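/- **Conventions.** Let $k$ be a commutative ring and $A$, $U$ associative unital $k$-algebras; unadorned tensor products are over $k$. *Left bialgebroid.* A left bialgebroid $U$ over $A$ consists of a $k$-algebra map $\eta:A\otimes A^{op}\to U$, with source map $s(a)=\eta(a\otimes 1)$ and target map $t(a)=\eta(1\otimes a)$, and of $k$-linear maps $\Delta:U\to U_\triangleleft\otimes_A{}_\triangleright U$, $u\mapsto u_{(1)}\otimes u_{(2)}$, and $\varepsilon:U\to A$. Here $a\triangleright u=s(a)u$, $u\triangleleft a=t(a)u$, $a\blacktriangleright u=u\,t(a)$, $u\blacktriangleleft a=u\,s(a)$, and $U_\triangleleft\otimes_A{}_\triangleright U$ is $U\otimes U$ modulo $t(a)u\otimes v-u\otimes s(a)v$. The axioms are: $\Delta$ and $\varepsilon$ are maps of $A$-bimodules, $\Delta(s(a)t(b)u)=s(a)u_{(1)}\otimes t(b)u_{(2)}$ and $\varepsilon(s(a)t(b)u)=a\,\varepsilon(u)\,b$; $\Delta$ is coassociative with counit $\varepsilon$, i.e. $s(\varepsilon(u_{(1)}))u_{(2)}=u=t(\varepsilon(u_{(2)}))u_{(1)}$; $u_{(1)}t(a)\otimes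 u_{(2)}=u_{(1)}\otimes u_{(2)}s(a)$, $\Delta(1)=1\otimes1$, $\Delta(uv)=u_{(1)}v_{(1)}\otimes u_{(2)}v_{(2)}$; $\varepsilon(1)=1$ and $\varepsilon(u\,s(\varepsilon(v)))=\varepsilon(uv)=\varepsilon(u\,t(\varepsilon(v)))$. It is a *left Hopf algebroid* if the map ${}_\blacktriangleright U\otimes_{A^{op}}U_\triangleleft\to U_\triangleleft\otimes_A{}_\triangleright U$, $u\otimes v\mapsto u_{(1)}\otimes u_{(2)}v$, is bijective, where in the source $u\,t(a)\otimes v=u\otimes t(a)v$; then $u_+\otimes u_-$ denotes the preimage of $u\otimes1$. *Module-comodule.* A module-comodule $M$ over $U$ is a right $U$-module (with compatible $k$-module structure) together with a left $U$-comodule structure $M\to U_\triangleleft\otimes_A{}_\blacktriangleright M$, $m\mapsto m_{(-1)}\otimes m_{(0)}$, on the left $A$-module with action $a\blacktriangleright m=m\,t(a)$; the coaction is left $A$-linear, $(a\blacktriangleright m)\mapsto s(a)m_{(-1)}\otimes m_{(0)}$, coassociative and counital. No compatibility between action and coaction is required. *Chains.* Let $C_n(U,M)=M\otimes_{A^{op}}U^{\otimes_{A^{op}}n}$,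 with elements $(m,u^1,\dots,u^n)$, where $(a\blacktriangleright m,u^1,\dots)=(m,u^1\triangleleft a,\dots)$ and $(\dots,a\blacktriangleright u^i,u^{i+1},\dots)=(\dots,u^i,u^{i+1}\triangleleft a,\dots)$, and $C_\bullet(U,M)=\bigoplus_{n\ge0}C_n(U,M)$. Put $$d_i(m,u^1,\dots,u^n)=\begin{cases}(m,u^1,\dots,\varepsilon(u^n)\blacktriangleright u^{n-1})&i=0\\(m,\dots,u^{n-i}u^{n-i+1},\dots,u^n)&1\le i\le n-1\\(mu^1,u^2,\dots,u^n)&i=n\end{cases}$$ for $n\ge 1$ (with $d_0(m,u)=\varepsilon(u)\blacktriangleright m$ for $n=1$), $s_j(m,u^1,\dots,u^n)=(m,\dots,u^{n-j},1,u^{n-j+1},\dots,u^n)$ for $0\le j\le n$, and $$t(m,u^1,\dots,u^n)=(m_{(0)}u^1_+,u^2_+,\dots,u^n_+,u^n_-\cdots u^1_-m_{(-1)}),\qquad t(m)=m_{(0)}m_{(-1)}\ (n=0).$$ On $C_n(U,M)$ let $T=t^{n+1}$, $b=\sum_{i=0}^n(-1)^id_i$ ($b=0$ for $n=0$), $N=\sum_{i=0}^n(-1)^{in}t^i$,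 $s_{-1}=t\,s_n$ and $B=(\mathrm{id}-t)s_{-1}N$. Let $\bar C^{cyc}_\bullet(U,M)$ be the quotient of $C^{cyc}_\bullet(U,M)=C_\bullet(U,M)/\mathrm{im}(\mathrm{id}-T)$ by the images of the degeneracies $s_j$, $0\le j\le n$. *Cochains.* Let $C^p(U,A)=\mathrm{Hom}_{A^{op}}((U^{\otimes_{A^{op}}p})_\triangleleft,A)$, i.e. $\varphi(u^1\triangleleft a,u^2,\dots,u^p)=\varphi(u^1,\dots,u^p)a$, and $C^0(U,A)=A$. The differential is $$\delta\varphi(u^1,\dots,u^{p+1})=\varepsilon\big(u^1s(\varphi(u^2,\dots,u^{p+1}))\big)+\sum_{i=1}^p(-1)^i\varphi(\dots,u^iu^{i+1},\dots)+(-1)^{p+1}\varphi(u^1,\dots,u^{p-1},\varepsilon(u^{p+1})\blacktriangleright u^p),$$ and $\delta a(u)=\varepsilon(u\,s(a))-a\,\varepsilon(u)$ for $p=0$. For $\varphi\in C^p(U,A)$ put $D_\varphi(u^1,\dots,u^p)=\varphi(u^1_{(1)},\dots,u^p_{(1)})\triangleright u^1_{(2)}\cdots u^p_{(2)}$ (so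 $D_a=s(a)$ for $p=0$), and, on $C_n(U,M)$ with $n\ge p$, $$D^{i\text{-th}}_\varphi(m,u^1,\dots,u^n)=(m,u^1,\dots,u^{i-1},D_\varphi(u^i,\dots,u^{i+p-1}),u^{i+p},\dots,u^n),\quad 1\le i\le n-p+1,$$ with $D'_\varphi=D^{(n-p+1)\text{-th}}_\varphi$. Let $C^p_M(U)\subseteq C^p(U,A)$ consist of those $\varphi$ for which all $D_\varphi^{i\text{-th}}$ map $\mathrm{im}(\mathrm{id}-T)$ into $\mathrm{im}(\mathrm{id}-T)$, and let $\bar C^p_M(U)\subseteq C^p_M(U)$ consist of those $\varphi$ which moreover vanish whenever one of their arguments is $1$. *Operators.* Write $|p|=p-1$, $|i|=i-1$, $|j|=j-1$. On $C_n(U,M)$ put: * $\iota_\varphi(m,u^1,\dots,u^n)=(m,u^1,\dots,u^{n-p-1},\varphi(u^{n-p+1},\dots,u^n)\blacktriangleright u^{n-p})$ for $p\le n$ (for $p=n$ it is $\varphi(u^1,\dots,u^n)\blacktriangleright m$), and $\iota_\varphi=0$ for $p>n$; * $L_\varphi=\sum_{i=1}^{n-|p|}(-1)^{|p|(n-|i|)}\,t^{n-|p|-i}D'_\varphi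 t^{i+p}+\sum_{i=1}^{p}(-1)^{n|i|+|p|}\,t^{n-|p|}D'_\varphi t^i$ for $p\le n$, $L_\varphi=(-1)^{|p|}\iota_\varphi B$ for $p=n+1$, and $L_\varphi=0$ for $p>n+1$; * $S_\varphi=\sum_{j=0}^{n-p}\sum_{i=0}^{j}(-1)^{nj+|p|i}\,s_{-1}\,t^{n-p-i}D'_\varphi\,t^{n+i-|j|}$ for $p\le n$, and $S_\varphi=0$ for $p>n$. **Theorem (Cartan–Rinehart homotopy formula).** Let $M$ be a module-comodule over a left Hopf algebroid $U$, let $p\ge0$ and $\varphi\in\bar C^p_M(U)$. Then $b$, $B$, $\iota_\varphi$, $S_\varphi$, $L_\varphi$, $\iota_{\delta\varphi}$ and $S_{\delta\varphi}$ descend to $\bar C^{cyc}_\bullet(U,M)$, and there $$L_\varphi=[B+b,\;S_\varphi+\iota_\varphi]-\iota_{\delta\varphi}-S_{\delta\varphi},$$ where $[X,Y]=XY-(-1)^{p}YX$ is the graded commutator for $X=B+b$ (odd) and $Y=S_\varphi+\iota_\varphi$ (of parity $p$). -/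

import Mathlib

open scoped TensorProduct RightActions

namespace HopfAlgd

/-! ### Balanced tensor products over a noncommutative base algebra -/

section Balanced

variable {k A X Y Z : Type*} [CommRing k]
  [AddCommGroup X] [Module k X] [AddCommGroup Y] [Module k Y] [AddCommGroup Z] [Module k Z]

/-- The `k`-span of all `(x ↼ a) ⊗ y - x ⊗ (a ⇀ y)`, where `↼` and `⇀` are the two families of
operators `ρ` and `l` indexed by `A`. -/
def balRel (ρ : A → X →ₗ[k] X) (l : A → Y →ₗ[k] Y) : Submodule k (X ⊗[k] Y) :=
  Submodule.span k {z | ∃ a x y, z = ρ a x ⊗ₜ[k] y - x ⊗ₜ[k] l a y}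

/-- The balanced tensor product of `X` and `Y` with respect to the operators `ρ` and `l`. -/
abbrev BalTensor (ρ : A → X →ₗ[k] X) (l : A → Y →ₗ[k] Y) : Type _ := (X ⊗[k] Y) ⧸ balRel ρ l

/-- The `k`-span of the balancing relations in a threefold tensor product. -/
def triRel (ρ₁ : A → X →ₗ[k] X) (l₁ ρ₂ : A → Y →ₗ[k] Y) (l₂ : A → Z →ₗ[k] Z) :
    Submodule k (X ⊗[k] (Y ⊗[k] Z)) :=
  Submodule.span k
    ({w | ∃ a x y z, w = ρ₁ a x ⊗ₜ[k] (y ⊗ₜ[k] z) - x ⊗ₜ[k] (l₁ a y ⊗ₜ[k] z)} ∪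
     {w | ∃ a x y z, w = x ⊗ₜ[k] (ρ₂ a y ⊗ₜ[k] z) - x ⊗ₜ[k] (y ⊗ₜ[k] l₂ a z)})

/-- The canonical projection to the balanced tensor product. -/
def balMk (ρ : A → X →ₗ[k] X) (l : A → Y →ₗ[k] Y) : X ⊗[k] Y →ₗ[k] BalTensor ρ l :=
  (balRel ρ l).mkQ

theorem balMk_surjective (ρ : A → X →ₗ[k] X) (l : A → Y →ₗ[k] Y) (z : BalTensor ρ l) :
    ∃ x, balMk ρ l x = z := (balRel ρ l).mkQ_surjective z

theorem balMk_bal (ρ : A → X →ₗ[k] X) (l : A → Y →ₗ[k] Y) (a : A) (x : X) (y : Y) :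
    balMk ρ l (ρ a x ⊗ₜ[k] y) = balMk ρ l (x ⊗ₜ[k] l a y) := by
  rw [← sub_eq_zero, ← map_sub]
  exact (Submodule.Quotient.mk_eq_zero _).2 (Submodule.subset_span ⟨a, x, y, rfl⟩)

/-- Linear maps out of a balanced tensor product. -/
def balLift {ρ : A → X →ₗ[k] X} {l : A → Y →ₗ[k] Y} (f : X ⊗[k] Y →ₗ[k] Z)
    (h : ∀ a x y, f (ρ a x ⊗ₜ[k] y) = f (x ⊗ₜ[k] l a y)) : BalTensor ρ l →ₗ[k] Z :=
  (balRel ρ l).liftQ f (by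
    rw [balRel, Submodule.span_le]
    rintro _ ⟨a, x, y, rfl⟩
    simp [h])

@[simp] theorem balLift_mk {ρ : A → X →ₗ[k] X} {l : A → Y →ₗ[k] Y} (f : X ⊗[k] Y →ₗ[k] Z)
    (h : ∀ a x y, f (ρ a x ⊗ₜ[k] y) = f (x ⊗ₜ[k] l a y)) (x : X ⊗[k] Y) :
    balLift f h (balMk ρ l x) = f x := rfl

theorem bal_ext {ρ : A → X →ₗ[k] X} {l : A → Y →ₗ[k] Y} {f g : BalTensor ρ l →ₗ[k] Z}
    (h : ∀ x y, f (balMk ρ l (x ⊗ₜ[k] y)) = g (balMk ρ l (x ⊗ₜ[k] y))) : f = g := by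
  apply Submodule.linearMap_qext
  exact TensorProduct.ext (LinearMap.ext fun x => LinearMap.ext fun y => h x y)

end Balanced

theorem split_word {U : Type*} {l : List U} {r q : ℕ} (h : r + q ≤ l.length) :
    ∃ l₁ l₂ l₃, l = l₁ ++ (l₂ ++ l₃) ∧ l₁.length = r ∧ l₂.length = q :=
  ⟨l.take r, (l.drop r).take q, (l.drop r).drop q, by simp, by simp; omega, by simp; omega⟩

theorem split_word₂ {U : Type*} {l : List U} {r : ℕ} (h : r ≤ l.length) :
    ∃ l₁ l₂, l = l₁ ++ l₂ ∧ l₁.length = r :=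
  ⟨l.take r, l.drop r, by simp, by simp; omega⟩

/-! ### Source and target maps -/

section Words

variable {k A U : Type*} [CommRing k] [Ring A] [Algebra k A] [Ring U] [Algebra k U]
  (η : A ⊗[k] Aᵐᵒᵖ →ₐ[k] U)

/-- The source map `s a = η (a ⊗ 1)`. -/
def src (a : A) : U := η (a ⊗ₜ[k] 1)

/-- The target map `t a = η (1 ⊗ a)`. -/
def tgt (a : A) : U := η (1 ⊗ₜ[k] MulOpposite.op a)

theorem src_mul (a b : A) : src η (a * b) = src η a * src η b := by
  simp [src, ← map_mul]

theorem tgt_mul (a b : A) : tgt η (a * b) = tgt η b * tgt η a := by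
  simp [tgt, ← map_mul]

theorem src_tgt (a b : A) : src η a * tgt η b = tgt η b * src η a := by
  simp [src, tgt, ← map_mul]

@[simp] theorem src_one : src η 1 = 1 := by
  simp only [src, ← Algebra.TensorProduct.one_def, map_one]

@[simp] theorem tgt_one : tgt η 1 = 1 := by
  simp only [tgt, MulOpposite.op_one, ← Algebra.TensorProduct.one_def, map_one]

theorem src_add (a b : A) : src η (a + b) = src η a + src η b := by
  simp [src, TensorProduct.add_tmul]

theorem tgt_add (a b : A) : tgt η (a + b) = tgt η a + tgt η b := by
  simp [tgt, TensorProduct.tmul_add]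

theorem src_smul (c : k) (a : A) : src η (c • a) = c • src η a := by
  simp [src, ← TensorProduct.smul_tmul']

theorem tgt_smul (c : k) (a : A) : tgt η (c • a) = c • tgt η a := by
  simp [tgt]

/-- `s` as a homomorphism of algebras. -/
def srcHom : A →ₐ[k] U := η.comp Algebra.TensorProduct.includeLeft

theorem srcHom_apply (a : A) : srcHom η a = src η a := rfl

/-! ### Words: the graded module of chains `M ⊗ U ⊗ ⋯ ⊗ U` -/

variable {M : Type*} [AddCommGroup M] [Module k M] (ρ : A →ₐ[k] Module.End k M)

/-- The defining relations of `⨁ₙ M ⊗ U ⊗ ⋯ ⊗ U` (`n` factors `U`, tensor products over `Aᵒᵖ`)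
as a quotient of the free `k`-module on all words `(m, u¹, …, uⁿ)`: multilinearity over `k`,
`(a ⇀ m, u¹, …) = (m, t(a) u¹, …)` and `(…, uⁱ t(a), uⁱ⁺¹, …) = (…, uⁱ, t(a) uⁱ⁺¹, …)`. -/
inductive WordRel : ((M × List U) →₀ k) → Prop
  | add_left (m m₁ : M) (l : List U) : WordRel (Finsupp.single (m + m₁, l) 1
      - (Finsupp.single (m, l) 1 + Finsupp.single (m₁, l) 1))
  | smul_left (c : k) (m : M) (l : List U) :
      WordRel (Finsupp.single (c • m, l) 1 - c • Finsupp.single (m, l) 1)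
  | add_letter (m : M) (l₁ : List U) (u v : U) (l₂ : List U) :
      WordRel (Finsupp.single (m, l₁ ++ (u + v) :: l₂) 1
        - (Finsupp.single (m, l₁ ++ u :: l₂) 1 + Finsupp.single (m, l₁ ++ v :: l₂) 1))
  | smul_letter (c : k) (m : M) (l₁ : List U) (u : U) (l₂ : List U) :
      WordRel (Finsupp.single (m, l₁ ++ (c • u) :: l₂) 1
        - c • Finsupp.single (m, l₁ ++ u :: l₂) 1)
  | front (a : A) (m : M) (u : U) (l : List U) :
      WordRel (Finsupp.single (ρ a m, u :: l) 1 - Finsupp.single (m, (tgt η a * u) :: l) 1)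
  | inner (a : A) (m : M) (l₁ : List U) (u v : U) (l₂ : List U) :
      WordRel (Finsupp.single (m, l₁ ++ (u * tgt η a) :: v :: l₂) 1
        - Finsupp.single (m, l₁ ++ u :: (tgt η a * v) :: l₂) 1)

/-- The total module `⨁ₙ M ⊗ U ⊗ ⋯ ⊗ U` (`n` factors `U`, tensor products over `Aᵒᵖ`); as all
relations are homogeneous, it is graded by the length `n` of the words. -/
def Words : Type _ := ((M × List U) →₀ k) ⧸ Submodule.span k {z | WordRel η ρ z}

noncomputable instance : AddCommGroup (Words η ρ) :=
  inferInstanceAs (AddCommGroup (((M × List U) →₀ k) ⧸ Submodule.span k {z | WordRel η ρ z}))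

noncomputable instance : Module k (Words η ρ) :=
  inferInstanceAs (Module k (((M × List U) →₀ k) ⧸ Submodule.span k {z | WordRel η ρ z}))

/-- The elementary tensor `(m, u¹, …, uⁿ)`. -/
noncomputable def wmk (m : M) (l : List U) : Words η ρ :=
  (Submodule.span k {z | WordRel η ρ z}).mkQ (Finsupp.single (m, l) 1)

/-- The functions on words that define a linear map on `Words η ρ`. -/
structure IsWordMap {Z : Type*} [AddCommGroup Z] [Module k Z] (F : M → List U → Z) : Prop where
  lin_left : ∀ l, IsLinearMap k (fun m => F m l)
  lin_letter : ∀ m l₁ l₂, IsLinearMap k (fun u => F m (l₁ ++ u :: l₂))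
  front : ∀ a m u l, F (ρ a m) (u :: l) = F m ((tgt η a * u) :: l)
  inner : ∀ a m l₁ u v l₂,
    F m (l₁ ++ (u * tgt η a) :: v :: l₂) = F m (l₁ ++ u :: (tgt η a * v) :: l₂)

variable {η ρ} {Z : Type*} [AddCommGroup Z] [Module k Z]

/-- The linear map on `Words η ρ` with prescribed values on elementary tensors. -/
noncomputable def wlift (F : M → List U → Z) (h : IsWordMap η ρ F) : Words η ρ →ₗ[k] Z :=
  (Submodule.span k {z | WordRel η ρ z}).liftQ
    (Finsupp.linearCombination k (fun x : M × List U => F x.1 x.2)) (by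
      rw [Submodule.span_le]
      rintro _ (⟨m, m₁, l⟩ | ⟨c, m, l⟩ | ⟨m, l₁, u, v, l₂⟩ | ⟨c, m, l₁, u, l₂⟩ | ⟨a, m, u, l⟩ |
        ⟨a, m, l₁, u, v, l₂⟩)
      · simp [(h.lin_left l).map_add]
      · simp [(h.lin_left l).map_smul]
      · simp [(h.lin_letter m l₁ l₂).map_add]
      · simp [(h.lin_letter m l₁ l₂).map_smul]
      · simp [h.front]
      · simp [h.inner])

@[simp] theorem wlift_mk (F : M → List U → Z) (h : IsWordMap η ρ F) (m : M) (l : List U) :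
    wlift F h (wmk η ρ m l) = F m l := by
  change Finsupp.linearCombination k (fun x : M × List U => F x.1 x.2) (Finsupp.single (m, l) 1) = _
  simp

theorem wext {f g : Words η ρ →ₗ[k] Z} (h : ∀ m l, f (wmk η ρ m l) = g (wmk η ρ m l)) :
    f = g := by
  apply Submodule.linearMap_qext
  apply Finsupp.lhom_ext'
  rintro ⟨m, l⟩
  apply LinearMap.ext_ring
  exact h m l

theorem wmk_eq {x y : (M × List U) →₀ k} (h : WordRel η ρ (x - y)) :
    (Submodule.span k {z | WordRel η ρ z}).mkQ x
      = (Submodule.span k {z | WordRel η ρ z}).mkQ y := by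
  rw [← sub_eq_zero, ← map_sub]
  exact (Submodule.Quotient.mk_eq_zero _).2 (Submodule.subset_span h)

variable (η ρ)

theorem wmk_isWordMap : IsWordMap η ρ (wmk η ρ) where
  lin_left l := ⟨fun m m₁ => (wmk_eq (.add_left m m₁ l)).trans (map_add _ _ _),
    fun c m => (wmk_eq (.smul_left c m l)).trans (map_smul _ _ _)⟩
  lin_letter m l₁ l₂ := ⟨fun u v => (wmk_eq (.add_letter m l₁ u v l₂)).trans (map_add _ _ _),
    fun c u => (wmk_eq (.smul_letter c m l₁ u l₂)).trans (map_smul _ _ _)⟩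
  front a m u l := wmk_eq (.front a m u l)
  inner a m l₁ u v l₂ := wmk_eq (.inner a m l₁ u v l₂)

variable {η ρ}

theorem IsWordMap.comp {Z₁ : Type*} [AddCommGroup Z₁] [Module k Z₁] {F : M → List U → Z}
    (h : IsWordMap η ρ F) (g : Z →ₗ[k] Z₁) : IsWordMap η ρ (fun m l => g (F m l)) where
  lin_left l := (g.comp (h.lin_left l).mk').isLinear
  lin_letter m l₁ l₂ := (g.comp (h.lin_letter m l₁ l₂).mk').isLinear
  front a m u l := by rw [h.front]
  inner a m l₁ u v l₂ := by rw [h.inner]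

/-- The operator that acts as `F n` on the component of degree `n`. -/
noncomputable def gr (F : ℕ → Module.End k (Words η ρ)) : Module.End k (Words η ρ) :=
  wlift (fun m l => F l.length (wmk η ρ m l))
    { lin_left := fun l => ((wmk_isWordMap η ρ).comp (F l.length)).lin_left l
      lin_letter := fun m l₁ l₂ => by
        simpa using ((wmk_isWordMap η ρ).comp (F (l₁.length + (l₂.length + 1)))).lin_letter m l₁ l₂
      front := fun a m u l => by
        simpa using ((wmk_isWordMap η ρ).comp (F (l.length + 1))).front a m u l
      inner := fun a m l₁ u v l₂ => by
        simpa using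
          ((wmk_isWordMap η ρ).comp (F (l₁.length + (l₂.length + 1 + 1)))).inner a m l₁ u v l₂ }

theorem gr_mk (F : ℕ → Module.End k (Words η ρ)) (m : M) (l : List U) :
    gr F (wmk η ρ m l) = F l.length (wmk η ρ m l) := wlift_mk _ _ _ _

/-! ### Basic operators on words -/

/-- The operator `(m, u¹, …, uⁿ) ↦ (m, u¹, …, uⁿ, v)`. -/
noncomputable def app (v : U) : Module.End k (Words η ρ) :=
  wlift (fun m l => wmk η ρ m (l ++ [v]))
    { lin_left := fun l => (wmk_isWordMap η ρ).lin_left _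
      lin_letter := fun m l₁ l₂ => by
        simpa using (wmk_isWordMap η ρ).lin_letter m l₁ (l₂ ++ [v])
      front := fun a m u l => (wmk_isWordMap η ρ).front a m u _
      inner := fun a m l₁ u w l₂ => by
        simpa using (wmk_isWordMap η ρ).inner a m l₁ u w (l₂ ++ [v]) }

@[simp] theorem app_mk (v : U) (m : M) (l : List U) :
    app v (wmk η ρ m l) = wmk η ρ m (l ++ [v]) := wlift_mk _ _ _ _

variable (η ρ) in
/-- The action `a ⇀ ·` through the last letter, on words:
`(m, u¹, …, uⁿ) ↦ (m, u¹, …, uⁿ t(a))`, and `m ↦ a ⇀ m` for `n = 0`. -/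
noncomputable def actFun (a : A) (m : M) (l : List U) : Words η ρ :=
  match l.getLast? with
  | none => wmk η ρ (ρ a m) []
  | some u => wmk η ρ m (l.dropLast ++ [u * tgt η a])

@[simp] theorem actFun_nil (a : A) (m : M) : actFun η ρ a m [] = wmk η ρ (ρ a m) [] := rfl

@[simp] theorem actFun_concat (a : A) (m : M) (l : List U) (u : U) :
    actFun η ρ a m (l ++ [u]) = wmk η ρ m (l ++ [u * tgt η a]) := by
  simp [actFun]

theorem actFun_isWordMap (a : A) : IsWordMap η ρ (actFun η ρ a) where
  lin_left l := by
    rcases List.eq_nil_or_concat l with rfl | ⟨l, u, rfl⟩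
    · exact (((wmk_isWordMap η ρ).lin_left []).mk'.comp (ρ a)).isLinear
    · simpa using (wmk_isWordMap η ρ).lin_left _
  lin_letter m l₁ l₂ := by
    rcases List.eq_nil_or_concat l₂ with rfl | ⟨l, u, rfl⟩
    · simp_rw [actFun_concat]
      exact (((wmk_isWordMap η ρ).lin_letter m l₁ []).mk'.comp
        (LinearMap.mulRight k (tgt η a))).isLinear
    · simp_rw [List.concat_eq_append, ← List.cons_append, ← List.append_assoc, actFun_concat]
      simpa using (wmk_isWordMap η ρ).lin_letter m l₁ (l ++ [u * tgt η a])
  front b m u l := by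
    rcases List.eq_nil_or_concat l with rfl | ⟨l, v, rfl⟩
    · rw [← List.nil_append [u], ← List.nil_append [tgt η b * u], actFun_concat, actFun_concat]
      simpa [mul_assoc] using (wmk_isWordMap η ρ).front b m (u * tgt η a) []
    · simp_rw [List.concat_eq_append, ← List.cons_append, actFun_concat]
      exact (wmk_isWordMap η ρ).front b m u _
  inner b m l₁ u v l₂ := by
    rcases List.eq_nil_or_concat l₂ with rfl | ⟨l, w, rfl⟩
    · have h := fun x y : U => actFun_concat (η := η) (ρ := ρ) a m (l₁ ++ [x]) y
      simp only [List.append_assoc, List.cons_append, List.nil_append] at h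
      rw [h, h]
      simpa [mul_assoc] using (wmk_isWordMap η ρ).inner b m l₁ u (v * tgt η a) []
    · have h := fun x y : U => actFun_concat (η := η) (ρ := ρ) a m (l₁ ++ x :: y :: l) w
      simp only [List.append_assoc, List.cons_append] at h
      rw [List.concat_eq_append, h, h]
      exact (wmk_isWordMap η ρ).inner b m l₁ u v _

variable (η ρ) in
/-- The action `a ⇀ ·` through the last letter. -/
noncomputable def act (a : A) : Module.End k (Words η ρ) :=
  wlift (actFun η ρ a) (actFun_isWordMap a)

@[simp] theorem act_mk_nil (a : A) (m : M) :
    act η ρ a (wmk η ρ m []) = wmk η ρ (ρ a m) [] := wlift_mk _ _ _ _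

@[simp] theorem act_mk_concat (a : A) (m : M) (l : List U) (u : U) :
    act η ρ a (wmk η ρ m (l ++ [u])) = wmk η ρ m (l ++ [u * tgt η a]) :=
  (wlift_mk _ _ _ _).trans (actFun_concat _ _ _ _)

theorem act_add (a b : A) : act η ρ (a + b) = act η ρ a + act η ρ b := by
  refine wext fun m l => ?_
  rcases List.eq_nil_or_concat l with rfl | ⟨l, u, rfl⟩
  · simp [((wmk_isWordMap η ρ).lin_left []).map_add]
  · simp [tgt_add, mul_add, ((wmk_isWordMap η ρ).lin_letter m l []).map_add]

theorem act_smul (c : k) (a : A) : act η ρ (c • a) = c • act η ρ a := by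
  refine wext fun m l => ?_
  rcases List.eq_nil_or_concat l with rfl | ⟨l, u, rfl⟩
  · simp [((wmk_isWordMap η ρ).lin_left []).map_smul]
  · simp [tgt_smul, ((wmk_isWordMap η ρ).lin_letter m l []).map_smul]

theorem act_mul (a b : A) : act η ρ (a * b) = act η ρ a * act η ρ b := by
  refine wext fun m l => ?_
  rcases List.eq_nil_or_concat l with rfl | ⟨l, u, rfl⟩
  · simp
  · simp [tgt_mul, mul_assoc]

theorem app_add (v w : U) : (app (v + w) : Module.End k (Words η ρ)) = app v + app w :=
  wext fun m l => by simp [((wmk_isWordMap η ρ).lin_letter m l []).map_add]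

theorem app_smul (c : k) (v : U) : (app (c • v) : Module.End k (Words η ρ)) = c • app v :=
  wext fun m l => by simp [((wmk_isWordMap η ρ).lin_letter m l []).map_smul]

theorem app_act (a : A) (v : U) : app v * act η ρ a = app (tgt η a * v) := by
  refine wext fun m l => ?_
  rcases List.eq_nil_or_concat l with rfl | ⟨l, u, rfl⟩
  · simpa using (wmk_isWordMap η ρ).front a m v []
  · simpa using (wmk_isWordMap η ρ).inner a m l u v []

theorem act_app (a : A) (v : U) : act η ρ a * app v = app (v * tgt η a) :=
  wext fun m l => by simp

variable (η) in
/-- Functions `f` of words `u¹, …, u^q` in `U` that may be inserted into longer words: `f` is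
multilinear over `k`, balanced, and compatible with the actions on the outer letters. -/
structure IsSlotMap (f : List U → U) : Prop where
  lin : ∀ l₁ l₂, IsLinearMap k (fun u => f (l₁ ++ u :: l₂))
  inner : ∀ a l₁ u v l₂,
    f (l₁ ++ (u * tgt η a) :: v :: l₂) = f (l₁ ++ u :: (tgt η a * v) :: l₂)
  front : ∀ a u l, f ((tgt η a * u) :: l) = tgt η a * f (u :: l)
  back : ∀ a u l, f (l ++ [u * tgt η a]) = f (l ++ [u]) * tgt η a
  nil : ∀ a, tgt η a * f [] = f [] * tgt η a

variable (η) in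
theorem prod_isSlotMap : IsSlotMap η (List.prod : List U → U) where
  lin l₁ l₂ := ⟨fun u v => by simp [add_mul, mul_add], fun c u => by simp⟩
  inner a l₁ u v l₂ := by simp [mul_assoc]
  front a u l := by simp [mul_assoc]
  back a u l := by simp [mul_assoc]
  nil a := by simp

variable (η ρ) in
/-- `(m, u¹, …, uⁿ) ↦ (m, u¹, …, uʳ, f(uʳ⁺¹, …, u^{r+q}), u^{r+q+1}, …, uⁿ)` if `r + q ≤ n`,
and `0` otherwise. -/
noncomputable def slotFun (r q : ℕ) (f : List U → U) (m : M) (l : List U) : Words η ρ :=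
  if r + q ≤ l.length then
    wmk η ρ m (l.take r ++ f ((l.drop r).take q) :: l.drop (r + q)) else 0

theorem slotFun_eq (f : List U → U) (m : M) (l₁ l₂ l₃ : List U) :
    slotFun η ρ l₁.length l₂.length f m (l₁ ++ (l₂ ++ l₃)) = wmk η ρ m (l₁ ++ f l₂ :: l₃) := by
  simp [slotFun, ← List.drop_drop]

theorem slotFun_isWordMap (r q : ℕ) {f : List U → U} (hf : IsSlotMap (k := k) η f) :
    IsWordMap η ρ (slotFun η ρ r q f) where
  lin_left l := by
    by_cases h : r + q ≤ l.length
    · obtain ⟨l₁, l₂, l₃, rfl, rfl, rfl⟩ := split_word h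
      simp_rw [slotFun_eq]
      exact (wmk_isWordMap η ρ).lin_left _
    · simp only [slotFun, h, if_false]
      exact (0 : M →ₗ[k] Words η ρ).isLinear
  lin_letter m l₁ l₂ := by
    by_cases h : r + q ≤ l₁.length + (l₂.length + 1)
    · by_cases h₁ : l₁.length < r
      · obtain ⟨a, b, c, rfl, ha, rfl⟩ :=
          split_word (l := l₂) (r := r - l₁.length - 1) (q := q) (by omega)
        have hr : ∀ u : U, r = (l₁ ++ u :: a).length := fun u => by simp; omega
        have := fun u : U => slotFun_eq (η := η) (ρ := ρ) f m (l₁ ++ u :: a) b c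
        simp_rw [← hr] at this
        simp only [List.append_assoc, List.cons_append] at this
        simp_rw [this]
        exact (wmk_isWordMap η ρ).lin_letter _ _ _
      · obtain ⟨a, d, rfl, rfl⟩ := split_word₂ (l := l₁) (r := r) (by omega)
        by_cases h₂ : d.length < q
        · obtain ⟨b, c, rfl, hb⟩ := split_word₂ (l := l₂) (r := q - d.length - 1)
            (by simp at h; omega)
          have hr : ∀ u : U, q = (d ++ u :: b).length := fun u => by simp; omega
          have := fun u : U => slotFun_eq (η := η) (ρ := ρ) f m a (d ++ u :: b) c
          simp_rw [← hr] at this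
          simp only [List.append_assoc, List.cons_append] at this ⊢
          simp_rw [this]
          exact (((wmk_isWordMap η ρ).lin_letter m a c).mk'.comp (hf.lin d b).mk').isLinear
        · obtain ⟨b, c, rfl, rfl⟩ := split_word₂ (l := d) (r := q) (by omega)
          have := fun u : U => slotFun_eq (η := η) (ρ := ρ) f m a b (c ++ u :: l₂)
          simp only [List.append_assoc] at this ⊢
          simp_rw [this]
          simpa using (wmk_isWordMap η ρ).lin_letter m (a ++ f b :: c) l₂
    · simp only [slotFun, List.length_append, List.length_cons, h, if_false]
      exact (0 : U →ₗ[k] Words η ρ).isLinear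
  front a m u l := by
    by_cases h : r + q ≤ l.length + 1
    · rcases r with _ | r
      · rcases q with _ | q
        · have := fun m (u : U) => slotFun_eq (η := η) (ρ := ρ) f m [] [] (u :: l)
          simp only [List.length_nil, List.nil_append] at this
          rw [this, this, (wmk_isWordMap η ρ).front, hf.nil]
          exact (wmk_isWordMap η ρ).inner a m [] _ _ _
        · obtain ⟨b, c, rfl, rfl⟩ := split_word₂ (l := l) (r := q) (by omega)
          have := fun m (u : U) => slotFun_eq (η := η) (ρ := ρ) f m [] (u :: b) c
          simp only [List.length_nil, List.nil_append, List.length_cons, List.cons_append] at this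
          rw [this, this, (wmk_isWordMap η ρ).front, hf.front]
      · obtain ⟨b, c, d, rfl, rfl, rfl⟩ := split_word (l := l) (r := r) (q := q) (by omega)
        have := fun m (u : U) => slotFun_eq (η := η) (ρ := ρ) f m (u :: b) c d
        simp only [List.length_cons, List.cons_append] at this
        rw [this, this, (wmk_isWordMap η ρ).front]
    · simp [slotFun, h]
  inner a m l₁ u v l₂ := by
    by_cases h : r + q ≤ l₁.length + (l₂.length + 1 + 1)
    · by_cases h₁ : l₁.length + 1 < r
      · obtain ⟨b, c, d, rfl, hb, rfl⟩ :=
          split_word (l := l₂) (r := r - l₁.length - 2) (q := q) (by omega)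
        have hr : ∀ u v : U, r = (l₁ ++ u :: v :: b).length := fun u v => by simp; omega
        have := fun u v : U => slotFun_eq (η := η) (ρ := ρ) f m (l₁ ++ u :: v :: b) c d
        simp_rw [← hr] at this
        simp only [List.append_assoc, List.cons_append] at this
        rw [this, this]
        exact (wmk_isWordMap η ρ).inner _ _ _ _ _ _
      by_cases h₂ : l₁.length + 1 = r
      · have hr : ∀ u : U, r = (l₁ ++ [u]).length := fun u => by simp; omega
        rcases q with _ | q
        · have := fun u v : U => slotFun_eq (η := η) (ρ := ρ) f m (l₁ ++ [u]) [] (v :: l₂)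
          simp_rw [← hr] at this
          simp only [List.append_assoc, List.cons_append, List.nil_append, List.length_nil] at this
          rw [this, this, (wmk_isWordMap η ρ).inner, hf.nil]
          simpa using (wmk_isWordMap η ρ).inner a m (l₁ ++ [u]) (f []) v l₂
        · obtain ⟨b, c, rfl, rfl⟩ := split_word₂ (l := l₂) (r := q) (by omega)
          have := fun u v : U => slotFun_eq (η := η) (ρ := ρ) f m (l₁ ++ [u]) (v :: b) c
          simp_rw [← hr] at this
          simp only [List.append_assoc, List.cons_append, List.nil_append,
            List.length_cons] at this
          rw [this, this, (wmk_isWordMap η ρ).inner, hf.front]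
      obtain ⟨e, d, rfl, rfl⟩ := split_word₂ (l := l₁) (r := r) (by omega)
      by_cases h₃ : d.length + 1 < q
      · obtain ⟨b, c, rfl, hb⟩ := split_word₂ (l := l₂) (r := q - d.length - 2)
          (by simp at h; omega)
        have hr : ∀ u v : U, q = (d ++ u :: v :: b).length := fun u v => by simp; omega
        have := fun u v : U => slotFun_eq (η := η) (ρ := ρ) f m e (d ++ u :: v :: b) c
        simp_rw [← hr] at this
        simp only [List.append_assoc, List.cons_append] at this ⊢
        rw [this, this, hf.inner]
      by_cases h₄ : d.length + 1 = q
      · have hr : ∀ u : U, q = (d ++ [u]).length := fun u => by simp; omega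
        have := fun u v : U => slotFun_eq (η := η) (ρ := ρ) f m e (d ++ [u]) (v :: l₂)
        simp_rw [← hr] at this
        simp only [List.append_assoc, List.cons_append, List.nil_append] at this ⊢
        rw [this, this, hf.back, (wmk_isWordMap η ρ).inner]
      obtain ⟨b, c, rfl, rfl⟩ := split_word₂ (l := d) (r := q) (by omega)
      have := fun u v : U => slotFun_eq (η := η) (ρ := ρ) f m e b (c ++ u :: v :: l₂)
      simp only [List.append_assoc] at this ⊢
      rw [this, this]
      simpa using (wmk_isWordMap η ρ).inner a m (e ++ f b :: c) u v l₂
    · simp [slotFun, h]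

variable (ρ) in
/-- The operator `(m, u¹, …, uⁿ) ↦ (m, u¹, …, uʳ, f(uʳ⁺¹, …, u^{r+q}), u^{r+q+1}, …, uⁿ)` for
`r + q ≤ n`; it is `0` in the degrees `n < r + q`. -/
noncomputable def slot (r q : ℕ) {f : List U → U} (hf : IsSlotMap (k := k) η f) :
    Module.End k (Words η ρ) :=
  wlift (slotFun η ρ r q f) (slotFun_isWordMap r q hf)

variable (η) in
/-- A `p`-cochain, i.e. an element of `Hom_{Aᵒᵖ}((U ⊗ ⋯ ⊗ U)_◁, A)` (`p` factors `U`, tensor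
products over `Aᵒᵖ`), given by its values on words of length `p`. For `p = 0` this is an element
of `A`. -/
structure Cochain (p : ℕ) where
  toFun : List U → A
  off : ∀ l, l.length ≠ p → toFun l = 0
  lin : ∀ l₁ l₂, IsLinearMap k (fun u => toFun (l₁ ++ u :: l₂))
  inner : ∀ a l₁ u v l₂,
    toFun (l₁ ++ (u * tgt η a) :: v :: l₂) = toFun (l₁ ++ u :: (tgt η a * v) :: l₂)
  front : ∀ a u l, toFun ((tgt η a * u) :: l) = toFun (u :: l) * a

variable {p : ℕ} (φ : Cochain (k := k) η p)

variable (ρ) in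
/-- The function defining the cap product. -/
noncomputable def capFun (m : M) (l : List U) : Words η ρ :=
  if p ≤ l.length then
    act η ρ (φ.toFun (l.drop (l.length - p))) (wmk η ρ m (l.take (l.length - p))) else 0

theorem capFun_eq (m : M) (l₁ l₂ : List U) (h : l₂.length = p) :
    capFun ρ φ m (l₁ ++ l₂) = act η ρ (φ.toFun l₂) (wmk η ρ m l₁) := by
  subst h
  simp [capFun]

variable (η ρ) in
/-- `act` as a linear map. -/
noncomputable def actHom : A →ₗ[k] Module.End k (Words η ρ) where
  toFun := act η ρ
  map_add' := act_add
  map_smul' := act_smul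

theorem capFun_isWordMap : IsWordMap η ρ (capFun ρ φ) where
  lin_left l := by
    by_cases h : p ≤ l.length
    · obtain ⟨a, b, rfl, ha⟩ := split_word₂ (l := l) (r := l.length - p) (by omega)
      simp_rw [capFun_eq φ _ a b (by simp at ha h; omega)]
      exact ((wmk_isWordMap η ρ).comp (act η ρ _)).lin_left a
    · simp only [capFun, h, if_false]
      exact (0 : M →ₗ[k] Words η ρ).isLinear
  lin_letter m l₁ l₂ := by
    by_cases h : p ≤ l₁.length + (l₂.length + 1)
    · by_cases h₁ : l₂.length < p
      · obtain ⟨a, b, rfl, ha⟩ := split_word₂ (l := l₁)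
          (r := l₁.length + (l₂.length + 1) - p) (by omega)
        have := fun u : U => capFun_eq (ρ := ρ) φ m a (b ++ u :: l₂)
          (by simp at ha h ⊢; omega)
        simp only [List.append_assoc]
        simp_rw [this]
        exact (((LinearMap.applyₗ (wmk η ρ m a)).comp (actHom η ρ)).comp
          (φ.lin b l₂).mk').isLinear
      · obtain ⟨a, b, rfl, ha⟩ := split_word₂ (l := l₂) (r := l₂.length - p) (by omega)
        have := fun u : U => capFun_eq (ρ := ρ) φ m (l₁ ++ u :: a) b
          (by simp at ha h₁; omega)
        simp only [List.append_assoc, List.cons_append] at this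
        simp_rw [this]
        exact ((wmk_isWordMap η ρ).comp (act η ρ _)).lin_letter _ _ _
    · simp only [capFun, List.length_append, List.length_cons, h, if_false]
      exact (0 : U →ₗ[k] Words η ρ).isLinear
  front c m u l := by
    by_cases h : p ≤ l.length + 1
    · by_cases h₁ : p = l.length + 1
      · have := fun m (u : U) => capFun_eq (ρ := ρ) φ m [] (u :: l) (by simp [h₁])
        simp only [List.nil_append] at this
        rw [this, this, φ.front]
        simp
      · obtain ⟨a, b, rfl, ha⟩ := split_word₂ (l := l) (r := l.length - p) (by omega)
        have := fun m (u : U) => capFun_eq (ρ := ρ) φ m (u :: a) b (by simp at ha h h₁; omega)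
        simp only [List.cons_append] at this
        rw [this, this, (wmk_isWordMap η ρ).front]
    · simp [capFun, h]
  inner c m l₁ u v l₂ := by
    by_cases h : p ≤ l₁.length + (l₂.length + 1 + 1)
    · by_cases h₁ : p ≤ l₂.length
      · obtain ⟨a, b, rfl, ha⟩ := split_word₂ (l := l₂) (r := l₂.length - p) (by omega)
        have := fun u v : U => capFun_eq (ρ := ρ) φ m (l₁ ++ u :: v :: a) b
          (by simp at ha h₁; omega)
        simp only [List.append_assoc, List.cons_append] at this
        rw [this, this, (wmk_isWordMap η ρ).inner]
      by_cases h₂ : p = l₂.length + 1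
      · have := fun u v : U => capFun_eq (ρ := ρ) φ m (l₁ ++ [u]) (v :: l₂) (by simp [h₂])
        simp only [List.append_assoc, List.cons_append, List.nil_append] at this
        rw [this, this, φ.front]
        simp [tgt_mul, mul_assoc]
      · obtain ⟨a, b, rfl, ha⟩ := split_word₂ (l := l₁)
          (r := l₁.length + (l₂.length + 1 + 1) - p) (by omega)
        have := fun u v : U => capFun_eq (ρ := ρ) φ m a (b ++ u :: v :: l₂)
          (by simp at ha h ⊢; omega)
        simp only [List.append_assoc]
        rw [this, this, φ.inner]
    · simp [capFun, h]

variable (ρ) in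
/-- The cap product
`(m, u¹, …, uⁿ) ↦ (m, u¹, …, u^{n-p-1}, φ(u^{n-p+1}, …, uⁿ) ⇀ u^{n-p})`,
where `a ⇀ u = u t(a)`; for `n = p` it is `φ(u¹, …, uⁿ) ⇀ m`, for `n < p` it is `0`. -/
noncomputable def cap : Module.End k (Words η ρ) :=
  wlift (capFun ρ φ) (capFun_isWordMap φ)

end Words

/-! ### Left bialgebroids and left Hopf algebroids -/

/-- The tensor product `U_◁ ⊗ N` over `A`, balanced by `t(a) u ⊗ n = u ⊗ (a ⇀ n)`. -/
abbrev TensA {k A U N : Type*} [CommRing k] [Ring A] [Algebra k A] [Ring U] [Algebra k U]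
    [AddCommGroup N] [Module k N] (η : A ⊗[k] Aᵐᵒᵖ →ₐ[k] U) (l : A → N →ₗ[k] N) : Type _ :=
  BalTensor (fun a => LinearMap.mulLeft k (tgt η a)) l

/-- The canonical projection `U ⊗ N → U_◁ ⊗ N`. -/
abbrev tensMk {k A U N : Type*} [CommRing k] [Ring A] [Algebra k A] [Ring U] [Algebra k U]
    [AddCommGroup N] [Module k N] (η : A ⊗[k] Aᵐᵒᵖ →ₐ[k] U) (l : A → N →ₗ[k] N) :
    U ⊗[k] N →ₗ[k] TensA η l :=
  balMk (fun a => LinearMap.mulLeft k (tgt η a)) l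

/-- Left multiplication by `s(a)` on `U`. -/
abbrev lsrc {k A U : Type*} [CommRing k] [Ring A] [Algebra k A] [Ring U] [Algebra k U]
    (η : A ⊗[k] Aᵐᵒᵖ →ₐ[k] U) (a : A) : U →ₗ[k] U := LinearMap.mulLeft k (src η a)

/-- A left bialgebroid over `A`. All identities between elements of balanced tensor products are
stated in terms of arbitrary representatives `X` of `Δ u = u₁ ⊗ u₂` in `U ⊗[k] U`. -/
structure LeftBialgebroid (k A U : Type*) [CommRing k] [Ring A] [Algebra k A] [Ring U]
    [Algebra k U] where
  /-- The algebra map `A ⊗ Aᵒᵖ → U`. -/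
  η : A ⊗[k] Aᵐᵒᵖ →ₐ[k] U
  /-- The coproduct `U → U_◁ ⊗_A {}_▷U`. -/
  Δ : U →ₗ[k] TensA η (lsrc η)
  /-- The counit. -/
  ε : U →ₗ[k] A
  /-- `Δ(s(a) t(b) u) = s(a) u₁ ⊗ t(b) u₂`. -/
  Δ_bimod : ∀ (a b : A) (u : U) (X : U ⊗[k] U), tensMk η (lsrc η) X = Δ u →
    Δ (src η a * tgt η b * u) = tensMk η (lsrc η) ((src η a ⊗ₜ tgt η b) * X)
  /-- `ε(s(a) t(b) u) = a ε(u) b`. -/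
  ε_bimod : ∀ (a b : A) (u : U), ε (src η a * tgt η b * u) = a * ε u * b
  /-- `u₁₁ ⊗ u₁₂ ⊗ u₂ = u₁ ⊗ u₂₁ ⊗ u₂₂`. -/
  coassoc : ∀ (u : U) (X : U ⊗[k] U) (Y : (U ⊗[k] U) ⊗[k] U) (Z : U ⊗[k] (U ⊗[k] U)),
    tensMk η (lsrc η) X = Δ u →
    (tensMk η (lsrc η)).rTensor U Y = Δ.rTensor U X →
    (tensMk η (lsrc η)).lTensor U Z = Δ.lTensor U X →
    TensorProduct.assoc k U U U Y - Z ∈ triRel (fun a => LinearMap.mulLeft k (tgt η a)) (lsrc η)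
      (fun a => LinearMap.mulLeft k (tgt η a)) (lsrc η)
  /-- `s(ε(u₁)) u₂ = u`. -/
  counit_left : ∀ (u : U) (X : U ⊗[k] U), tensMk η (lsrc η) X = Δ u →
    LinearMap.mul' k U (TensorProduct.map ((srcHom η).toLinearMap ∘ₗ ε) LinearMap.id X) = u
  /-- `t(ε(u₂)) u₁ = u`. -/
  counit_right : ∀ (u : U) (X : U ⊗[k] U), tensMk η (lsrc η) X = Δ u →
    TensorProduct.lift (LinearMap.mk₂ k (fun u₁ u₂ => tgt η (ε u₂) * u₁)
      (fun _ _ _ => mul_add _ _ _) (fun _ _ _ => mul_smul_comm _ _ _)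
      (fun _ _ _ => by simp [tgt_add, add_mul]) (fun _ _ _ => by simp [tgt_smul])) X = u
  /-- `u₁ t(a) ⊗ u₂ = u₁ ⊗ u₂ s(a)`, i.e. `Δ` takes values in the Takeuchi product. -/
  takeuchi : ∀ (a : A) (u : U) (X : U ⊗[k] U), tensMk η (lsrc η) X = Δ u →
    tensMk η (lsrc η) (X * (tgt η a ⊗ₜ 1)) = tensMk η (lsrc η) (X * (1 ⊗ₜ src η a))
  Δ_one : Δ 1 = tensMk η (lsrc η) 1
  /-- `Δ(u v) = u₁ v₁ ⊗ u₂ v₂`. -/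
  Δ_mul : ∀ (u v : U) (X Y : U ⊗[k] U), tensMk η (lsrc η) X = Δ u → tensMk η (lsrc η) Y = Δ v →
    Δ (u * v) = tensMk η (lsrc η) (X * Y)
  ε_one : ε 1 = 1
  /-- `ε(u s(ε(v))) = ε(u v)`. -/
  ε_mul_src : ∀ u v : U, ε (u * src η (ε v)) = ε (u * v)
  /-- `ε(u t(ε(v))) = ε(u v)`. -/
  ε_mul_tgt : ∀ u v : U, ε (u * tgt η (ε v)) = ε (u * v)

namespace LeftBialgebroid

variable {k A U : Type*} [CommRing k] [Ring A] [Algebra k A] [Ring U] [Algebra k U]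
  (H : LeftBialgebroid k A U)

/-- `U_◁ ⊗_A {}_▷U`. -/
abbrev UU : Type _ := TensA H.η (lsrc H.η)

/-- The projection `U ⊗ U → U_◁ ⊗_A {}_▷U`. -/
abbrev mkUU : U ⊗[k] U →ₗ[k] H.UU := tensMk H.η (lsrc H.η)

theorem mkUU_surjective (z : H.UU) : ∃ X, H.mkUU X = z := balMk_surjective _ _ z

/-- Right multiplication by an element of `U ⊗ U` on `U_◁ ⊗_A {}_▷U`. -/
def rmulUU (W : U ⊗[k] U) : H.UU →ₗ[k] H.UU :=
  balLift (H.mkUU ∘ₗ LinearMap.mulRight k W) (by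
    intro a x y
    induction W using TensorProduct.induction_on with
    | zero => simp
    | tmul v w =>
      simpa [mul_assoc] using balMk_bal (fun a => LinearMap.mulLeft k (tgt H.η a))
        (lsrc H.η) a (x * v) (y * w)
    | add v w hv hw => simpa [mul_add] using congrArg₂ (· + ·) hv hw)

@[simp] theorem rmulUU_mk (W X : U ⊗[k] U) : H.rmulUU W (H.mkUU X) = H.mkUU (X * W) := rfl

/-- Left multiplication by `1 ⊗ t(a)` on `U_◁ ⊗_A {}_▷U`. -/
def lmulUU (a : A) : H.UU →ₗ[k] H.UU :=
  balLift (H.mkUU ∘ₗ LinearMap.mulLeft k (1 ⊗ₜ tgt H.η a)) (by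
    intro b x y
    simpa [← mul_assoc, src_tgt] using balMk_bal (fun a => LinearMap.mulLeft k (tgt H.η a))
        (lsrc H.η) b x (tgt H.η a * y))

@[simp] theorem lmulUU_mk (a : A) (X : U ⊗[k] U) :
    H.lmulUU a (H.mkUU X) = H.mkUU ((1 ⊗ₜ tgt H.η a) * X) := rfl

theorem Δ_tgt_mul (a : A) (u : U) : H.Δ (tgt H.η a * u) = H.lmulUU a (H.Δ u) := by
  obtain ⟨X, hX⟩ := H.mkUU_surjective (H.Δ u)
  have := H.Δ_bimod 1 a u X hX
  rw [src_one, one_mul] at this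
  rw [this, ← hX, lmulUU_mk]

theorem Δ_mul_tgt (a : A) (u : U) : H.Δ (u * tgt H.η a) = H.rmulUU (1 ⊗ₜ tgt H.η a) (H.Δ u) := by
  obtain ⟨X, hX⟩ := H.mkUU_surjective (H.Δ u)
  have h : H.mkUU (1 ⊗ₜ tgt H.η a) = H.Δ (tgt H.η a) := by
    rw [← mul_one (tgt H.η a), Δ_tgt_mul, Δ_one, lmulUU_mk]
    simp
  rw [H.Δ_mul u _ X _ hX h, ← hX, rmulUU_mk]

theorem rmulUU_add (W W₁ : U ⊗[k] U) (z : H.UU) :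
    H.rmulUU (W + W₁) z = H.rmulUU W z + H.rmulUU W₁ z := by
  obtain ⟨X, rfl⟩ := H.mkUU_surjective z
  simp [mul_add]

theorem rmulUU_smul (c : k) (W : U ⊗[k] U) (z : H.UU) :
    H.rmulUU (c • W) z = c • H.rmulUU W z := by
  obtain ⟨X, rfl⟩ := H.mkUU_surjective z
  simp

theorem rmulUU_mul (W W₁ : U ⊗[k] U) (z : H.UU) :
    H.rmulUU (W * W₁) z = H.rmulUU W₁ (H.rmulUU W z) := by
  obtain ⟨X, rfl⟩ := H.mkUU_surjective z
  simp [mul_assoc]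

theorem takeuchi_rmul (a : A) (u : U) :
    H.rmulUU (tgt H.η a ⊗ₜ 1) (H.Δ u) = H.rmulUU (1 ⊗ₜ src H.η a) (H.Δ u) := by
  obtain ⟨X, hX⟩ := H.mkUU_surjective (H.Δ u)
  rw [← hX]
  exact H.takeuchi a u X hX

/-- `{}_▸U ⊗ U_◁` over `Aᵒᵖ`, balanced by `u t(a) ⊗ v = u ⊗ t(a) v`. -/
abbrev UopU : Type _ :=
  BalTensor (fun a : A => LinearMap.mulRight k (tgt H.η a))
    (fun a => LinearMap.mulLeft k (tgt H.η a))

/-- The projection `U ⊗ U → {}_▸U ⊗ U_◁`. -/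
abbrev mkUopU : U ⊗[k] U →ₗ[k] H.UopU :=
  balMk (fun a : A => LinearMap.mulRight k (tgt H.η a)) (fun a => LinearMap.mulLeft k (tgt H.η a))

theorem mkUopU_surjective (z : H.UopU) : ∃ X, H.mkUopU X = z := balMk_surjective _ _ z

/-- The map `u ⊗ v ↦ u₁ ⊗ u₂ v`, before passing to the balanced tensor product. -/
def preGalois : U ⊗[k] U →ₗ[k] H.UU :=
  TensorProduct.lift (LinearMap.mk₂ k (fun u v => H.rmulUU (1 ⊗ₜ v) (H.Δ u))
    (fun _ _ _ => by simp) (fun _ _ _ => by simp)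
    (fun _ _ _ => by rw [TensorProduct.tmul_add, rmulUU_add])
    (fun _ _ _ => by rw [TensorProduct.tmul_smul, rmulUU_smul]))

@[simp] theorem preGalois_tmul (u v : U) :
    H.preGalois (u ⊗ₜ v) = H.rmulUU (1 ⊗ₜ v) (H.Δ u) := rfl

/-- The Galois map `{}_▸U ⊗ U_◁ → U_◁ ⊗ {}_▷U`, `u ⊗ v ↦ u₁ ⊗ u₂ v`. -/
def galois : H.UopU →ₗ[k] H.UU :=
  balLift H.preGalois (by
    intro a u v
    simp [Δ_mul_tgt, ← rmulUU_mul])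

@[simp] theorem galois_mk (X : U ⊗[k] U) : H.galois (H.mkUopU X) = H.preGalois X := rfl

end LeftBialgebroid

/-- A left Hopf algebroid: a left bialgebroid whose Galois map is bijective. -/
structure LeftHopfAlgebroid (k A U : Type*) [CommRing k] [Ring A] [Algebra k A] [Ring U]
    [Algebra k U] extends LeftBialgebroid k A U where
  galois_bijective : Function.Bijective toLeftBialgebroid.galois

namespace LeftHopfAlgebroid

variable {k A U : Type*} [CommRing k] [Ring A] [Algebra k A] [Ring U] [Algebra k U]
  (H : LeftHopfAlgebroid k A U)

/-- The translation map `u ↦ u₊ ⊗ u₋`, the preimage of `u ⊗ 1` under the Galois map. -/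
noncomputable def trans : U →ₗ[k] H.UopU :=
  (LinearEquiv.ofBijective H.galois H.galois_bijective).symm.toLinearMap ∘ₗ
    H.mkUU ∘ₗ (TensorProduct.mk k U U).flip 1

theorem galois_trans (u : U) : H.galois (H.trans u) = H.mkUU (u ⊗ₜ 1) :=
  (LinearEquiv.ofBijective H.galois H.galois_bijective).apply_symm_apply _

theorem preGalois_mul_right (v : U) (X : U ⊗[k] U) :
    H.preGalois (X * (1 ⊗ₜ v)) = H.rmulUU (1 ⊗ₜ v) (H.preGalois X) := by
  induction X using TensorProduct.induction_on with
  | zero => simp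
  | tmul x y => simp [← LeftBialgebroid.rmulUU_mul]
  | add x y hx hy => simp [add_mul, hx, hy]

theorem preGalois_tgt_mul (a : A) (X : U ⊗[k] U) :
    H.preGalois ((tgt H.η a ⊗ₜ 1) * X) = H.lmulUU a (H.preGalois X) := by
  induction X using TensorProduct.induction_on with
  | zero => simp
  | tmul x y =>
    obtain ⟨W, hW⟩ := H.mkUU_surjective (H.Δ x)
    simp [H.Δ_tgt_mul, ← hW, mul_assoc]
  | add x y hx hy => simp [mul_add, hx, hy]

theorem preGalois_src_mul (a : A) (X : U ⊗[k] U) :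
    H.preGalois ((1 ⊗ₜ src H.η a) * X) = H.rmulUU (tgt H.η a ⊗ₜ 1) (H.preGalois X) := by
  induction X using TensorProduct.induction_on with
  | zero => simp
  | tmul x y =>
    have h : (1 : U) ⊗ₜ[k] (src H.η a * y) = (1 ⊗ₜ src H.η a) * (1 ⊗ₜ y) := by simp
    simp only [Algebra.TensorProduct.tmul_mul_tmul, one_mul, LeftBialgebroid.preGalois_tmul]
    rw [h, LeftBialgebroid.rmulUU_mul, ← H.takeuchi_rmul, ← LeftBialgebroid.rmulUU_mul,
      ← LeftBialgebroid.rmulUU_mul]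
    simp
  | add x y hx hy => simp [mul_add, hx, hy]

/-- `t(a) u₊ ⊗ u₋ = u₊ ⊗ u₋ t(a)`. -/
theorem trans_takeuchi (a : A) (u : U) (X : U ⊗[k] U) (hX : H.mkUopU X = H.trans u) :
    H.mkUopU ((tgt H.η a ⊗ₜ 1) * X) = H.mkUopU (X * (1 ⊗ₜ tgt H.η a)) := by
  apply H.galois_bijective.1
  have h : H.preGalois X = H.mkUU (u ⊗ₜ 1) := by
    rw [← LeftBialgebroid.galois_mk, hX, galois_trans]
  simp [preGalois_tgt_mul, preGalois_mul_right, h]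

/-- `(u t(a))₊ ⊗ (u t(a))₋ = u₊ ⊗ s(a) u₋`. -/
theorem trans_mul_tgt (a : A) (u : U) (X : U ⊗[k] U) (hX : H.mkUopU X = H.trans u) :
    H.trans (u * tgt H.η a) = H.mkUopU ((1 ⊗ₜ src H.η a) * X) := by
  apply H.galois_bijective.1
  have h : H.preGalois X = H.mkUU (u ⊗ₜ 1) := by
    rw [← LeftBialgebroid.galois_mk, hX, galois_trans]
  simp [preGalois_src_mul, galois_trans, h]

/-- `(t(a) u)₊ ⊗ (t(a) u)₋ = u₊ ⊗ u₋ s(a)`. -/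
theorem trans_tgt_mul (a : A) (u : U) (X : U ⊗[k] U) (hX : H.mkUopU X = H.trans u) :
    H.trans (tgt H.η a * u) = H.mkUopU (X * (1 ⊗ₜ src H.η a)) := by
  apply H.galois_bijective.1
  have h : H.preGalois X = H.mkUU (u ⊗ₜ 1) := by
    rw [← LeftBialgebroid.galois_mk, hX, galois_trans]
  simpa [preGalois_mul_right, galois_trans, h] using
    balMk_bal (fun a => LinearMap.mulLeft k (tgt H.η a)) (lsrc H.η) a u 1

end LeftHopfAlgebroid

/-! ### The operators `D_φ` -/

namespace LeftBialgebroid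

variable {k A U : Type*} [CommRing k] [Ring A] [Algebra k A] [Ring U] [Algebra k U]
  (H : LeftBialgebroid k A U)

theorem ε_src_mul (a : A) (u : U) : H.ε (src H.η a * u) = a * H.ε u := by
  simpa using H.ε_bimod a 1 u

theorem ε_tgt_mul (a : A) (u : U) : H.ε (tgt H.η a * u) = H.ε u * a := by
  simpa using H.ε_bimod 1 a u

theorem ε_src (a : A) : H.ε (src H.η a) = a := by
  simpa [H.ε_one] using H.ε_src_mul a 1

theorem ε_mul_src_eq_tgt (a : A) (u : U) : H.ε (u * src H.η a) = H.ε (u * tgt H.η a) := by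
  have h := H.ε_mul_tgt u (src H.η a)
  rw [ε_src] at h
  exact h.symm

/-- The action `a ⇀ w = s(a) w` on `U`. -/
abbrev srcAct : A →ₐ[k] Module.End k U := (Algebra.lmul k U).comp (srcHom H.η)

/-- The map `v ⊗ v' ↦ (v' w, v, u¹, …, uⁿ)`. -/
noncomputable def prepPair (w : U) (l : List U) : H.UU →ₗ[k] Words H.η H.srcAct :=
  balLift (TensorProduct.lift (LinearMap.mk₂ k (fun v v₁ => wmk H.η H.srcAct (v₁ * w) (v :: l))
      (fun v v₂ _ => ((wmk_isWordMap H.η H.srcAct).lin_letter _ [] l).map_add v v₂)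
      (fun c v _ => ((wmk_isWordMap H.η H.srcAct).lin_letter _ [] l).map_smul c v)
      (fun v v₁ v₂ => by
        rw [add_mul, ((wmk_isWordMap H.η H.srcAct).lin_left _).map_add])
      (fun c v v₁ => by
        rw [smul_mul_assoc, ((wmk_isWordMap H.η H.srcAct).lin_left _).map_smul]))) (by
    intro a x y
    simpa [srcHom_apply, mul_assoc] using
      ((wmk_isWordMap H.η H.srcAct).front a (y * w) x l).symm)

theorem prepPair_tmul (w : U) (l : List U) (v v₁ : U) :
    H.prepPair w l (H.mkUU (v ⊗ₜ v₁)) = wmk H.η H.srcAct (v₁ * w) (v :: l) := rfl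

theorem prepPair_isWordMap (u : U) :
    IsWordMap H.η H.srcAct (fun w l => H.prepPair w l (H.Δ u)) where
  lin_left l := by
    refine ⟨fun w w₁ => ?_, fun c w => ?_⟩
    · rw [← LinearMap.add_apply]
      congr 1
      refine bal_ext fun v v₁ => ?_
      simp only [LinearMap.add_apply, prepPair_tmul]
      rw [mul_add, ((wmk_isWordMap H.η H.srcAct).lin_left _).map_add]
    · rw [← LinearMap.smul_apply]
      congr 1
      refine bal_ext fun v v₁ => ?_
      simp only [LinearMap.smul_apply, prepPair_tmul]
      rw [mul_smul_comm, ((wmk_isWordMap H.η H.srcAct).lin_left _).map_smul]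
  lin_letter w l₁ l₂ := by
    refine ⟨fun x y => ?_, fun c x => ?_⟩
    · rw [← LinearMap.add_apply]
      congr 1
      refine bal_ext fun v v₁ => ?_
      simp only [LinearMap.add_apply, prepPair_tmul]
      exact ((wmk_isWordMap H.η H.srcAct).lin_letter _ (v :: l₁) l₂).map_add x y
    · rw [← LinearMap.smul_apply]
      congr 1
      refine bal_ext fun v v₁ => ?_
      simp only [LinearMap.smul_apply, prepPair_tmul]
      exact ((wmk_isWordMap H.η H.srcAct).lin_letter _ (v :: l₁) l₂).map_smul c x
  front a w y l := by
    have h₁ : H.prepPair (H.srcAct a w) (y :: l) =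
        H.prepPair w (y :: l) ∘ₗ H.rmulUU (1 ⊗ₜ src H.η a) := by
      refine bal_ext fun v v₁ => ?_
      simp [prepPair_tmul, srcHom_apply, mul_assoc]
    have h₂ : H.prepPair w ((tgt H.η a * y) :: l) =
        H.prepPair w (y :: l) ∘ₗ H.rmulUU (tgt H.η a ⊗ₜ 1) := by
      refine bal_ext fun v v₁ => ?_
      simpa [prepPair_tmul] using
        ((wmk_isWordMap H.η H.srcAct).inner a (v₁ * w) [] v y l).symm
    rw [h₁, h₂, LinearMap.comp_apply, LinearMap.comp_apply, takeuchi_rmul]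
  inner a w l₁ x y l₂ := by
    congr 1
    refine bal_ext fun v v₁ => ?_
    simpa [prepPair_tmul] using
      (wmk_isWordMap H.η H.srcAct).inner a (v₁ * w) (v :: l₁) x y l₂

/-- The operator `(w, u¹, …, uⁿ) ↦ (u₂ w, u₁, u¹, …, uⁿ)`. -/
noncomputable def prep (u : U) : Module.End k (Words H.η H.srcAct) :=
  wlift (fun w l => H.prepPair w l (H.Δ u)) (H.prepPair_isWordMap u)

theorem prep_mk (u w : U) (l : List U) :
    H.prep u (wmk H.η H.srcAct w l) = H.prepPair w l (H.Δ u) := wlift_mk _ _ _ _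

theorem prep_isLinear : IsLinearMap k H.prep :=
  ⟨fun u v => wext fun w l => by simp [prep_mk], fun c u => wext fun w l => by simp [prep_mk]⟩

theorem prep_inner (a : A) (u v : U) :
    H.prep (u * tgt H.η a) * H.prep v = H.prep u * H.prep (tgt H.η a * v) := by
  refine wext fun w l => ?_
  simp only [Module.End.mul_apply, prep_mk]
  rw [Δ_tgt_mul]
  rw [← LinearMap.comp_apply, ← LinearMap.comp_apply (H.prep u),
    ← LinearMap.comp_apply (H.prep u ∘ₗ _)]
  congr 1
  refine bal_ext fun x y => ?_
  change H.prep (u * tgt H.η a) (H.prepPair w l (H.mkUU (x ⊗ₜ y))) =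
    H.prep u (H.prepPair w l (H.lmulUU a (H.mkUU (x ⊗ₜ y))))
  simp only [lmulUU_mk, Algebra.TensorProduct.tmul_mul_tmul, one_mul, prepPair_tmul, prep_mk,
    Δ_mul_tgt]
  rw [← LinearMap.comp_apply]
  congr 1
  refine bal_ext fun x₁ y₁ => ?_
  change H.prepPair (y * w) (x :: l) (H.rmulUU (1 ⊗ₜ tgt H.η a) (H.mkUU (x₁ ⊗ₜ y₁))) =
    H.prepPair (tgt H.η a * y * w) (x :: l) (H.mkUU (x₁ ⊗ₜ y₁))
  simp [prepPair_tmul, mul_assoc]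

/-- `(u¹, …, uⁿ) ↦ (u¹₂ ⋯ uⁿ₂, u¹₁, …, uⁿ₁)`. -/
noncomputable def coactWord (l : List U) : Words H.η H.srcAct :=
  l.foldr (fun u z => H.prep u z) (wmk H.η H.srcAct 1 [])

/-- The operator `(w, u¹, …, uⁿ) ↦ (w b, u¹, …, uⁿ)`. -/
noncomputable def rmulWord (b : U) : Module.End k (Words H.η H.srcAct) :=
  wlift (fun w l => wmk H.η H.srcAct (w * b) l)
    { lin_left := fun l => (((wmk_isWordMap H.η H.srcAct).lin_left l).mk'.comp
        (LinearMap.mulRight k b)).isLinear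
      lin_letter := fun m l₁ l₂ => (wmk_isWordMap H.η H.srcAct).lin_letter _ _ _
      front := fun a m u l => by
        simpa [srcHom_apply, mul_assoc] using (wmk_isWordMap H.η H.srcAct).front a (m * b) u l
      inner := fun a m l₁ u v l₂ => (wmk_isWordMap H.η H.srcAct).inner _ _ _ _ _ _ }

@[simp] theorem rmulWord_mk (b w : U) (l : List U) :
    H.rmulWord b (wmk H.η H.srcAct w l) = wmk H.η H.srcAct (w * b) l := wlift_mk _ _ _ _

theorem prep_rmulWord (b u : U) : H.prep u * H.rmulWord b = H.rmulWord b * H.prep u := by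
  refine wext fun w l => ?_
  simp only [Module.End.mul_apply, prep_mk, rmulWord_mk]
  have h : H.prepPair (w * b) l = H.rmulWord b ∘ₗ H.prepPair w l := by
    refine bal_ext fun x y => ?_
    change _ = H.rmulWord b (H.prepPair w l (H.mkUU (x ⊗ₜ y)))
    simp [prepPair_tmul, mul_assoc]
  exact LinearMap.congr_fun h _

variable {p : ℕ} (φ : Cochain (k := k) H.η p)

/-- The map `(w, u¹, …, u^p) ↦ s(φ(u¹, …, u^p)) w`, equal to `0` in the degrees other
than `p`. -/
noncomputable def contract : Words H.η H.srcAct →ₗ[k] U :=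
  wlift (fun w l => src H.η (φ.toFun l) * w)
    { lin_left := fun l => (LinearMap.mulLeft k _).isLinear
      lin_letter := fun w l₁ l₂ => ⟨fun u v => by
          rw [(φ.lin l₁ l₂).map_add, src_add, add_mul],
        fun c u => by rw [(φ.lin l₁ l₂).map_smul, src_smul, smul_mul_assoc]⟩
      front := fun a w u l => by simp [φ.front, src_mul, mul_assoc, srcHom_apply]
      inner := fun a w l₁ u v l₂ => by rw [φ.inner] }

@[simp] theorem contract_mk (w : U) (l : List U) :
    H.contract φ (wmk H.η H.srcAct w l) = src H.η (φ.toFun l) * w := wlift_mk _ _ _ _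

/-- `D_φ(u¹, …, u^p) = s(φ(u¹₁, …, u^p₁)) u¹₂ ⋯ u^p₂`. -/
noncomputable def DD (l : List U) : U := H.contract φ (H.coactWord l)

theorem coactWord_append (l₁ l₂ : List U) :
    H.coactWord (l₁ ++ l₂) = l₁.foldr (fun u z => H.prep u z) (H.coactWord l₂) := by
  simp [coactWord]

theorem foldr_prep (l : List U) : ∃ g : Module.End k (Words H.η H.srcAct),
    (∀ z, l.foldr (fun u z => H.prep u z) z = g z) ∧ ∀ b, g * H.rmulWord b = H.rmulWord b * g := by
  induction l with
  | nil => exact ⟨1, fun z => rfl, fun b => by simp⟩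
  | cons u l ih =>
    obtain ⟨g, hg, hb⟩ := ih
    refine ⟨H.prep u * g, fun z => by simp [hg], fun b => ?_⟩
    rw [mul_assoc, hb, ← mul_assoc, prep_rmulWord, mul_assoc]

theorem contract_rmulWord (b : U) (z : Words H.η H.srcAct) :
    H.contract φ (H.rmulWord b z) = H.contract φ z * b := by
  have : H.contract φ ∘ₗ H.rmulWord b = LinearMap.mulRight k b ∘ₗ H.contract φ :=
    wext fun w l => by simp [mul_assoc]
  exact LinearMap.congr_fun this z

theorem prep_mul_tgt_one (a : A) (u : U) :
    H.prep (u * tgt H.η a) (wmk H.η H.srcAct 1 []) =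
      H.rmulWord (tgt H.η a) (H.prep u (wmk H.η H.srcAct 1 [])) := by
  simp only [prep_mk, Δ_mul_tgt]
  have h : H.prepPair 1 [] ∘ₗ H.rmulUU (1 ⊗ₜ tgt H.η a) =
      H.rmulWord (tgt H.η a) ∘ₗ H.prepPair 1 [] := by
    refine bal_ext fun x y => ?_
    change H.prepPair 1 [] (H.rmulUU (1 ⊗ₜ tgt H.η a) (H.mkUU (x ⊗ₜ y))) =
      H.rmulWord (tgt H.η a) (H.prepPair 1 [] (H.mkUU (x ⊗ₜ y)))
    simp [prepPair_tmul]
  exact LinearMap.congr_fun h _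

theorem contract_prep_tgt_mul (a : A) (u : U) :
    H.contract φ ∘ₗ H.prep (tgt H.η a * u) =
      LinearMap.mulLeft k (tgt H.η a) ∘ₗ H.contract φ ∘ₗ H.prep u := by
  refine wext fun w l => ?_
  simp only [LinearMap.comp_apply, prep_mk, Δ_tgt_mul]
  rw [← LinearMap.comp_apply (H.prepPair w l), ← LinearMap.comp_apply (H.contract φ),
    ← LinearMap.comp_apply (H.contract φ), ← LinearMap.comp_apply (LinearMap.mulLeft k _)]
  congr 1
  refine bal_ext fun x y => ?_
  change H.contract φ (H.prepPair w l (H.lmulUU a (H.mkUU (x ⊗ₜ y)))) =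
    tgt H.η a * H.contract φ (H.prepPair w l (H.mkUU (x ⊗ₜ y)))
  simp [prepPair_tmul, ← mul_assoc, src_tgt]

theorem DD_isSlotMap : IsSlotMap (k := k) H.η (H.DD φ) where
  lin l₁ l₂ := by
    obtain ⟨g, hg, -⟩ := H.foldr_prep l₁
    simp only [DD, coactWord_append, hg]
    exact (((H.contract φ ∘ₗ g) ∘ₗ LinearMap.applyₗ (H.coactWord l₂)) ∘ₗ
      H.prep_isLinear.mk').isLinear
  inner a l₁ u v l₂ := by
    simp only [DD, coactWord_append]
    congr 2
    exact LinearMap.congr_fun (H.prep_inner a u v) (H.coactWord l₂)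
  front a u l := LinearMap.congr_fun (H.contract_prep_tgt_mul φ a u) (H.coactWord l)
  back a u l := by
    obtain ⟨g, hg, hb⟩ := H.foldr_prep l
    simp only [DD, coactWord_append, hg]
    rw [← contract_rmulWord]
    change H.contract φ (g (H.prep (u * tgt H.η a) (wmk H.η H.srcAct 1 []))) = H.contract φ
      ((H.rmulWord (tgt H.η a) * g) (H.prep u (wmk H.η H.srcAct 1 [])))
    rw [← hb, prep_mul_tgt_one, Module.End.mul_apply]
  nil a := by simp [DD, coactWord, src_tgt]

/-- The counit as a `1`-cochain. -/
def counitCochain : Cochain (k := k) H.η 1 where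
  toFun l := match l with
    | [u] => H.ε u
    | _ => 0
  off l h := by
    rcases l with _ | ⟨u, _ | ⟨v, l⟩⟩
    · rfl
    · simp at h
    · rfl
  lin l₁ l₂ := by
    rcases l₁ with _ | ⟨x, l₁⟩
    · rcases l₂ with _ | ⟨y, l₂⟩
      · exact H.ε.isLinear
      · exact (0 : U →ₗ[k] A).isLinear
    · rcases l₁ with _ | ⟨y, l₁⟩ <;> exact (0 : U →ₗ[k] A).isLinear
  inner a l₁ u v l₂ := by
    rcases l₁ with _ | ⟨x, _ | ⟨y, l₁⟩⟩ <;> rfl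
  front a u l := by
    rcases l with _ | ⟨v, l⟩
    · exact H.ε_tgt_mul a u
    · exact (zero_mul a).symm

/-! ### The differential of cochains -/

/-- `φ(u¹, …, uⁿ t(b))`, read as `φ b` for `n = 0`. -/
def lastAct (b : A) (l : List U) : A :=
  match l.getLast? with
  | none => φ.toFun [] * b
  | some u => φ.toFun (l.dropLast ++ [u * tgt H.η b])

/-- `φ(u¹, …, uⁿ⁻¹ t(ε(uⁿ)))`. -/
def lastTerm (l : List U) : A :=
  match l.getLast? with
  | none => 0
  | some u => H.lastAct φ (H.ε u) l.dropLast

/-- `ε(u¹ s(φ(u², …, uⁿ)))`, that is, the action of `u¹` on `φ(u², …, uⁿ) ∈ A`. -/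
def headTerm (l : List U) : A :=
  match l with
  | [] => 0
  | u :: l => H.ε (u * src H.η (φ.toFun l))

/-- The values of the differential on words `(u¹, …, u^{p+1})`:
`u¹ φ(u², …, u^{p+1}) + ∑_{i=1}^{p} (-1)ⁱ φ(u¹, …, uⁱ uⁱ⁺¹, …, u^{p+1})`
`+ (-1)^{p+1} φ(u¹, …, u^p t(ε(u^{p+1})))`. -/
def deltaFun (l : List U) : A :=
  if l.length = p + 1 then
    H.headTerm φ l
      + ∑ i ∈ Finset.Icc 1 p, (-1 : ℤ) ^ i •
          φ.toFun (l.take (i - 1) ++ ((l.drop (i - 1)).take 2).prod :: l.drop (i + 1))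
      + (-1 : ℤ) ^ (p + 1) • H.lastTerm φ l
  else 0

/-- The functional `(b, u¹, …, u^p) ↦ φ(u¹, …, u^p) b`. -/
noncomputable def pairing : Words H.η (Algebra.lmul k A) →ₗ[k] A :=
  wlift (fun b l => φ.toFun l * b)
    { lin_left := fun l => (LinearMap.mulLeft k _).isLinear
      lin_letter := fun w l₁ l₂ => ((LinearMap.mulRight k w) ∘ₗ (φ.lin l₁ l₂).mk').isLinear
      front := fun a w u l => by simp [φ.front, mul_assoc]
      inner := fun a w l₁ u v l₂ => by rw [φ.inner] }

theorem pairing_mk (b : A) (l : List U) :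
    H.pairing φ (wmk H.η (Algebra.lmul k A) b l) = φ.toFun l * b := wlift_mk _ _ _ _

theorem pairing_slot (b : A) (l : List U) (i : ℕ) (hi : i + 2 ≤ l.length) :
    H.pairing φ (slot (Algebra.lmul k A) i 2 (prod_isSlotMap H.η)
      (wmk H.η (Algebra.lmul k A) b l)) =
      φ.toFun (l.take i ++ ((l.drop i).take 2).prod :: l.drop (i + 2)) * b := by
  rw [slot, wlift_mk, slotFun, if_pos hi, pairing_mk]

theorem pairing_cap (b : A) (l : List U) :
    H.pairing φ (cap (Algebra.lmul k A) H.counitCochain (wmk H.η (Algebra.lmul k A) b l)) =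
      H.lastTerm φ l * b := by
  rcases List.eq_nil_or_concat l with rfl | ⟨l, v, rfl⟩
  · simp [cap, capFun, lastTerm]
  · rw [List.concat_eq_append, cap, wlift_mk,
      capFun_eq (ρ := Algebra.lmul k A) H.counitCochain b l [v] rfl]
    rcases List.eq_nil_or_concat l with rfl | ⟨l, u, rfl⟩
    · simp [pairing_mk, lastTerm, lastAct, counitCochain, mul_assoc]
    · simp [pairing_mk, lastTerm, lastAct, counitCochain]

/-- The sum of all terms but the first one of the differential, as a functional on words. -/
noncomputable def deltaAux : Words H.η (Algebra.lmul k A) →ₗ[k] A :=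
  ∑ i ∈ Finset.Icc 1 p, (-1 : ℤ) ^ i •
    (H.pairing φ ∘ₗ slot (Algebra.lmul k A) (i - 1) 2 (prod_isSlotMap H.η))
  + (-1 : ℤ) ^ (p + 1) • (H.pairing φ ∘ₗ cap (Algebra.lmul k A) H.counitCochain)

theorem deltaAux_mk (b : A) (l : List U) (hl : l.length = p + 1) :
    H.deltaAux φ (wmk H.η (Algebra.lmul k A) b l) =
      (∑ i ∈ Finset.Icc 1 p, (-1 : ℤ) ^ i •
          φ.toFun (l.take (i - 1) ++ ((l.drop (i - 1)).take 2).prod :: l.drop (i + 1))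
        + (-1 : ℤ) ^ (p + 1) • H.lastTerm φ l) * b := by
  simp only [deltaAux, LinearMap.add_apply, LinearMap.sum_apply, LinearMap.smul_apply,
    LinearMap.comp_apply, pairing_cap, add_mul, Finset.sum_mul, smul_mul_assoc]
  congr 1
  refine Finset.sum_congr rfl fun i hi => ?_
  rw [Finset.mem_Icc] at hi
  rw [pairing_slot _ _ _ _ _ (by omega), show i - 1 + 2 = i + 1 by omega]

theorem deltaFun_eq (l : List U) (hl : l.length = p + 1) : H.deltaFun φ l =
    H.headTerm φ l + H.deltaAux φ (wmk H.η (Algebra.lmul k A) 1 l) := by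
  rw [deltaAux_mk _ _ _ _ hl, deltaFun, if_pos hl, mul_one, add_assoc]

/-- The differential `δ` of cochains. -/
def delta : Cochain (k := k) H.η (p + 1) where
  toFun := H.deltaFun φ
  off l h := if_neg h
  lin l₁ l₂ := by
    by_cases h : l₁.length + (l₂.length + 1) = p + 1
    · have := fun u => H.deltaFun_eq φ (l₁ ++ u :: l₂) (by simpa using h)
      simp_rw [this]
      have h₂ := ((wmk_isWordMap H.η (Algebra.lmul k A)).comp (H.deltaAux φ)).lin_letter 1 l₁ l₂
      have h₁ : IsLinearMap k (fun u => H.headTerm φ (l₁ ++ u :: l₂)) := by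
        rcases l₁ with _ | ⟨v, l₁⟩
        · exact (H.ε ∘ₗ LinearMap.mulRight k _).isLinear
        · refine ⟨fun x y => ?_, fun c x => ?_⟩
          · simp [headTerm, (φ.lin l₁ l₂).map_add, src_add, mul_add]
          · simp [headTerm, (φ.lin l₁ l₂).map_smul, src_smul]
      exact (h₁.mk' + h₂.mk').isLinear
    · simp only [deltaFun, List.length_append, List.length_cons, h, if_false]
      exact (0 : U →ₗ[k] A).isLinear
  inner a l₁ u v l₂ := by
    by_cases h : l₁.length + (l₂.length + 1 + 1) = p + 1
    · rw [deltaFun_eq _ _ _ (by simpa using h), deltaFun_eq _ _ _ (by simpa using h),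
        (wmk_isWordMap H.η (Algebra.lmul k A)).inner]
      congr 1
      rcases l₁ with _ | ⟨x, l₁⟩
      · simp only [headTerm, List.nil_append, φ.front, src_mul]
        rw [mul_assoc, ← src_tgt, ← mul_assoc, ← mul_assoc, ε_mul_src_eq_tgt]
      · simp only [headTerm, List.cons_append, φ.inner]
    · simp [deltaFun, h]
  front a u l := by
    by_cases h : l.length = p
    · rw [deltaFun_eq _ _ _ (by simpa using h), deltaFun_eq _ _ _ (by simpa using h),
        ← (wmk_isWordMap H.η (Algebra.lmul k A)).front, deltaAux_mk _ _ _ _ (by simpa using h),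
        deltaAux_mk _ _ _ _ (by simpa using h), add_mul]
      simp [headTerm, mul_assoc, ε_tgt_mul, add_mul]
    · simp [deltaFun, h]

end LeftBialgebroid

/-! ### Module-comodules and the cyclic operator -/

section RightModule

variable {k A U : Type*} [CommRing k] [Ring A] [Algebra k A] [Ring U] [Algebra k U]
  (η : A ⊗[k] Aᵐᵒᵖ →ₐ[k] U)
  (M : Type*) [AddCommGroup M] [Module k M] [Module Uᵐᵒᵖ M] [IsScalarTower k Uᵐᵒᵖ M]

/-- The action `a ▸ m = m t(a)` of `A` on a right `U`-module. -/
noncomputable def modAct : A →ₐ[k] Module.End k M :=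
  (Algebra.lsmul k k M).comp
    (AlgHom.opComm.symm (η.comp Algebra.TensorProduct.includeRight) : A →ₐ[k] Uᵐᵒᵖ)

@[simp] theorem modAct_apply (a : A) (m : M) : modAct η M a m = m <• tgt η a := rfl

theorem act_rightModule_mul (m : M) (u v : U) : m <• (u * v) = (m <• u) <• v := by
  rw [MulOpposite.op_mul, mul_smul]

end RightModule

/-- A module-comodule over a left bialgebroid: a right `U`-module `M` with a left `U`-coaction
`M → U_◁ ⊗_A {}_▸M`, `m ↦ m₋₁ ⊗ m₀`, on the left `A`-module `{}_▸M`. There is no further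
compatibility between action and coaction. Identities are stated in terms of arbitrary
representatives `X` of the coaction in `U ⊗[k] M`. -/
structure ModuleComodule {k A U : Type*} [CommRing k] [Ring A] [Algebra k A] [Ring U]
    [Algebra k U] (H : LeftBialgebroid k A U) (M : Type*) [AddCommGroup M] [Module k M]
    [Module Uᵐᵒᵖ M] [IsScalarTower k Uᵐᵒᵖ M] where
  coact : M →ₗ[k] TensA H.η (fun a => modAct H.η M a)
  /-- `(a ▸ m)₋₁ ⊗ (a ▸ m)₀ = s(a) m₋₁ ⊗ m₀`. -/
  coact_left : ∀ (a : A) (m : M) (X : U ⊗[k] M), tensMk H.η (fun a => modAct H.η M a) X = coact m →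
    coact (modAct H.η M a m) = tensMk H.η (fun a => modAct H.η M a) ((lsrc H.η a).rTensor M X)
  /-- `m₋₁₁ ⊗ m₋₁₂ ⊗ m₀ = m₋₁ ⊗ m₀₋₁ ⊗ m₀₀`. -/
  coassoc : ∀ (m : M) (X : U ⊗[k] M) (Y : (U ⊗[k] U) ⊗[k] M) (Z : U ⊗[k] (U ⊗[k] M)),
    tensMk H.η (fun a => modAct H.η M a) X = coact m →
    H.mkUU.rTensor M Y = H.Δ.rTensor M X →
    (tensMk H.η (fun a => modAct H.η M a)).lTensor U Z = coact.lTensor U X →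
    TensorProduct.assoc k U U M Y - Z ∈ triRel (fun a => LinearMap.mulLeft k (tgt H.η a))
      (lsrc H.η) (fun a => LinearMap.mulLeft k (tgt H.η a)) (fun a => modAct H.η M a)
  /-- `ε(m₋₁) ▸ m₀ = m`. -/
  counit : ∀ (m : M) (X : U ⊗[k] M), tensMk H.η (fun a => modAct H.η M a) X = coact m →
    TensorProduct.lift ((modAct H.η M).toLinearMap ∘ₗ H.ε) X = m

section Cyclic

variable {k A U : Type*} [CommRing k] [Ring A] [Algebra k A] [Ring U] [Algebra k U]
  {M : Type*} [AddCommGroup M] [Module k M]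

section State

variable (H : LeftHopfAlgebroid k A U) (ρ : A →ₐ[k] Module.End k M)

/-- Words with one further letter, which is kept apart: `(m, u¹, …, uⁿ) ⊗ h`, balanced over
`Aᵒᵖ`. -/
abbrev State : Type _ :=
  BalTensor (act H.η ρ) (fun a : A => LinearMap.mulLeft k (tgt H.η a))

/-- The canonical projection. -/
noncomputable abbrev stMk : Words H.η ρ ⊗[k] U →ₗ[k] State H ρ :=
  balMk (act H.η ρ) (fun a : A => LinearMap.mulLeft k (tgt H.η a))

/-- `app` as a linear map. -/
noncomputable def appHom : U →ₗ[k] Module.End k (Words H.η ρ) where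
  toFun v := app v
  map_add' := app_add
  map_smul' := app_smul

/-- The map `v ⊗ w ↦ ((m, u¹, …, uⁿ) ⊗ h ↦ (m, u¹, …, uⁿ, v) ⊗ w h)`. -/
noncomputable def stepPair : H.UopU →ₗ[k] (Words H.η ρ ⊗[k] U →ₗ[k] State H ρ) :=
  balLift (TensorProduct.lift (LinearMap.mk₂ k
      (fun v w => stMk H ρ ∘ₗ TensorProduct.map (appHom H ρ v) (LinearMap.mulLeft k w))
      (fun v v₁ w => by rw [map_add, TensorProduct.map_add_left, LinearMap.comp_add])
      (fun c v w => by rw [map_smul, TensorProduct.map_smul_left, LinearMap.comp_smul])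
      (fun v w w₁ => by
        rw [show LinearMap.mulLeft k (w + w₁) = LinearMap.mulLeft k w + LinearMap.mulLeft k w₁ from
          LinearMap.ext fun x => add_mul _ _ _, TensorProduct.map_add_right, LinearMap.comp_add])
      (fun c v w => by
        rw [show LinearMap.mulLeft k (c • w) = c • LinearMap.mulLeft k w from
          LinearMap.ext fun x => smul_mul_assoc _ _ _, TensorProduct.map_smul_right,
          LinearMap.comp_smul]))) (by
    intro a v w
    refine TensorProduct.ext' fun x h => ?_
    have := balMk_bal (act H.η ρ) (fun a : A => LinearMap.mulLeft k (tgt H.η a)) a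
      (app v x) (w * h)
    rw [← Module.End.mul_apply, act_app] at this
    simpa [appHom, mul_assoc] using this)

theorem stepPair_tmul (v w : U) (x : Words H.η ρ) (h : U) :
    stepPair H ρ (H.mkUopU (v ⊗ₜ w)) (x ⊗ₜ h) = stMk H ρ (app v x ⊗ₜ (w * h)) := rfl

theorem stepPair_mk_act (a : A) (x : Words H.η ρ) (h : U) (X : U ⊗[k] U) :
    stepPair H ρ (H.mkUopU X) (act H.η ρ a x ⊗ₜ h) =
      stepPair H ρ (H.mkUopU ((tgt H.η a ⊗ₜ 1) * X)) (x ⊗ₜ h) := by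
  induction X using TensorProduct.induction_on with
  | zero => simp
  | tmul v w =>
    rw [stepPair_tmul, Algebra.TensorProduct.tmul_mul_tmul, stepPair_tmul, one_mul,
      ← Module.End.mul_apply, app_act]
  | add X Y hX hY =>
    rw [mul_add, map_add, map_add, map_add, map_add, LinearMap.add_apply, LinearMap.add_apply,
      hX, hY]

theorem stepPair_mk_mul (b : U) (x : Words H.η ρ) (h : U) (X : U ⊗[k] U) :
    stepPair H ρ (H.mkUopU X) (x ⊗ₜ (b * h)) =
      stepPair H ρ (H.mkUopU (X * (1 ⊗ₜ b))) (x ⊗ₜ h) := by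
  induction X using TensorProduct.induction_on with
  | zero => simp
  | tmul v w =>
    rw [stepPair_tmul, Algebra.TensorProduct.tmul_mul_tmul, stepPair_tmul, mul_one, mul_assoc]
  | add X Y hX hY =>
    rw [add_mul, map_add, map_add, map_add, map_add, LinearMap.add_apply, LinearMap.add_apply,
      hX, hY]

/-- The operator `(m, u¹, …, uⁿ) ⊗ h ↦ (m, u¹, …, uⁿ, v₊) ⊗ v₋ h`. -/
noncomputable def step (v : U) : Module.End k (State H ρ) :=
  balLift (stepPair H ρ (H.trans v)) (by
    intro a x h
    obtain ⟨X, hX⟩ := H.mkUopU_surjective (H.trans v)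
    rw [← hX, stepPair_mk_act, LinearMap.mulLeft_apply, stepPair_mk_mul,
      H.trans_takeuchi a v X hX])

@[simp] theorem step_mk (v : U) (z : Words H.η ρ ⊗[k] U) :
    step H ρ v (stMk H ρ z) = stepPair H ρ (H.trans v) z := rfl

theorem step_isLinear : IsLinearMap k (step H ρ) :=
  ⟨fun u v => bal_ext fun x h => by
      change stepPair H ρ (H.trans (u + v)) _ = stepPair H ρ (H.trans u) _ +
        stepPair H ρ (H.trans v) _
      rw [map_add, map_add, LinearMap.add_apply],
    fun c u => bal_ext fun x h => by
      change stepPair H ρ (H.trans (c • u)) _ = c • stepPair H ρ (H.trans u) _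
      rw [map_smul, map_smul, LinearMap.smul_apply]⟩

/-- The operator `x ⊗ h ↦ x ⊗ s(a) h`. -/
noncomputable def srcState (a : A) : Module.End k (State H ρ) :=
  balLift (stMk H ρ ∘ₗ (lsrc H.η a).lTensor (Words H.η ρ)) (by
    intro b x h
    have := balMk_bal (act H.η ρ) (fun a : A => LinearMap.mulLeft k (tgt H.η a)) b
      x (src H.η a * h)
    simp only [LinearMap.comp_apply, LinearMap.lTensor_tmul, LinearMap.mulLeft_apply] at this ⊢
    rw [this, ← mul_assoc, ← mul_assoc, src_tgt])

theorem srcState_mk (a : A) (x : Words H.η ρ) (h : U) :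
    srcState H ρ a (stMk H ρ (x ⊗ₜ h)) = stMk H ρ (x ⊗ₜ (src H.η a * h)) := rfl

theorem step_srcState (a : A) (v : U) :
    step H ρ v * srcState H ρ a = step H ρ (tgt H.η a * v) := by
  refine bal_ext fun x h => ?_
  obtain ⟨X, hX⟩ := H.mkUopU_surjective (H.trans v)
  change step H ρ v (srcState H ρ a (stMk H ρ (x ⊗ₜ h))) =
    step H ρ (tgt H.η a * v) (stMk H ρ (x ⊗ₜ h))
  rw [srcState_mk, step_mk, step_mk, H.trans_tgt_mul a v X hX, ← hX, stepPair_mk_mul]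

theorem srcState_step (a : A) (v : U) :
    srcState H ρ a * step H ρ v = step H ρ (v * tgt H.η a) := by
  refine bal_ext fun x h => ?_
  obtain ⟨X, hX⟩ := H.mkUopU_surjective (H.trans v)
  change srcState H ρ a (step H ρ v (stMk H ρ (x ⊗ₜ h))) =
    step H ρ (v * tgt H.η a) (stMk H ρ (x ⊗ₜ h))
  rw [step_mk, step_mk, H.trans_mul_tgt a v X hX, ← hX]
  clear hX
  induction X using TensorProduct.induction_on with
  | zero => simp
  | tmul v w =>
    rw [stepPair_tmul, srcState_mk, Algebra.TensorProduct.tmul_mul_tmul, stepPair_tmul, one_mul,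
      mul_assoc]
  | add X Y hX hY =>
    rw [mul_add, map_add, map_add, map_add, map_add, LinearMap.add_apply, LinearMap.add_apply,
      map_add, hX, hY]

/-- The map `(m, u¹, …, uⁿ) ⊗ h ↦ (m, u¹, …, uⁿ, h)`. -/
noncomputable def join : State H ρ →ₗ[k] Words H.η ρ :=
  balLift (TensorProduct.lift (appHom H ρ).flip) (by
    intro a x h
    simpa [appHom] using LinearMap.congr_fun (app_act (η := H.η) (ρ := ρ) a h) x)

end State

variable [Module Uᵐᵒᵖ M] [IsScalarTower k Uᵐᵒᵖ M]

/-- The chains `C(U, M) = ⨁ₙ M ⊗ U ⊗ ⋯ ⊗ U` (tensor products over `Aᵒᵖ`), graded by `n`. -/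
abbrev Chains (H : LeftBialgebroid k A U) (M : Type*) [AddCommGroup M] [Module k M]
    [Module Uᵐᵒᵖ M] [IsScalarTower k Uᵐᵒᵖ M] : Type _ := Words H.η (modAct H.η M)

/-- The face operator `(m, u¹, …, uⁿ) ↦ (m u¹, u², …, uⁿ)`, equal to `0` for `n = 0`. -/
noncomputable def lastFace (H : LeftBialgebroid k A U) (M : Type*) [AddCommGroup M] [Module k M]
    [Module Uᵐᵒᵖ M] [IsScalarTower k Uᵐᵒᵖ M] : Module.End k (Chains H M) :=
  wlift (fun m l => match l with
      | [] => 0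
      | u :: l => wmk H.η (modAct H.η M) (m <• u) l)
    { lin_left := fun l => by
        rcases l with _ | ⟨u, l⟩
        · exact (0 : M →ₗ[k] _).isLinear
        · exact (((wmk_isWordMap H.η (modAct H.η M)).lin_left l).mk' ∘ₗ
            Algebra.lsmul k k M (MulOpposite.op u)).isLinear
      lin_letter := fun m l₁ l₂ => by
        rcases l₁ with _ | ⟨u, l₁⟩
        · refine ⟨fun x y => ?_, fun c x => ?_⟩
          · simp only [List.nil_append, MulOpposite.op_add, add_smul]
            exact ((wmk_isWordMap H.η (modAct H.η M)).lin_left l₂).map_add _ _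
          · simp only [List.nil_append, MulOpposite.op_smul, smul_assoc]
            exact ((wmk_isWordMap H.η (modAct H.η M)).lin_left l₂).map_smul _ _
        · exact (wmk_isWordMap H.η (modAct H.η M)).lin_letter _ l₁ l₂
      front := fun a m u l => by
        simp only [modAct_apply, act_rightModule_mul]
      inner := fun a m l₁ u v l₂ => by
        rcases l₁ with _ | ⟨w, l₁⟩
        · simpa [act_rightModule_mul, mul_smul] using
            (wmk_isWordMap H.η (modAct H.η M)).front a (m <• u) v l₂
        · exact (wmk_isWordMap H.η (modAct H.η M)).inner a _ l₁ u v l₂ }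

variable {H : LeftHopfAlgebroid k A U} (C : ModuleComodule H.toLeftBialgebroid M)

/-- The map `m ↦ m₀ ⊗ m₋₁`. -/
noncomputable def startState : M →ₗ[k] State H (modAct H.η M) :=
  balLift (ρ := fun a => LinearMap.mulLeft k (tgt H.η a)) (l := fun a => modAct H.η M a)
    (stMk H (modAct H.η M) ∘ₗ (TensorProduct.comm k U (Words H.η (modAct H.η M))).toLinearMap ∘ₗ
      (((wmk_isWordMap H.η (modAct H.η M)).lin_left []).mk').lTensor U) (by
    intro a h m
    simpa using (balMk_bal (act H.η (modAct H.η M))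
      (fun a : A => LinearMap.mulLeft k (tgt H.η a)) a (wmk H.η (modAct H.η M) m []) h).symm) ∘ₗ
    C.coact

theorem startState_act (a : A) (m : M) :
    startState C (modAct H.η M a m) = srcState H _ a (startState C m) := by
  obtain ⟨X, hX⟩ := balMk_surjective _ _ (C.coact m)
  rw [startState, LinearMap.comp_apply, LinearMap.comp_apply, C.coact_left a m X hX, ← hX,
    balLift_mk, balLift_mk]
  clear hX
  induction X using TensorProduct.induction_on with
  | zero => simp
  | tmul h m =>
    simp only [LinearMap.comp_apply, LinearMap.rTensor_tmul, LinearMap.lTensor_tmul,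
      LinearEquiv.coe_coe, TensorProduct.comm_tmul, srcState_mk, LinearMap.mulLeft_apply]
  | add X Y hX hY => rw [map_add, map_add, map_add, map_add, hX, hY]

/-- `(m, u¹, …, uⁿ) ↦ (m₀, u¹₊, …, uⁿ₊) ⊗ uⁿ₋ ⋯ u¹₋ m₋₁`. -/
noncomputable def spread : Chains H.toLeftBialgebroid M →ₗ[k] State H (modAct H.η M) :=
  wlift (fun m l => l.foldl (fun z u => step H _ u z) (startState C m)) (by
    have hlin : ∀ l : List U, ∃ g : Module.End k (State H (modAct H.η M)),
        ∀ z, l.foldl (fun z u => step H _ u z) z = g z := by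
      intro l
      induction l with
      | nil => exact ⟨1, fun z => rfl⟩
      | cons u l ih =>
        obtain ⟨g, hg⟩ := ih
        exact ⟨g * step H _ u, fun z => by simp [hg]⟩
    refine ⟨fun l => ?_, fun m l₁ l₂ => ?_, fun a m u l => ?_, fun a m l₁ u v l₂ => ?_⟩
    · obtain ⟨g, hg⟩ := hlin l
      simp_rw [hg]
      exact (g ∘ₗ startState C).isLinear
    · obtain ⟨g, hg⟩ := hlin l₂
      simp only [List.foldl_append, List.foldl_cons, hg]
      exact ((g ∘ₗ LinearMap.applyₗ (l₁.foldl (fun z u => step H _ u z) (startState C m))) ∘ₗ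
        (step_isLinear H (modAct H.η M)).mk').isLinear
    · simp only [List.foldl_cons]
      rw [startState_act, ← Module.End.mul_apply, step_srcState]
    · simp only [List.foldl_append, List.foldl_cons]
      rw [← Module.End.mul_apply, ← Module.End.mul_apply, ← srcState_step, ← step_srcState,
        mul_assoc])

/-- The cyclic operator
`(m, u¹, …, uⁿ) ↦ (m₀ u¹₊, u²₊, …, uⁿ₊, uⁿ₋ ⋯ u¹₋ m₋₁)`; for `n = 0` it is `m ↦ m₀ m₋₁`. -/
noncomputable def cyc : Module.End k (Chains H.toLeftBialgebroid M) :=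
  lastFace H.toLeftBialgebroid M ∘ₗ join H (modAct H.η M) ∘ₗ spread C

/-! ### The operators of the calculus -/

/-- The face operator `d_i` on chains of degree `n`, for `0 ≤ i ≤ n`:
`(m, u¹, …, uⁿ⁻¹ t(ε(uⁿ)))` for `i = 0`, `(m, …, uⁿ⁻ⁱ uⁿ⁻ⁱ⁺¹, …, uⁿ)` for `1 ≤ i ≤ n - 1` and
`(m u¹, u², …, uⁿ)` for `i = n`. There are no faces in degree `0`. -/
noncomputable def face (H : LeftBialgebroid k A U) (M : Type*) [AddCommGroup M] [Module k M]
    [Module Uᵐᵒᵖ M] [IsScalarTower k Uᵐᵒᵖ M] (n i : ℕ) : Module.End k (Chains H M) :=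
  if i = 0 then cap (modAct H.η M) H.counitCochain
  else if i = n then lastFace H M
  else slot (modAct H.η M) (n - i - 1) 2 (prod_isSlotMap H.η)

/-- The degeneracy `s_j` on chains of degree `n`, for `0 ≤ j ≤ n`:
`(m, u¹, …, uⁿ⁻ʲ, 1, uⁿ⁻ʲ⁺¹, …, uⁿ)`. -/
noncomputable def degen (H : LeftBialgebroid k A U) (M : Type*) [AddCommGroup M] [Module k M]
    [Module Uᵐᵒᵖ M] [IsScalarTower k Uᵐᵒᵖ M] (n j : ℕ) : Module.End k (Chains H M) :=
  slot (modAct H.η M) (n - j) 0 (prod_isSlotMap H.η)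

/-- The simplicial differential `b = ∑_{i=0}^{n} (-1)ⁱ d_i`. -/
noncomputable def bOp (H : LeftBialgebroid k A U) (M : Type*) [AddCommGroup M] [Module k M]
    [Module Uᵐᵒᵖ M] [IsScalarTower k Uᵐᵒᵖ M] : Module.End k (Chains H M) :=
  gr fun n => ∑ i ∈ Finset.range (n + 1), (-1 : ℤ) ^ i • face H M n i

/-- The operator `T = t^{n+1}`. -/
noncomputable def cycT : Module.End k (Chains H.toLeftBialgebroid M) :=
  gr fun n => cyc C ^ (n + 1)

/-- The norm operator `N = ∑_{i=0}^{n} (-1)^{in} tⁱ`. -/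
noncomputable def normOp : Module.End k (Chains H.toLeftBialgebroid M) :=
  gr fun n => ∑ i ∈ Finset.range (n + 1), (-1 : ℤ) ^ (i * n) • cyc C ^ i

/-- The extra degeneracy `s_{-1} = t s_n`. -/
noncomputable def extraDegen : Module.End k (Chains H.toLeftBialgebroid M) :=
  gr fun n => cyc C * degen H.toLeftBialgebroid M n n

/-- The cyclic differential `B = (id - t) s_{-1} N`. -/
noncomputable def BOp : Module.End k (Chains H.toLeftBialgebroid M) :=
  (1 - cyc C) * extraDegen C * normOp C

variable {p : ℕ} (φ : Cochain (k := k) H.η p)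

/-- The operator `D_φ^{i-th}`: on chains of degree `n`, for `p ≤ n` and `1 ≤ i ≤ n - p + 1`, it is
`(m, u¹, …, uⁿ) ↦ (m, u¹, …, uⁱ⁻¹, D_φ(uⁱ, …, u^{i+p-1}), u^{i+p}, …, uⁿ)`; it is `0` in the
degrees `n < i + p - 1`. -/
noncomputable def insertAt (M : Type*) [AddCommGroup M] [Module k M]
    [Module Uᵐᵒᵖ M] [IsScalarTower k Uᵐᵒᵖ M] (i : ℕ) :
    Module.End k (Chains H.toLeftBialgebroid M) :=
  slot (modAct H.η M) (i - 1) p (H.DD_isSlotMap φ)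

/-- The operator `D'_φ = D_φ^{i-th}` with `i = n - p + 1`, on chains of degree `n ≥ p`. -/
noncomputable def insertLast (M : Type*) [AddCommGroup M] [Module k M]
    [Module Uᵐᵒᵖ M] [IsScalarTower k Uᵐᵒᵖ M] : Module.End k (Chains H.toLeftBialgebroid M) :=
  gr fun n => if p ≤ n then insertAt φ M (n - p + 1) else 0

/-- The operator `ι_φ`. -/
noncomputable def iotaOp (M : Type*) [AddCommGroup M] [Module k M]
    [Module Uᵐᵒᵖ M] [IsScalarTower k Uᵐᵒᵖ M] : Module.End k (Chains H.toLeftBialgebroid M) :=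
  cap (modAct H.η M) φ

/-- The Lie derivative `L_φ`. On chains of degree `n ≥ p` it is
`∑_{i=1}^{n-p+1} (-1)^{(p-1)(n-i+1)} t^{n-p+1-i} D'_φ t^{i+p}`
`+ ∑_{i=1}^{p} (-1)^{n(i-1)+p-1} t^{n-p+1} D'_φ tⁱ`,
for `p = n + 1` it is `(-1)^{p-1} ι_φ B`, and for `p > n + 1` it is `0`. -/
noncomputable def lieOp : Module.End k (Chains H.toLeftBialgebroid M) :=
  gr fun n =>
    if p ≤ n then
      ∑ i ∈ Finset.Icc 1 (n - p + 1),
        (((p : ℤ) - 1) * ((n : ℤ) - ((i : ℤ) - 1))).negOnePow •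
          (cyc C ^ (n - p + 1 - i) * insertLast φ M * cyc C ^ (i + p))
      + ∑ i ∈ Finset.Icc 1 p, ((n : ℤ) * ((i : ℤ) - 1) + ((p : ℤ) - 1)).negOnePow •
          (cyc C ^ (n - p + 1) * insertLast φ M * cyc C ^ i)
    else if p = n + 1 then ((p : ℤ) - 1).negOnePow • (iotaOp φ M * BOp C)
    else 0

/-- The operator `S_φ`. On chains of degree `n ≥ p` it is
`∑_{j=0}^{n-p} ∑_{i=0}^{j} (-1)^{nj+(p-1)i} s_{-1} t^{n-p-i} D'_φ t^{n+i-(j-1)}`,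
for `p > n` it is `0`. -/
noncomputable def SOp : Module.End k (Chains H.toLeftBialgebroid M) :=
  gr fun n =>
    if p ≤ n then
      ∑ j ∈ Finset.range (n - p + 1), ∑ i ∈ Finset.range (j + 1),
        ((n : ℤ) * (j : ℤ) + ((p : ℤ) - 1) * (i : ℤ)).negOnePow •
          (extraDegen C * cyc C ^ (n - p - i) * insertLast φ M * cyc C ^ (n + i + 1 - j))
    else 0

/-! ### The reduced cyclic quotient and the cochains acting on it -/

/-- The image of `id - T`. -/
noncomputable def imT : Submodule k (Chains H.toLeftBialgebroid M) :=
  LinearMap.range (1 - cycT C)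

/-- The submodule spanned by the images of the degeneracy operators. -/
noncomputable def degenerate (H : LeftBialgebroid k A U) (M : Type*) [AddCommGroup M] [Module k M]
    [Module Uᵐᵒᵖ M] [IsScalarTower k Uᵐᵒᵖ M] : Submodule k (Chains H M) :=
  Submodule.span k {z | ∃ (m : M) (l : List U) (j : ℕ), j ≤ l.length ∧
    z = degen H M l.length j (wmk H.η (modAct H.η M) m l)}

/-- The kernel of the projection of the chains to the reduced cyclic quotient. -/
noncomputable def redCycKer : Submodule k (Chains H.toLeftBialgebroid M) :=
  imT C ⊔ degenerate H.toLeftBialgebroid M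

/-- The reduced cyclic quotient `C̄^cyc(U, M)`: the quotient of `C^cyc(U, M) = C(U, M) / im(id - T)`
by the images of the degeneracies. -/
abbrev RedCyc : Type _ := Chains H.toLeftBialgebroid M ⧸ redCycKer C

/-- Membership in `C_M(U)`: all `D_φ^{i-th}` map `im(id - T)` to itself. -/
def IsMCochain : Prop := ∀ i, 1 ≤ i → imT C ≤ (imT C).comap (insertAt φ M i)

/-- Membership in the intersection of the kernels of the codegeneracies. -/
def IsReduced : Prop := ∀ l₁ l₂ : List U, φ.toFun (l₁ ++ 1 :: l₂) = 0

/-- The endomorphism of the reduced cyclic quotient induced by an operator on chains that preserves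
the kernel of the projection. -/
noncomputable def onRedCyc (f : Module.End k (Chains H.toLeftBialgebroid M))
    (hf : redCycKer C ≤ (redCycKer C).comap f) : Module.End k (RedCyc C) :=
  (redCycKer C).mapQ (redCycKer C) f hf

/-- The graded commutator `X Y - (-1)^{de} Y X` of operators of degrees `d` and `e`. -/
def gradedComm {R : Type*} [Ring R] (d e : ℕ) (X Y : R) : R :=
  X * Y - (-1 : R) ^ (d * e) * (Y * X)

end Cyclic

end HopfAlgd

/-! Write `J` for the extra degeneracy `s_{-1}`, `λ` for the signed cyclic operator `(-1)ⁿ t`, and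
`Y` (`homotopy`) for the signed sum of all `D_φ^{i-th} λʳ` that fit. After the shifts of `D'_φ` by
powers of `t` have been carried out, `S_φ = J Y T` (`SOp_eq`). In the reduced cyclic quotient the
factor `T` disappears, and so does the factor `id - t` of `B`, because `t J` is degenerate. Hence
`S_φ` becomes `J Y` and `B` becomes `J N`.

Three computations on chains then give the formula. (1) `b J = 1 - λ - J b'`, where `b'` is `b`
without its last face (`bOp_coextra`). (2) `b' Y + Y_{δφ} = N ι_φ - (-1)^p Y b`
(`sum_sface_homotopy`). Faces that miss the inserted letter commute with the insertion, and those
that touch it are governed by the expansion of `D_{δφ}` in `DD_delta`. The one unmatched face of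
each row is a rotation of `ι_φ`. (3) `b ι_φ - (-1)^p ι_φ b = ι_{δφ}` (`bOp_iotaOp`). From (1) and
(2), `[b, S_φ] = (1 - λ) Y - B ι_φ + S_{δφ}` in the quotient. Moreover `B S_φ = 0 = S_φ B` there,
because `J N J` and `J Y J` are degenerate; both facts rest on `J J = s₀ J` (`coextra_coextra`).
Adding up, the right-hand side of the theorem is `(1 - λ) Y - (-1)^p ι_φ B`. In degrees `n ≥ p` the
first term telescopes (`homotopy_sub_lam`) and the second is a norm of insertions in the first place
(`iotaOp_coextra_normOp`). What remains is `L_φ` (`mkQ_lieOp`). In degrees below `p` only `ι_φ B`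
can survive, and it does so for `p = n + 1`, where `L_φ` is defined by it.

The paracyclic relations behind this follow from identities for the translation map `u₊ ⊗ u₋`, all
obtained from the Galois map and its inverse. The decisive ones are `cop_tr`, which makes `D_φ`
compatible with translation and hence with `t`, and `tr_tr`, which yields `J J = s₀ J`. The
hypotheses on `φ` serve the descent: `IsMCochain` takes care of `im(id - T)`, and `IsReduced` of the
degeneracies. -/

namespace HopfAlgd

/-! ### Sweedler sums -/

section Sweedler

variable {k X Y Z W : Type*} [CommRing k] [AddCommGroup X] [Module k X] [AddCommGroup Y]
  [Module k Y] [AddCommGroup Z] [Module k Z] [AddCommGroup W] [Module k W]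

/-- The sum of the values of `F` over a list of pairs. -/
def bsum {X Y Z : Type*} [AddCommGroup Z] (L : List (X × Y)) (F : X → Y → Z) : Z :=
  (L.map fun q => F q.1 q.2).sum

/-- The tensor represented by a list of pairs. -/
def tens (k : Type*) {X Y : Type*} [CommRing k] [AddCommGroup X] [Module k X] [AddCommGroup Y]
    [Module k Y] (L : List (X × Y)) : X ⊗[k] Y := bsum L fun x y => x ⊗ₜ[k] y

@[simp] theorem bsum_nil {X Y Z : Type*} [AddCommGroup Z] (F : X → Y → Z) :
    bsum ([] : List (X × Y)) F = 0 := rfl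

@[simp] theorem bsum_cons {X Y Z : Type*} [AddCommGroup Z] (q : X × Y) (L : List (X × Y))
    (F : X → Y → Z) : bsum (q :: L) F = F q.1 q.2 + bsum L F := by simp [bsum]

theorem bsum_append {X Y Z : Type*} [AddCommGroup Z] (L L' : List (X × Y)) (F : X → Y → Z) :
    bsum (L ++ L') F = bsum L F + bsum L' F := by simp [bsum]

theorem bsum_add {X Y Z : Type*} [AddCommGroup Z] (L : List (X × Y)) (F G : X → Y → Z) :
    bsum L (fun x y => F x y + G x y) = bsum L F + bsum L G := by
  simp [bsum, List.sum_map_add]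

theorem bsum_map {X Y X' Y' Z : Type*} [AddCommGroup Z] (L : List (X × Y))
    (f : X × Y → X' × Y') (F : X' → Y' → Z) :
    bsum (L.map f) F = bsum L fun x y => F (f (x, y)).1 (f (x, y)).2 := by
  simp [bsum, Function.comp_def]

theorem bsum_flatMap {X Y X' Y' Z : Type*} [AddCommGroup Z] (L : List (X × Y))
    (f : X × Y → List (X' × Y')) (F : X' → Y' → Z) :
    bsum (L.flatMap f) F = bsum L fun x y => bsum (f (x, y)) F := by
  induction L with
  | nil => rfl
  | cons q L ih => rw [List.flatMap_cons, bsum_append, ih, bsum_cons]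

theorem map_bsum {X Y Z W G : Type*} [AddCommGroup Z] [AddCommGroup W] [FunLike G Z W]
    [AddMonoidHomClass G Z W] (g : G) (L : List (X × Y)) (F : X → Y → Z) :
    g (bsum L F) = bsum L fun x y => g (F x y) := by
  induction L with
  | nil => simp
  | cons q L ih => simp [ih]

theorem bsum_comm {X Y X' Y' Z : Type*} [AddCommGroup Z] (L : List (X × Y))
    (L' : List (X' × Y')) (F : X → Y → X' → Y' → Z) :
    bsum L (fun x y => bsum L' (F x y)) =
      bsum L' fun x' y' => bsum L fun x y => F x y x' y' := by
  induction L with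
  | nil => induction L' with
    | nil => rfl
    | cons q L' ih => rw [bsum_cons, ← ih]; simp
  | cons q L ih =>
    rw [bsum_cons, ih]
    simp only [bsum_cons]
    clear ih
    induction L' with
    | nil => simp
    | cons q' L' ih => simp only [bsum_cons, ← ih]; abel

/-- Comparison only on members of the list is needed where an identity depends on the lengths of the
expanded words, which are known through `length_of_mem_expand`. -/
theorem bsum_mem_congr {X Y Z : Type*} [AddCommGroup Z] (L : List (X × Y)) {F G : X → Y → Z}
    (h : ∀ q ∈ L, F q.1 q.2 = G q.1 q.2) : bsum L F = bsum L G := by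
  unfold bsum
  exact congrArg List.sum (List.map_congr_left h)

/-- Linearity of a sum of linear functions over a list of pairs. -/
theorem bsum_isLinear {X Y : Type*} (L : List (X × Y)) {F : W → X → Y → Z}
    (h : ∀ x y, IsLinearMap k fun w => F w x y) : IsLinearMap k fun w => bsum L (F w) := by
  induction L with
  | nil => exact (0 : W →ₗ[k] Z).isLinear
  | cons q L ih =>
    simp only [bsum_cons]
    exact ((h q.1 q.2).mk' + ih.mk').isLinear

theorem exists_tens (z : X ⊗[k] Y) : ∃ L, tens k L = z := by
  induction z using TensorProduct.induction_on with
  | zero => exact ⟨[], rfl⟩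
  | tmul x y => exact ⟨[(x, y)], by simp [tens]⟩
  | add z w hz hw =>
    obtain ⟨L, rfl⟩ := hz
    obtain ⟨L', rfl⟩ := hw
    exact ⟨L ++ L', bsum_append _ _ _⟩

/-- Bilinear functions of two variables. -/
structure IsBilin (k : Type*) {X Y Z : Type*} [CommRing k] [AddCommGroup X] [Module k X]
    [AddCommGroup Y] [Module k Y] [AddCommGroup Z] [Module k Z] (F : X → Y → Z) : Prop where
  left : ∀ y, IsLinearMap k fun x => F x y
  right : ∀ x, IsLinearMap k fun y => F x y

/-- The linear map on the tensor product defined by a bilinear function. -/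
noncomputable def IsBilin.lift {F : X → Y → Z} (h : IsBilin k F) : X ⊗[k] Y →ₗ[k] Z :=
  TensorProduct.lift (LinearMap.mk₂ k F (fun x x' y => (h.left y).map_add x x')
    (fun c x y => (h.left y).map_smul c x) (fun x y y' => (h.right x).map_add y y')
    (fun c x y => (h.right x).map_smul c y))

theorem IsBilin.lift_tmul {F : X → Y → Z} (h : IsBilin k F) (x : X) (y : Y) :
    h.lift (x ⊗ₜ y) = F x y := rfl

theorem IsBilin.lift_tens {F : X → Y → Z} (h : IsBilin k F) (L : List (X × Y)) :
    h.lift (tens k L) = bsum L F := by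
  rw [tens, map_bsum]
  rfl

variable {A : Type*} {ρ : A → X →ₗ[k] X} {l : A → Y →ₗ[k] Y}

/-- Balanced bilinear functions. -/
structure IsBal (ρ : A → X →ₗ[k] X) (l : A → Y →ₗ[k] Y) (F : X → Y → Z) : Prop
    extends IsBilin k F where
  bal : ∀ a x y, F (ρ a x) y = F x (l a y)

/-- The linear map on the balanced tensor product defined by a balanced function. -/
noncomputable def IsBal.lift {F : X → Y → Z} (h : IsBal ρ l F) : BalTensor ρ l →ₗ[k] Z :=
  balLift h.toIsBilin.lift h.bal

theorem IsBal.lift_tmul {F : X → Y → Z} (h : IsBal ρ l F) (x : X) (y : Y) :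
    h.lift (balMk ρ l (x ⊗ₜ y)) = F x y := rfl

theorem IsBal.lift_tens {F : X → Y → Z} (h : IsBal ρ l F) (L : List (X × Y)) :
    h.lift (balMk ρ l (tens k L)) = bsum L F := h.toIsBilin.lift_tens L

/-- This legitimizes lists as Sweedler notation: the chosen list is arbitrary, but a balanced
function sees only its class in the balanced tensor product. -/
theorem IsBal.bsum_eq {F : X → Y → Z} (h : IsBal ρ l F) {L L' : List (X × Y)}
    (hL : balMk ρ l (tens k L) = balMk ρ l (tens k L')) : bsum L F = bsum L' F := by
  rw [← h.lift_tens, hL, h.lift_tens]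

theorem balMk_isBal (ρ : A → X →ₗ[k] X) (l : A → Y →ₗ[k] Y) :
    IsBal ρ l fun x y => balMk ρ l (x ⊗ₜ y) where
  left y := ((balMk ρ l) ∘ₗ (TensorProduct.mk k X Y).flip y).isLinear
  right x := ((balMk ρ l) ∘ₗ TensorProduct.mk k X Y x).isLinear
  bal a x y := balMk_bal ρ l a x y

theorem balMk_tens (ρ : A → X →ₗ[k] X) (l : A → Y →ₗ[k] Y) (L : List (X × Y)) :
    balMk ρ l (tens k L) = bsum L fun x y => balMk ρ l (x ⊗ₜ y) := map_bsum _ _ _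

theorem isLinear_comp {F : Y → Z} {f : X → Y} (hF : IsLinearMap k F) (hf : IsLinearMap k f) :
    IsLinearMap k fun x => F (f x) := (hF.mk' ∘ₗ hf.mk').isLinear

/-- Trilinear functions that are balanced in the first two and in the last two variables vanish
on the relations of threefold tensor products. -/
structure IsTriBal {A₁ : Type*} (ρ₁ : A₁ → X →ₗ[k] X) (l₁ ρ₂ : A₁ → Y →ₗ[k] Y)
    (l₂ : A₁ → W →ₗ[k] W) (F : X → Y → W → Z) : Prop where
  lin₁ : ∀ y w, IsLinearMap k fun x => F x y w
  lin₂ : ∀ x w, IsLinearMap k fun y => F x y w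
  lin₃ : ∀ x y, IsLinearMap k fun w => F x y w
  bal₁ : ∀ a x y w, F (ρ₁ a x) y w = F x (l₁ a y) w
  bal₂ : ∀ a x y w, F x (ρ₂ a y) w = F x y (l₂ a w)

variable {A₁ : Type*} {ρ₁ : A₁ → X →ₗ[k] X} {l₁ ρ₂ : A₁ → Y →ₗ[k] Y}
    {l₂ : A₁ → W →ₗ[k] W}

/-- The linear map on the threefold tensor product defined by a trilinear function. -/
noncomputable def IsTriBal.lift {F : X → Y → W → Z} (h : IsTriBal ρ₁ l₁ ρ₂ l₂ F) :
    X ⊗[k] (Y ⊗[k] W) →ₗ[k] Z :=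
  (IsBilin.lift (k := k) (F := fun x (z : Y ⊗[k] W) =>
      (IsBilin.lift (k := k) (F := F x) ⟨h.lin₂ x, h.lin₃ x⟩) z)
    { left := fun z => by
        obtain ⟨L, rfl⟩ := exists_tens z
        simp only [IsBilin.lift_tens]
        exact bsum_isLinear L fun y w => h.lin₁ y w
      right := fun x => (IsBilin.lift _).isLinear })

theorem IsTriBal.lift_tmul {F : X → Y → W → Z} (h : IsTriBal ρ₁ l₁ ρ₂ l₂ F) (x : X) (y : Y)
    (w : W) : h.lift (x ⊗ₜ (y ⊗ₜ w)) = F x y w := rfl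

theorem IsTriBal.lift_tens {F : X → Y → W → Z} (h : IsTriBal ρ₁ l₁ ρ₂ l₂ F) (x : X)
    (L : List (Y × W)) : h.lift (x ⊗ₜ tens k L) = bsum L (F x) := by
  rw [tens, ← TensorProduct.mk_apply, map_bsum, map_bsum]
  rfl

theorem IsTriBal.lift_eq {F : X → Y → W → Z} (h : IsTriBal ρ₁ l₁ ρ₂ l₂ F)
    {z z' : X ⊗[k] (Y ⊗[k] W)} (hz : z - z' ∈ triRel ρ₁ l₁ ρ₂ l₂) : h.lift z = h.lift z' := by
  rw [← sub_eq_zero, ← map_sub]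
  have : triRel ρ₁ l₁ ρ₂ l₂ ≤ LinearMap.ker h.lift := by
    rw [triRel, Submodule.span_le]
    rintro _ (⟨a, x, y, w, rfl⟩ | ⟨a, x, y, w, rfl⟩)
    · simp [h.lift_tmul, h.bal₁]
    · simp [h.lift_tmul, h.bal₂]
  exact this hz

end Sweedler

/-! ### Sweedler calculus for the coproduct -/

section Bialgebroid

variable {k A U Z : Type*} [CommRing k] [Ring A] [Algebra k A] [Ring U] [Algebra k U]
  [AddCommGroup Z] [Module k Z]

theorem isLinear_mul_right {F : U → Z} (hF : IsLinearMap k F) (v : U) :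
    IsLinearMap k fun x => F (x * v) := isLinear_comp hF (LinearMap.mulRight k v).isLinear

theorem isLinear_mul_left {F : U → Z} (hF : IsLinearMap k F) (v : U) :
    IsLinearMap k fun x => F (v * x) := isLinear_comp hF (LinearMap.mulLeft k v).isLinear

namespace LeftBialgebroid

variable (H : LeftBialgebroid k A U)

/-- Functions on `U_◁ ⊗ {}_▷U`. -/
abbrev BalUU (F : U → U → Z) : Prop :=
  IsBal (k := k) (fun a => LinearMap.mulLeft k (tgt H.η a)) (lsrc H.η) F

/-- Functions on `U_◁ ⊗ {}_▷U_◁ ⊗ {}_▷U`. -/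
abbrev BalUUU (F : U → U → U → Z) : Prop :=
  IsTriBal (k := k) (fun a => LinearMap.mulLeft k (tgt H.η a)) (lsrc H.η)
    (fun a => LinearMap.mulLeft k (tgt H.η a)) (lsrc H.η) F

/-- Functions on `{}_▸U ⊗ U_◁`. -/
abbrev BalOp (F : U → U → Z) : Prop :=
  IsBal (k := k) (fun a : A => LinearMap.mulRight k (tgt H.η a))
    (fun a => LinearMap.mulLeft k (tgt H.η a)) F

theorem exists_cop (u : U) : ∃ L, H.mkUU (tens k L) = H.Δ u := by
  obtain ⟨X, hX⟩ := H.mkUU_surjective (H.Δ u)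
  obtain ⟨L, rfl⟩ := exists_tens X
  exact ⟨L, hX⟩

/-- A list of pairs that represents `Δ u`. -/
noncomputable def cop (u : U) : List (U × U) := (H.exists_cop u).choose

theorem mk_cop (u : U) : H.mkUU (tens k (H.cop u)) = H.Δ u := (H.exists_cop u).choose_spec

variable {H} {F : U → U → Z}

theorem BalUU.lift_Δ (h : H.BalUU F) (u : U) : h.lift (H.Δ u) = bsum (H.cop u) F := by
  rw [← mk_cop]
  exact h.lift_tens _

theorem BalUU.isLinear (h : H.BalUU F) : IsLinearMap k fun u => bsum (H.cop u) F := by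
  simp only [← BalUU.lift_Δ h]
  exact (h.lift ∘ₗ H.Δ).isLinear

theorem BalUU.mul_right (h : H.BalUU F) (v w : U) : H.BalUU fun x y => F (x * v) (y * w) where
  left y := isLinear_mul_right (h.left _) v
  right x := isLinear_mul_right (h.right _) w
  bal a x y := by simpa [mul_assoc] using h.bal a (x * v) (y * w)

theorem BalUU.one (h : H.BalUU F) : bsum (H.cop 1) F = F 1 1 := by
  rw [← BalUU.lift_Δ h, H.Δ_one]
  rfl

/-- The representative of `Δ v` is left free so that `BalUU.mul_src` can use the one-term list `s(a)
⊗ 1` for `v = s(a)`. -/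
theorem BalUU.mul_of_mk (h : H.BalUU F) (u : U) {v : U} {L : List (U × U)}
    (hL : H.mkUU (tens k L) = H.Δ v) : bsum (H.cop (u * v)) F =
    bsum (H.cop u) fun x y => bsum L fun x' y' => F (x * x') (y * y') := by
  rw [← BalUU.lift_Δ h, H.Δ_mul u v _ _ (H.mk_cop u) hL]
  have : tens k (H.cop u) * tens k L = bsum (H.cop u) fun x y =>
      bsum L fun x' y' => (x * x') ⊗ₜ[k] (y * y') := by
    rw [tens, ← LinearMap.mulRight_apply (R := k), map_bsum]
    congr 1; funext x y
    rw [LinearMap.mulRight_apply, tens, ← LinearMap.mulLeft_apply (R := k), map_bsum]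
    simp
  rw [this, map_bsum, map_bsum]
  congr 1; funext x y
  rw [map_bsum, map_bsum]
  rfl

theorem BalUU.mul (h : H.BalUU F) (u v : U) : bsum (H.cop (u * v)) F =
    bsum (H.cop u) fun x y => bsum (H.cop v) fun x' y' => F (x * x') (y * y') :=
  BalUU.mul_of_mk h u (H.mk_cop v)

theorem BalUU.src_tgt_mul (h : H.BalUU F) (a b : A) (u : U) :
    bsum (H.cop (src H.η a * tgt H.η b * u)) F =
      bsum (H.cop u) fun x y => F (src H.η a * x) (tgt H.η b * y) := by
  rw [← BalUU.lift_Δ h, H.Δ_bimod a b u _ (H.mk_cop u), tens,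
    ← LinearMap.mulLeft_apply (R := k), map_bsum, map_bsum, map_bsum]
  congr 1; funext x y
  simp [h.lift_tmul]

theorem BalUU.tgt_mul (h : H.BalUU F) (a : A) (u : U) :
    bsum (H.cop (tgt H.η a * u)) F = bsum (H.cop u) fun x y => F x (tgt H.η a * y) := by
  simpa using BalUU.src_tgt_mul h 1 a u

theorem BalUU.src_mul (h : H.BalUU F) (a : A) (u : U) :
    bsum (H.cop (src H.η a * u)) F = bsum (H.cop u) fun x y => F (src H.η a * x) y := by
  simpa using BalUU.src_tgt_mul h a 1 u

theorem BalUU.mul_src (h : H.BalUU F) (a : A) (u : U) :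
    bsum (H.cop (u * src H.η a)) F =
      bsum (H.cop u) fun x y => F (x * src H.η a) y := by
  have e : H.mkUU (tens k [(src H.η a, (1 : U))]) = H.Δ (src H.η a) := by
    have := H.Δ_bimod a 1 1 1 H.Δ_one.symm
    simpa [tens] using this.symm
  simpa using BalUU.mul_of_mk h u e

theorem BalUU.takeuchi (h : H.BalUU F) (a : A) (u : U) :
    bsum (H.cop u) (fun x y => F (x * tgt H.η a) y) =
      bsum (H.cop u) fun x y => F x (y * src H.η a) := by
  have := congrArg h.lift (H.takeuchi a u _ (H.mk_cop u))
  rw [tens, ← LinearMap.mulRight_apply (R := k), ← LinearMap.mulRight_apply (R := k),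
    map_bsum, map_bsum, map_bsum, map_bsum, map_bsum, map_bsum] at this
  simpa [h.lift_tmul] using this

variable (H) in
theorem cop_counit_left (u : U) : bsum (H.cop u) (fun x y => src H.η (H.ε x) * y) = u := by
  have := H.counit_left u _ (H.mk_cop u)
  rw [tens, map_bsum, map_bsum] at this
  simpa [srcHom_apply] using this

variable (H) in
theorem cop_counit_right (u : U) :
    bsum (H.cop u) (fun x y => tgt H.η (H.ε y) * x) = u := by
  have := H.counit_right u _ (H.mk_cop u)
  rw [tens, map_bsum] at this
  simpa using this

theorem BalUUU.coassoc {F : U → U → U → Z} (h : H.BalUUU F) (u : U) :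
    bsum (H.cop u) (fun x y => bsum (H.cop x) fun x₁ x₂ => F x₁ x₂ y) =
      bsum (H.cop u) fun x y => bsum (H.cop y) fun y₁ y₂ => F x y₁ y₂ := by
  -- The axiom quantifies over representatives of the two iterated coproducts; the ones built from
  -- the lists `cop` are supplied.
  have := IsTriBal.lift_eq h (H.coassoc u _
    (bsum (H.cop u) fun x y => tens k (H.cop x) ⊗ₜ[k] y)
    (bsum (H.cop u) fun x y => x ⊗ₜ[k] tens k (H.cop y)) (H.mk_cop u)
    (by
      rw [map_bsum, tens, map_bsum]
      congr 1; funext x y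
      rw [LinearMap.rTensor_tmul, LinearMap.rTensor_tmul, mk_cop])
    (by
      rw [map_bsum, tens, map_bsum]
      congr 1; funext x y
      rw [LinearMap.lTensor_tmul, LinearMap.lTensor_tmul, mk_cop]))
  rw [map_bsum, map_bsum, map_bsum] at this
  simp only [h.lift_tens] at this
  rw [← this]
  congr 1; funext x y
  have e : tens k (H.cop x) ⊗ₜ[k] y = bsum (H.cop x) fun x₁ x₂ => (x₁ ⊗ₜ[k] x₂) ⊗ₜ[k] y := by
    rw [tens, ← TensorProduct.mk_apply, ← LinearMap.flip_apply, map_bsum]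
    rfl
  rw [e, map_bsum, map_bsum]
  rfl

end LeftBialgebroid

end Bialgebroid

end HopfAlgd

namespace HopfAlgd

/-! ### Identities for the translation map `u₊ ⊗ u₋` -/

namespace LeftHopfAlgebroid

open LeftBialgebroid

variable {k A U Z : Type*} [CommRing k] [Ring A] [Algebra k A] [Ring U] [Algebra k U]
  [AddCommGroup Z] [Module k Z] (H : LeftHopfAlgebroid k A U)

theorem exists_tr (u : U) : ∃ L, H.mkUopU (tens k L) = H.trans u := by
  obtain ⟨X, hX⟩ := H.mkUopU_surjective (H.trans u)
  obtain ⟨L, rfl⟩ := exists_tens X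
  exact ⟨L, hX⟩

/-- A list of pairs that represents `u₊ ⊗ u₋`. -/
noncomputable def tr (u : U) : List (U × U) := (H.exists_tr u).choose

theorem mk_tr (u : U) : H.mkUopU (tens k (H.tr u)) = H.trans u := (H.exists_tr u).choose_spec

theorem galois_tens (L : List (U × U)) : H.galois (H.mkUopU (tens k L)) =
    bsum L fun x y => bsum (H.cop x) fun x₁ x₂ => H.mkUU (x₁ ⊗ₜ (x₂ * y)) := by
  rw [tens, map_bsum, map_bsum]
  congr 1; funext x y
  rw [galois_mk, preGalois_tmul, ← H.mk_cop, rmulUU_mk, tens,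
    ← LinearMap.mulRight_apply (R := k), map_bsum, map_bsum]
  simp

variable {H} {F : U → U → Z}

theorem BalOp.lift_trans (h : H.BalOp F) (u : U) : h.lift (H.trans u) = bsum (H.tr u) F := by
  rw [← mk_tr]
  exact h.lift_tens _

theorem BalOp.isLinear (h : H.BalOp F) : IsLinearMap k fun u => bsum (H.tr u) F := by
  simp only [← BalOp.lift_trans h]
  exact (h.lift ∘ₗ H.trans).isLinear

theorem BalOp.tr_eq (h : H.BalOp F) {u : U} {L : List (U × U)}
    (hL : H.trans u = H.mkUopU (tens k L)) : bsum (H.tr u) F = bsum L F := by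
  rw [← BalOp.lift_trans h, hL]
  exact h.lift_tens _

/-- Injectivity of the Galois map reduces identities between translation terms to the coproduct
calculus: both sides are compared after `u ⊗ v ↦ u₁ ⊗ u₂ v`. -/
theorem mk_eq_of_galois {L L' : List (U × U)}
    (h : (bsum L fun x y => bsum (H.cop x) fun x₁ x₂ => H.mkUU (x₁ ⊗ₜ (x₂ * y))) =
      bsum L' fun x y => bsum (H.cop x) fun x₁ x₂ => H.mkUU (x₁ ⊗ₜ (x₂ * y))) :
    H.mkUopU (tens k L) = H.mkUopU (tens k L') := by
  apply H.galois_bijective.1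
  rw [galois_tens, galois_tens, h]

theorem trans_eq_of_galois {L : List (U × U)} {u : U}
    (h : (bsum L fun x y => bsum (H.cop x) fun x₁ x₂ => H.mkUU (x₁ ⊗ₜ (x₂ * y))) =
      H.mkUU (u ⊗ₜ 1)) : H.trans u = H.mkUopU (tens k L) := by
  apply H.galois_bijective.1
  rw [galois_tens, galois_trans, h]

theorem mkUU_bal (v w : U) : H.BalUU fun x y => H.mkUU ((x * v) ⊗ₜ (y * w)) :=
  BalUU.mul_right (balMk_isBal _ _) v w

theorem mkUU_bal_right (w : U) : H.BalUU fun x y => H.mkUU (x ⊗ₜ (y * w)) := by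
  simpa using mkUU_bal (H := H) 1 w

/-- `u₊₁ ⊗ u₊₂ u₋ = u ⊗ 1`. -/
theorem BalUU.gal (h : H.BalUU F) (u : U) :
    bsum (H.tr u) (fun x y => bsum (H.cop x) fun x₁ x₂ => F x₁ (x₂ * y)) = F u 1 := by
  have e := congrArg h.lift (H.galois_trans u)
  rw [← mk_tr, galois_tens, map_bsum] at e
  simp only [map_bsum, h.lift_tmul] at e
  exact e

theorem BalUU.mul_left_fst (h : H.BalUU F) (a : A) : H.BalUU fun x y => F (src H.η a * x) y where
  left y := isLinear_mul_left (h.left _) _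
  right x := h.right _
  bal b x y := by simpa [← mul_assoc, src_tgt] using h.bal b (src H.η a * x) y

theorem BalOp.src_one_of (h : H.BalOp F) (a : A) :
    bsum (H.tr (src H.η a)) F = F (src H.η a) 1 := by
  have : H.trans (src H.η a) = H.mkUopU (tens k [(src H.η a, 1)]) := by
    apply trans_eq_of_galois
    simp only [bsum_cons, bsum_nil, add_zero, mul_one]
    rw [← mul_one (src H.η a), BalUU.src_mul (balMk_isBal _ _),
      BalUU.one (BalUU.mul_left_fst (balMk_isBal _ _) a)]
  simpa using BalOp.tr_eq h this

theorem BalOp.one (h : H.BalOp F) : bsum (H.tr 1) F = F 1 1 := by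
  simpa using BalOp.src_one_of h 1

/-- Left multiplication by `Δ u` is well defined on the balanced tensor product precisely by the
Takeuchi condition. -/
theorem mkUU_cop_bal (u w : U) : H.BalUU fun a b => bsum (H.cop u) fun x y =>
    H.mkUU ((x * a) ⊗ₜ (y * (b * w))) := by
  refine ⟨⟨fun b => bsum_isLinear _ fun x y => (H.mkUU ∘ₗ
      (TensorProduct.mk k U U).flip (y * (b * w)) ∘ₗ LinearMap.mulLeft k x).isLinear,
    fun a => bsum_isLinear _ fun x y => (H.mkUU ∘ₗ TensorProduct.mk k U U (x * a) ∘ₗ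
      LinearMap.mulLeft k y ∘ₗ LinearMap.mulRight k w).isLinear⟩, fun c a b => ?_⟩
  simpa [mul_assoc] using BalUU.takeuchi (mkUU_bal (H := H) a (b * w)) c u

/-- The Galois map sends `u₊v₊ ⊗ v₋u₋` to `u₊₁v₊₁ ⊗ u₊₂v₊₂v₋u₋`. The inner factor `v₊₁ ⊗ v₊₂v₋`
collapses to `v ⊗ 1`, then `u₊₁ ⊗ u₊₂u₋` to `u ⊗ 1`. -/
theorem BalOp.mul (h : H.BalOp F) (u v : U) : bsum (H.tr (u * v)) F =
    bsum (H.tr u) fun x y => bsum (H.tr v) fun x' y' => F (x * x') (y' * y) := by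
  have : H.trans (u * v) = H.mkUopU (tens k ((H.tr u).flatMap fun q =>
      (H.tr v).map fun q' => (q.1 * q'.1, q'.2 * q.2))) := by
    apply trans_eq_of_galois
    simp only [bsum_flatMap, bsum_map]
    calc _ = bsum (H.tr u) fun x y => bsum (H.cop x) fun x₁ x₂ =>
          H.mkUU ((x₁ * v) ⊗ₜ (x₂ * y)) := by
          congr 1; funext x y
          have e' := BalUU.gal (mkUU_cop_bal (H := H) x y) v
          simp only [one_mul] at e'
          rw [← e']
          congr 1; funext x' y'
          rw [BalUU.mul (mkUU_bal_right _), bsum_comm]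
          simp only [mul_assoc]
      _ = _ := by
          have e := BalUU.gal (mkUU_bal (H := H) v 1) u
          simpa using e
  rw [BalOp.tr_eq h this, bsum_flatMap]
  simp only [bsum_map]

theorem BalOp.mul_right_snd (h : H.BalOp F) (w : U) : H.BalOp fun x y => F x (y * w) where
  left y := h.left _
  right x := isLinear_mul_right (h.right _) w
  bal a x y := by simpa [mul_assoc] using h.bal a x (y * w)

theorem BalOp.mul_left_fst (h : H.BalOp F) (w : U) : H.BalOp fun x y => F (w * x) y where
  left y := isLinear_mul_left (h.left _) w
  right x := h.right _
  bal a x y := by simpa [mul_assoc] using h.bal a (w * x) y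

theorem BalOp.src_mul (h : H.BalOp F) (a : A) (u : U) :
    bsum (H.tr (src H.η a * u)) F = bsum (H.tr u) fun x y => F (src H.η a * x) y := by
  have : H.trans (src H.η a * u) =
      H.mkUopU (tens k ((H.tr u).map fun q => (src H.η a * q.1, q.2))) := by
    apply trans_eq_of_galois
    rw [bsum_map, ← BalUU.gal (BalUU.mul_left_fst (balMk_isBal _ _) a) u]
    congr 1; funext x y
    rw [BalUU.src_mul (mkUU_bal_right y)]
  rw [BalOp.tr_eq h this, bsum_map]

theorem BalOp.tgt_mul (h : H.BalOp F) (a : A) (u : U) :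
    bsum (H.tr (tgt H.η a * u)) F = bsum (H.tr u) fun x y => F x (y * src H.η a) := by
  rw [← BalOp.lift_trans h, H.trans_tgt_mul a u _ (H.mk_tr u), tens,
    ← LinearMap.mulRight_apply (R := k), map_bsum, map_bsum, map_bsum]
  congr 1; funext x y
  simp [h.lift_tmul]

theorem BalOp.mul_tgt (h : H.BalOp F) (a : A) (u : U) :
    bsum (H.tr (u * tgt H.η a)) F = bsum (H.tr u) fun x y => F x (src H.η a * y) := by
  rw [← BalOp.lift_trans h, H.trans_mul_tgt a u _ (H.mk_tr u), tens,
    ← LinearMap.mulLeft_apply (R := k), map_bsum, map_bsum, map_bsum]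
  congr 1; funext x y
  simp [h.lift_tmul]

theorem BalOp.takeuchi (h : H.BalOp F) (a : A) (u : U) :
    bsum (H.tr u) (fun x y => F (tgt H.η a * x) y) =
      bsum (H.tr u) fun x y => F x (y * tgt H.η a) := by
  have := congrArg h.lift (H.trans_takeuchi a u _ (H.mk_tr u))
  rw [tens, ← LinearMap.mulRight_apply (R := k) _ (bsum _ _),
    ← LinearMap.mulLeft_apply (R := k) _ (bsum _ _),
    map_bsum, map_bsum, map_bsum, map_bsum, map_bsum, map_bsum] at this
  simpa [h.lift_tmul] using this

/-- `(u₁ g)₊ ⊗ (u₁ g)₋ u₂ = u g₊ ⊗ g₋`. -/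
theorem BalOp.gal_mul (h : H.BalOp F) (u g : U) :
    bsum (H.cop u) (fun x y => bsum (H.tr (x * g)) fun p q => F p (q * y)) =
      bsum (H.tr g) fun p q => F (u * p) q := by
  have : H.mkUopU (tens k ((H.cop u).flatMap fun q => (H.tr (q.1 * g)).map fun q' =>
      (q'.1, q'.2 * q.2))) = H.mkUopU (tens k ((H.tr g).map fun q => (u * q.1, q.2))) := by
    apply mk_eq_of_galois
    simp only [bsum_flatMap, bsum_map]
    -- Both sides have the Galois image `u₁ g ⊗ u₂`: on the left the translation of `u₁ g`
    -- collapses, on the right that of `g`.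
    trans bsum (H.cop u) fun x y => H.mkUU ((x * g) ⊗ₜ y)
    · congr 1; funext x y
      have e' := BalUU.gal (mkUU_bal_right (H := H) y) (x * g)
      simp only [one_mul] at e'
      simpa only [mul_assoc] using e'
    · have e' := BalUU.gal (mkUU_cop_bal (H := H) u 1) g
      simp only [mul_one] at e'
      rw [← e']
      congr 1; funext p q
      rw [BalUU.mul (mkUU_bal_right _), bsum_comm]
      simp only [mul_assoc]
  have e := h.bsum_eq this
  simpa only [bsum_flatMap, bsum_map] using e

/-- `u₁₊ ⊗ u₁₋ u₂ = u ⊗ 1`. -/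
theorem BalOp.gal (h : H.BalOp F) (u : U) :
    bsum (H.cop u) (fun x y => bsum (H.tr x) fun p q => F p (q * y)) = F u 1 := by
  have := BalOp.gal_mul h u 1
  simp only [mul_one] at this
  rw [this, BalOp.one, mul_one]
  exact BalOp.mul_left_fst h u

variable {G : U → U → U → Z}

/-- `u₊₁ ⊗ u₊₂ ⊗ u₋ = u₁ ⊗ u₂₊ ⊗ u₂₋`. -/
theorem cop_tr (h₁ : ∀ y z, IsLinearMap k fun x => G x y z)
    (h₂ : ∀ x z, IsLinearMap k fun y => G x y z) (h₃ : ∀ x y, IsLinearMap k fun z => G x y z)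
    (hb₁ : ∀ a x y z, G (tgt H.η a * x) y z = G x (src H.η a * y) z)
    (hb₂ : ∀ a x y z, G x (y * tgt H.η a) z = G x y (tgt H.η a * z)) (u : U) :
    bsum (H.tr u) (fun x y => bsum (H.cop x) fun x₁ x₂ => G x₁ x₂ y) =
      bsum (H.cop u) fun x y => bsum (H.tr y) fun p q => G x p q := by
  have hop : ∀ x c, H.BalOp fun p q => G x p (q * c) := fun x c =>
    BalOp.mul_right_snd (F := G x) ⟨⟨fun z => h₂ x z, fun y => h₃ x y⟩, fun a y z => hb₂ a x y z⟩ c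
  have htri : H.BalUUU fun a b c => bsum (H.tr b) fun p q => G a p (q * c) := by
    refine ⟨fun b c => bsum_isLinear _ fun p q => h₁ _ _, fun a c => BalOp.isLinear (hop a c),
      fun a b => bsum_isLinear _ fun p q => isLinear_mul_left (h₃ _ _) _, fun e a b c => ?_,
      fun e a b c => ?_⟩
    · simp only [LinearMap.mulLeft_apply, BalOp.src_mul (hop a c), hb₁]
    · simp only [LinearMap.mulLeft_apply, BalOp.tgt_mul (hop a c), mul_assoc]
  have hop' : ∀ x, H.BalUU fun b c => bsum (H.tr b) fun p q => G x p (q * c) := fun x =>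
    ⟨⟨fun c => htri.lin₂ x c, fun b => htri.lin₃ x b⟩, fun a b c => htri.bal₂ a x b c⟩
  have hc : ∀ c, H.BalUU fun a b => bsum (H.tr b) fun p q => G a p (q * c) := fun c =>
    ⟨⟨fun b => htri.lin₁ b c, fun a => htri.lin₂ a c⟩, fun e a b => htri.bal₁ e a b c⟩
  have h2 : H.BalUU fun a c => bsum (H.cop a) fun a₁ a₂ =>
      bsum (H.tr a₂) fun p q => G a₁ p (q * c) := by
    refine ⟨⟨fun c => BalUU.isLinear (hc c), fun a => bsum_isLinear _ fun a₁ a₂ =>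
      htri.lin₃ _ _⟩, fun e a c => ?_⟩
    simp only [LinearMap.mulLeft_apply]
    rw [BalUU.tgt_mul (hc c)]
    congr 1; funext a₁ a₂
    exact htri.bal₂ e a₁ a₂ c
  -- Substituting `u ⊗ 1 = u₊₁ ⊗ u₊₂u₋` in `u₁ ⊗ u₂₊ ⊗ u₂₋` and reassociating gives `u₊₁ ⊗ (u₊₂)₁₊ ⊗
  -- (u₊₂)₁₋(u₊₂)₂u₋`, which `BalOp.gal` contracts to `u₊₁ ⊗ u₊₂ ⊗ u₋`.
  have := BalUU.gal h2 u
  simp only [mul_one] at this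
  rw [← this]
  congr 1; funext x y
  have htri' : H.BalUUU fun a b c => bsum (H.tr b) fun p q => G a p (q * (c * y)) :=
    ⟨fun b c => htri.lin₁ _ _, fun a c => htri.lin₂ _ _, fun a b => isLinear_mul_right
      (htri.lin₃ a b) _, fun e a b c => htri.bal₁ e a b _, fun e a b c => by
      simpa [mul_assoc] using htri.bal₂ e a b (c * y)⟩
  rw [BalUUU.coassoc htri']
  congr 1; funext x₁ x₂
  have := BalOp.gal (hop x₁ y) x₂
  simp only [one_mul] at this
  rw [← this]
  simp only [mul_assoc]

/-- `u₊₊ ⊗ u₋ ⊗ u₊₋ = u₊ ⊗ u₋₁ ⊗ u₋₂`. -/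
theorem tr_tr (h₁ : ∀ y z, IsLinearMap k fun x => G x y z)
    (h₂ : ∀ x z, IsLinearMap k fun y => G x y z) (h₃ : ∀ x y, IsLinearMap k fun z => G x y z)
    (hb₁ : ∀ a x y z, G (x * tgt H.η a) y z = G x y (tgt H.η a * z))
    (hb₂ : ∀ a x y z, G x (tgt H.η a * y) z = G x y (src H.η a * z)) (u : U) :
    bsum (H.tr u) (fun x y => bsum (H.tr x) fun p q => G p y q) =
      bsum (H.tr u) fun x y => bsum (H.cop y) fun y₁ y₂ => G x y₁ y₂ := by
  have hop : ∀ b c, H.BalOp fun p q => G p b (q * c) := fun b c =>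
    BalOp.mul_right_snd (F := fun p q => G p b q)
      ⟨⟨fun z => h₁ b z, fun y => h₃ y b⟩, fun a y z => hb₁ a y b z⟩ c
  have hK : ∀ b c, H.BalOp fun p q => bsum (H.tr p) fun p' q' => G p' (q * b) (q' * c) := by
    intro b c
    refine ⟨⟨fun q => BalOp.isLinear (hop _ _), fun p => bsum_isLinear _ fun p' q' =>
      isLinear_mul_right (h₂ _ _) _⟩, fun e p q => ?_⟩
    simp only [LinearMap.mulLeft_apply, LinearMap.mulRight_apply]
    rw [BalOp.mul_tgt (hop _ _)]
    simp only [mul_assoc, hb₂]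
  have htri : H.BalUUU fun a b c => bsum (H.tr a) fun p q => bsum (H.tr p) fun p' q' =>
      G p' (q * b) (q' * c) := by
    refine ⟨fun b c => BalOp.isLinear (hK b c), fun a c => bsum_isLinear _ fun p q =>
      bsum_isLinear _ fun p' q' => isLinear_mul_left (h₂ _ _) _, fun a b => bsum_isLinear _
      fun p q => bsum_isLinear _ fun p' q' => isLinear_mul_left (h₃ _ _) _, fun e a b c => ?_,
      fun e a b c => ?_⟩
    · simp only [LinearMap.mulLeft_apply]
      rw [BalOp.tgt_mul (hK b c)]
      simp only [mul_assoc]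
    · simp only [LinearMap.mulLeft_apply]
      have := BalOp.takeuchi (hK b c) e a
      simp only [mul_assoc] at this
      rw [← this]
      congr 1; funext p q
      rw [BalOp.tgt_mul (hop _ _)]
      simp only [mul_assoc]
  have h2' : ∀ a, H.BalUU fun b c => bsum (H.tr a) fun p q => bsum (H.tr p) fun p' q' =>
      G p' (q * b) (q' * c) := fun a =>
    ⟨⟨fun c => htri.lin₂ a c, fun b => htri.lin₃ a b⟩, fun e b c => htri.bal₂ e a b c⟩
  have h2 : H.BalUU fun a b => bsum (H.cop b) fun b₁ b₂ => bsum (H.tr a) fun p q =>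
      bsum (H.tr p) fun p' q' => G p' (q * b₁) (q' * b₂) := by
    refine ⟨⟨fun b => bsum_isLinear _ fun b₁ b₂ => htri.lin₁ _ _, fun a => BalUU.isLinear (h2' a)⟩,
      fun e a b => ?_⟩
    simp only [LinearMap.mulLeft_apply]
    rw [BalUU.src_mul (h2' a)]
    congr 1; funext b₁ b₂
    exact htri.bal₁ e a b₁ b₂
  -- The same device for `a₊₊ ⊗ a₋b₁ ⊗ a₊₋b₂`: at `u ⊗ 1` it is the left-hand side. At `u₊₁ ⊗
  -- u₊₂u₋`, multiplicativity of `Δ` and coassociativity prepare two successive contractions by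
  -- `BalOp.gal`.
  have e1 := BalUU.gal h2 u
  rw [BalUU.one (h2' u)] at e1
  simp only [mul_one] at e1
  rw [← e1]
  congr 1; funext x y
  have htri' : H.BalUUU fun a b c => bsum (H.cop y) fun y₁ y₂ => bsum (H.tr a) fun p q =>
      bsum (H.tr p) fun p' q' => G p' (q * (b * y₁)) (q' * (c * y₂)) := by
    refine ⟨fun b c => bsum_isLinear _ fun _ _ => htri.lin₁ _ _, fun a c => bsum_isLinear _
      fun _ _ => isLinear_mul_right (htri.lin₂ _ _) _, fun a b => bsum_isLinear _
      fun _ _ => isLinear_mul_right (htri.lin₃ _ _) _, fun e a b c => ?_, fun e a b c => ?_⟩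
    · congr 1; funext y₁ y₂
      simpa [mul_assoc] using htri.bal₁ e a (b * y₁) (c * y₂)
    · congr 1; funext y₁ y₂
      simpa [mul_assoc] using htri.bal₂ e a (b * y₁) (c * y₂)
  have e2 : (bsum (H.cop x) fun x₁ x₂ => bsum (H.cop (x₂ * y)) fun b₁ b₂ =>
      bsum (H.tr x₁) fun p q => bsum (H.tr p) fun p' q' => G p' (q * b₁) (q' * b₂)) =
      bsum (H.cop x) fun x₁ x₂ => bsum (H.cop x₂) fun b₁ b₂ => bsum (H.cop y) fun y₁ y₂ =>
      bsum (H.tr x₁) fun p q => bsum (H.tr p) fun p' q' =>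
        G p' (q * (b₁ * y₁)) (q' * (b₂ * y₂)) := by
    congr 1; funext x₁ x₂
    rw [BalUU.mul (h2' x₁)]
  rw [e2, ← BalUUU.coassoc htri']
  have e3 : ∀ x₁ x₂, (bsum (H.cop x₁) fun b₁ b₂ => bsum (H.cop y) fun y₁ y₂ =>
      bsum (H.tr b₁) fun p q => bsum (H.tr p) fun p' q' =>
        G p' (q * (b₂ * y₁)) (q' * (x₂ * y₂))) = bsum (H.cop y) fun y₁ y₂ =>
      bsum (H.tr x₁) fun p q => G p y₁ (q * (x₂ * y₂)) := by
    intro x₁ x₂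
    rw [bsum_comm]
    congr 1; funext y₁ y₂
    have := BalOp.gal (hK y₁ (x₂ * y₂)) x₁
    simp only [one_mul] at this
    rw [← this]
    simp only [mul_assoc]
  simp only [e3]
  rw [bsum_comm]
  congr 1; funext y₁ y₂
  have := BalOp.gal (hop y₁ y₂) x
  simp only [one_mul] at this
  rw [← this]
  simp only [mul_assoc]

/-- `u₊ u₋ = s(ε(u))`. -/
theorem tr_mul (u : U) : bsum (H.tr u) (fun x y => x * y) = src H.η (H.ε u) := by
  have h : H.BalUU fun x y => src H.η (H.ε x) * y := by
    refine ⟨⟨fun y => ⟨fun a b => by simp [src_add, add_mul], fun c a => by simp [src_smul]⟩,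
      fun x => (LinearMap.mulLeft k _).isLinear⟩, fun a x y => ?_⟩
    simp [H.ε_tgt_mul, src_mul, mul_assoc]
  have := BalUU.gal h u
  simp only [mul_one] at this
  rw [← this]
  congr 1; funext x y
  have := congrArg (· * y) (H.cop_counit_left x)
  rw [← LinearMap.mulRight_apply (R := k), map_bsum] at this
  simpa [mul_assoc] using this.symm

/-- `u₊ t(ε(u₋ g)) = t(ε(g)) u`. -/
theorem tr_counit (u g : U) :
    bsum (H.tr u) (fun x y => x * tgt H.η (H.ε (y * g))) = tgt H.η (H.ε g) * u := by
  have h : H.BalUU fun x y => tgt H.η (H.ε (y * g)) * x := by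
    refine ⟨⟨fun y => (LinearMap.mulLeft k _).isLinear,
      fun x => ⟨fun a b => by simp [tgt_add, add_mul], fun c a => by simp [tgt_smul]⟩⟩,
      fun a x y => ?_⟩
    simp [H.ε_src_mul, HopfAlgd.tgt_mul, mul_assoc]
  have := BalUU.gal h u
  simp only [one_mul] at this
  rw [← this]
  congr 1; funext x y
  have h1 : H.BalUU fun a b => tgt H.η (H.ε b) * a := by
    refine ⟨⟨fun y => (LinearMap.mulLeft k _).isLinear,
      fun x => ⟨fun a b => by simp [tgt_add, add_mul], fun c a => by simp [tgt_smul]⟩⟩,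
      fun a x y => ?_⟩
    simp [H.ε_src_mul, HopfAlgd.tgt_mul, mul_assoc]
  -- The Takeuchi condition trades `x₁ t(ε(yg)) ⊗ x₂` for `x₁ ⊗ x₂ s(ε(yg))`, and `ε(x₂ s(ε(yg))) =
  -- ε(x₂yg)`.
  have e := BalUU.takeuchi h1 (H.ε (y * g)) x
  simp only [H.ε_mul_src] at e
  simp only [mul_assoc]
  rw [← e]
  have := congrArg (· * tgt H.η (H.ε (y * g))) (H.cop_counit_right x)
  rw [← LinearMap.mulRight_apply (R := k), map_bsum] at this
  simpa [mul_assoc] using this.symm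

end LeftHopfAlgebroid

end HopfAlgd

namespace HopfAlgd

/-! ### Homogeneous components and commutation of operators on words -/

section Homogeneous

variable {k A U : Type*} [CommRing k] [Ring A] [Algebra k A] [Ring U] [Algebra k U]
  {η : A ⊗[k] Aᵐᵒᵖ →ₐ[k] U} {M : Type*} [AddCommGroup M] [Module k M]
  {ρ : A →ₐ[k] Module.End k M} {Z : Type*} [AddCommGroup Z] [Module k Z]

variable (η ρ) in
/-- The component of degree `n`. -/
noncomputable def homog (n : ℕ) : Submodule k (Words η ρ) :=
  Submodule.span k {x | ∃ m l, l.length = n ∧ x = wmk η ρ m l}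

theorem wmk_mem_homog (m : M) {l : List U} {n : ℕ} (h : l.length = n) :
    wmk η ρ m l ∈ homog η ρ n := Submodule.subset_span ⟨m, l, h, rfl⟩

/-- Many relations hold only in degrees where the operators have room, so operators are compared on
one homogeneous component at a time. -/
theorem homog_ext {n : ℕ} {f g : Words η ρ →ₗ[k] Z}
    (h : ∀ m l, l.length = n → f (wmk η ρ m l) = g (wmk η ρ m l)) {x : Words η ρ}
    (hx : x ∈ homog η ρ n) : f x = g x := by
  have : homog η ρ n ≤ LinearMap.eqLocus f g := by
    rw [homog, Submodule.span_le]
    rintro _ ⟨m, l, hl, rfl⟩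
    exact h m l hl
  exact this hx

theorem map_mem_homog {n : ℕ} {f : Words η ρ →ₗ[k] Z} {P : Submodule k Z}
    (h : ∀ m l, l.length = n → f (wmk η ρ m l) ∈ P) {x : Words η ρ}
    (hx : x ∈ homog η ρ n) : f x ∈ P := by
  have : homog η ρ n ≤ P.comap f := by
    rw [homog, Submodule.span_le]
    rintro _ ⟨m, l, hl, rfl⟩
    exact h m l hl
  exact this hx

theorem gr_apply (F : ℕ → Module.End k (Words η ρ)) {n : ℕ} {x : Words η ρ}
    (hx : x ∈ homog η ρ n) : gr F x = F n x :=
  homog_ext (fun m l hl => by rw [gr_mk, hl]) hx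

theorem zsmul_mem_homog {n : ℕ} (c : ℤ) {x : Words η ρ} (hx : x ∈ homog η ρ n) :
    c • x ∈ homog η ρ n := zsmul_mem hx c

theorem act_mem {n : ℕ} {x : Words η ρ} (hx : x ∈ homog η ρ n) (a : A) :
    act η ρ a x ∈ homog η ρ n := by
  refine map_mem_homog (fun m l hl => ?_) hx
  rcases List.eq_nil_or_concat l with rfl | ⟨l, u, rfl⟩
  · rw [act_mk_nil]; exact wmk_mem_homog _ hl
  · rw [List.concat_eq_append, act_mk_concat]; exact wmk_mem_homog m (by simpa using hl)

section Slots

variable {f g : List U → U} (hf : IsSlotMap (k := k) η f) (hg : IsSlotMap (k := k) η g)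

theorem slot_mk (r q : ℕ) (m : M) {l₁ l₂ : List U} (l₃ : List U) (h₁ : l₁.length = r)
    (h₂ : l₂.length = q) :
    slot ρ r q hf (wmk η ρ m (l₁ ++ (l₂ ++ l₃))) = wmk η ρ m (l₁ ++ f l₂ :: l₃) := by
  subst h₁ h₂
  exact (wlift_mk _ _ _ _).trans (slotFun_eq _ _ _ _ _)

theorem slot_mk_of_lt (r q : ℕ) (m : M) {l : List U} (h : l.length < r + q) :
    slot ρ r q hf (wmk η ρ m l) = 0 := by
  rw [slot, wlift_mk, slotFun, if_neg (by omega)]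

theorem slot_mem {n r q : ℕ} (h : r + q ≤ n) {x : Words η ρ} (hx : x ∈ homog η ρ n) :
    slot ρ r q hf x ∈ homog η ρ (n + 1 - q) := by
  refine map_mem_homog (fun m l hl => ?_) hx
  obtain ⟨l₁, l₂, l₃, rfl, h₁, h₂⟩ := split_word (l := l) (r := r) (q := q) (by omega)
  rw [slot_mk hf r q m l₃ h₁ h₂]
  exact wmk_mem_homog m (by simp at hl ⊢; omega)

theorem slot_eq_zero {n r q : ℕ} (h : n < r + q) {x : Words η ρ} (hx : x ∈ homog η ρ n) :
    slot ρ r q hf x = 0 :=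
  homog_ext (g := 0) (fun m l hl => slot_mk_of_lt hf r q m (by omega)) hx

/-- The two blocks are disjoint. Once the left one has become a single letter, the right one starts
at `r' + 1` instead of `r' + q`. If the word is too short both sides are `0`, so no bound on the
degree is needed. The cases `0`, `2`, `p` of the block lengths give the commutations of
degeneracies, inner faces and `D_φ`. -/
theorem slot_slot {r r' : ℕ} (q q' : ℕ) (h : r ≤ r') (x : Words η ρ) :
    slot ρ r q hf (slot ρ (r' + q) q' hg x) = slot ρ (r' + 1) q' hg (slot ρ r q hf x) := by
  have : slot ρ r q hf * slot ρ (r' + q) q' hg = slot ρ (r' + 1) q' hg * slot ρ r q hf := by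
    refine wext fun m l => ?_
    simp only [Module.End.mul_apply]
    by_cases h₁ : r' + q + q' ≤ l.length
    · obtain ⟨l₁, l', rfl, hl₁⟩ := split_word₂ (l := l) (r := r) (by omega)
      obtain ⟨l₂, l', rfl, hl₂⟩ := split_word₂ (l := l') (r := q) (by simp at h₁; omega)
      obtain ⟨l₃, l', rfl, hl₃⟩ := split_word₂ (l := l') (r := r' - r) (by simp at h₁; omega)
      obtain ⟨l₄, l₅, rfl, hl₄⟩ := split_word₂ (l := l') (r := q') (by simp at h₁; omega)
      have e₁ := slot_mk (ρ := ρ) hg (r' + q) q' m (l₁ := l₁ ++ (l₂ ++ l₃)) (l₂ := l₄) l₅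
        (by simp; omega) hl₄
      have e₂ := slot_mk (ρ := ρ) hg (r' + 1) q' m (l₁ := l₁ ++ f l₂ :: l₃) (l₂ := l₄) l₅
        (by simp; omega) hl₄
      have e₃ := slot_mk (ρ := ρ) hf r q m (l₁ := l₁) (l₂ := l₂) (l₃ ++ g l₄ :: l₅) hl₁ hl₂
      have e₄ := slot_mk (ρ := ρ) hf r q m (l₁ := l₁) (l₂ := l₂) (l₃ ++ (l₄ ++ l₅)) hl₁ hl₂
      simp only [List.append_assoc, List.cons_append] at e₁ e₂ e₃ e₄ ⊢
      rw [e₁, e₃, e₄, e₂]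
    · rw [slot_mk_of_lt _ _ _ _ (by omega), map_zero]
      by_cases h₂ : r + q ≤ l.length
      · rw [slot_eq_zero hg _ (slot_mem hf h₂ (wmk_mem_homog m rfl))]
        omega
      · rw [slot_mk_of_lt _ _ _ _ (by omega), map_zero]
  exact LinearMap.congr_fun this x

theorem merge_degen_left {n r : ℕ} (h : r < n) {x : Words η ρ} (hx : x ∈ homog η ρ n) :
    slot ρ r 2 (prod_isSlotMap η) (slot ρ r 0 (prod_isSlotMap η) x) = x := by
  refine homog_ext (f := slot ρ r 2 (prod_isSlotMap η) * slot ρ r 0 (prod_isSlotMap η)) (g := 1)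
    (fun m l hl => ?_) hx
  obtain ⟨l₁, l₂, l₃, rfl, h₁, h₂⟩ := split_word (l := l) (r := r) (q := 1) (by omega)
  obtain ⟨u, rfl⟩ := List.length_eq_one_iff.1 h₂
  have e := slot_mk (ρ := ρ) (prod_isSlotMap η) r 0 m (l₂ := []) ([u] ++ l₃) h₁ rfl
  have e' := slot_mk (ρ := ρ) (prod_isSlotMap η) r 2 m (l₂ := [1, u]) l₃ h₁ rfl
  simp at e e' ⊢
  rw [e, e']

theorem merge_degen_right {n r : ℕ} (h : r < n) {x : Words η ρ} (hx : x ∈ homog η ρ n) :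
    slot ρ r 2 (prod_isSlotMap η) (slot ρ (r + 1) 0 (prod_isSlotMap η) x) = x := by
  refine homog_ext (f := slot ρ r 2 (prod_isSlotMap η) * slot ρ (r + 1) 0 (prod_isSlotMap η))
    (g := 1) (fun m l hl => ?_) hx
  obtain ⟨l₁, l₂, l₃, rfl, h₁, h₂⟩ := split_word (l := l) (r := r) (q := 1) (by omega)
  obtain ⟨u, rfl⟩ := List.length_eq_one_iff.1 h₂
  have e := slot_mk (ρ := ρ) (prod_isSlotMap η) (r + 1) 0 m (l₁ := l₁ ++ [u]) (l₂ := []) l₃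
    (by simp [h₁]) rfl
  have e' := slot_mk (ρ := ρ) (prod_isSlotMap η) r 2 m (l₂ := [u, 1]) l₃ h₁ rfl
  simp at e e' ⊢
  rw [e, e']

theorem act_slot {n r q : ℕ} (h : r + q ≤ n) (a : A) {x : Words η ρ} (hx : x ∈ homog η ρ n) :
    act η ρ a (slot ρ r q hf x) = slot ρ r q hf (act η ρ a x) := by
  refine homog_ext (f := act η ρ a * slot ρ r q hf) (g := slot ρ r q hf * act η ρ a)
    (fun m l hl => ?_) hx
  simp only [Module.End.mul_apply]
  obtain ⟨l₁, l₂, l₃, rfl, h₁, h₂⟩ := split_word (l := l) (r := r) (q := q) (by omega)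
  rw [slot_mk hf r q m l₃ h₁ h₂]
  -- The last letter may lie behind the block or inside it. If an empty block stands at the end, its
  -- value becomes the last letter, and `hf.nil` with balancing moves the action to the preceding
  -- letter or to the module entry.
  rcases List.eq_nil_or_concat l₃ with rfl | ⟨l₃, v, rfl⟩
  · rcases List.eq_nil_or_concat l₂ with rfl | ⟨l₂, v, rfl⟩
    · rw [act_mk_concat, ← hf.nil]
      rcases List.eq_nil_or_concat l₁ with rfl | ⟨l₁, v, rfl⟩
      · have e := slot_mk (ρ := ρ) hf r q (ρ a m) (l₁ := []) (l₂ := []) [] h₁ h₂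
        simp only [List.append_nil, List.nil_append] at e ⊢
        rw [act_mk_nil, e, (wmk_isWordMap η ρ).front]
      · have e := slot_mk (ρ := ρ) hf r q m (l₁ := l₁ ++ [v * tgt η a]) (l₂ := []) []
          (by simpa using h₁) h₂
        simp only [List.concat_eq_append, List.append_nil, List.append_assoc, List.cons_append,
          List.nil_append] at e ⊢
        rw [act_mk_concat, e, (wmk_isWordMap η ρ).inner]
    · have e := slot_mk (ρ := ρ) hf r q m (l₁ := l₁) (l₂ := l₂ ++ [v * tgt η a]) []
        h₁ (by simpa using h₂)
      have e' := act_mk_concat (η := η) (ρ := ρ) a m (l₁ ++ l₂) v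
      simp only [List.append_nil, List.append_assoc, List.concat_eq_append] at e e' ⊢
      rw [act_mk_concat, e', e, hf.back]
  · have e := slot_mk (ρ := ρ) hf r q m (l₁ := l₁) (l₂ := l₂) (l₃ ++ [v * tgt η a]) h₁ h₂
    have e₁ := act_mk_concat (η := η) (ρ := ρ) a m (l₁ ++ (l₂ ++ l₃)) v
    have e₂ := act_mk_concat (η := η) (ρ := ρ) a m (l₁ ++ f l₂ :: l₃) v
    simp only [List.append_assoc, List.cons_append, List.concat_eq_append] at e e₁ e₂ ⊢
    rw [e₁, e₂, e]

theorem app_one_eq_degen {n : ℕ} {x : Words η ρ} (hx : x ∈ homog η ρ n) :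
    app 1 x = slot ρ n 0 (prod_isSlotMap η) x := by
  refine homog_ext (fun m l hl => ?_) hx
  have e := slot_mk (ρ := ρ) (prod_isSlotMap η) n 0 m (l₂ := []) [] hl rfl
  simp at e
  rw [e, app_mk]

variable {p : ℕ} (φ : Cochain (k := k) η p)

theorem cap_mk (m : M) (l₁ : List U) {l₂ : List U} (h : l₂.length = p) :
    cap ρ φ (wmk η ρ m (l₁ ++ l₂)) = act η ρ (φ.toFun l₂) (wmk η ρ m l₁) :=
  (wlift_mk _ _ _ _).trans (capFun_eq _ _ _ _ h)

theorem cap_eq_zero {n : ℕ} (h : n < p) {x : Words η ρ} (hx : x ∈ homog η ρ n) :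
    cap ρ φ x = 0 := by
  refine homog_ext (g := 0) (fun m l hl => ?_) hx
  rw [cap, wlift_mk, capFun, if_neg (by omega)]
  rfl

theorem cap_mem {n : ℕ} (h : p ≤ n) {x : Words η ρ} (hx : x ∈ homog η ρ n) :
    cap ρ φ x ∈ homog η ρ (n - p) := by
  refine map_mem_homog (fun m l hl => ?_) hx
  obtain ⟨l₁, l₂, rfl, h₁⟩ := split_word₂ (l := l) (r := n - p) (by omega)
  rw [cap_mk φ m l₁ (by simp at hl; omega)]
  exact act_mem (wmk_mem_homog m h₁) _

theorem cap_slot {n r q : ℕ} (h : r + q + p ≤ n) {x : Words η ρ} (hx : x ∈ homog η ρ n) :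
    cap ρ φ (slot ρ r q hf x) = slot ρ r q hf (cap ρ φ x) := by
  refine homog_ext (f := cap ρ φ * slot ρ r q hf) (g := slot ρ r q hf * cap ρ φ)
    (fun m l hl => ?_) hx
  simp only [Module.End.mul_apply]
  obtain ⟨l', l₄, rfl, h₄⟩ := split_word₂ (l := l) (r := n - p) (by omega)
  obtain ⟨l₁, l₂, l₃, rfl, h₁, h₂⟩ := split_word (l := l') (r := r) (q := q) (by omega)
  have hl₄ : l₄.length = p := by simp at hl h₄; omega
  rw [cap_mk φ m _ hl₄, ← act_slot hf (n := n - p) (by omega) _ (wmk_mem_homog m h₄),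
    slot_mk hf r q m l₃ h₁ h₂, ← cap_mk φ m _ hl₄]
  have e := slot_mk (ρ := ρ) hf r q m (l₁ := l₁) (l₂ := l₂) (l₃ ++ l₄) h₁ h₂
  simp only [List.append_assoc, List.cons_append] at e ⊢
  rw [e]

end Slots

end Homogeneous

section CounitDegen

variable {k A U : Type*} [CommRing k] [Ring A] [Algebra k A] [Ring U] [Algebra k U]
  {H : LeftBialgebroid k A U} {M : Type*} [AddCommGroup M] [Module k M]

theorem cap_counit_degen {ρ : A →ₐ[k] Module.End k M} {n : ℕ} {x : Words H.η ρ}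
    (hx : x ∈ homog H.η ρ n) :
    cap ρ H.counitCochain (slot ρ n 0 (prod_isSlotMap H.η) x) = x := by
  rw [← app_one_eq_degen hx]
  refine homog_ext (f := cap ρ H.counitCochain * app 1) (g := 1) (fun m l hl => ?_) hx
  rw [Module.End.mul_apply, app_mk, cap_mk H.counitCochain m l (by rfl)]
  change act _ _ (H.ε 1) _ = _
  rw [H.ε_one]
  rcases List.eq_nil_or_concat l with rfl | ⟨l, v, rfl⟩
  · simp
  · rw [List.concat_eq_append, act_mk_concat]
    simp

end CounitDegen

/-! ### The face multiplying the first letter into the module -/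

section LastFace

variable {k A U : Type*} [CommRing k] [Ring A] [Algebra k A] [Ring U] [Algebra k U]
  {H : LeftBialgebroid k A U} {M : Type*} [AddCommGroup M] [Module k M]
  [Module Uᵐᵒᵖ M] [IsScalarTower k Uᵐᵒᵖ M]

theorem lastFace_mk_cons (m : M) (u : U) (l : List U) :
    lastFace H M (wmk H.η (modAct H.η M) m (u :: l)) = wmk H.η (modAct H.η M) (m <• u) l :=
  wlift_mk _ _ _ _

theorem lastFace_mem {n : ℕ} {x : Chains H M} (hx : x ∈ homog H.η (modAct H.η M) (n + 1)) :
    lastFace H M x ∈ homog H.η (modAct H.η M) n := by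
  refine map_mem_homog (fun m l hl => ?_) hx
  obtain ⟨u, l, rfl⟩ := List.exists_cons_of_length_eq_add_one hl
  rw [lastFace_mk_cons]
  exact wmk_mem_homog _ (by simpa using hl)

theorem lastFace_slot {f : List U → U} (hf : IsSlotMap (k := k) H.η f) {n r q : ℕ}
    (h : r + 1 + q ≤ n) {x : Chains H M} (hx : x ∈ homog H.η (modAct H.η M) n) :
    lastFace H M (slot (modAct H.η M) (r + 1) q hf x) =
      slot (modAct H.η M) r q hf (lastFace H M x) := by
  refine homog_ext (f := lastFace H M * slot (modAct H.η M) (r + 1) q hf)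
    (g := slot (modAct H.η M) r q hf * lastFace H M) (fun m l hl => ?_) hx
  simp only [Module.End.mul_apply]
  obtain ⟨l₁, l₂, l₃, rfl, h₁, h₂⟩ := split_word (l := l) (r := r + 1) (q := q) (by omega)
  obtain ⟨u, l₁, rfl⟩ := List.exists_cons_of_length_eq_add_one h₁
  rw [slot_mk hf _ q m l₃ h₁ h₂, List.cons_append, List.cons_append, lastFace_mk_cons,
    lastFace_mk_cons, slot_mk hf r q _ l₃ (by simpa using h₁) h₂]

theorem lastFace_merge {n : ℕ} (h : 2 ≤ n) {x : Chains H M}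
    (hx : x ∈ homog H.η (modAct H.η M) n) :
    lastFace H M (slot (modAct H.η M) 0 2 (prod_isSlotMap H.η) x) =
      lastFace H M (lastFace H M x) := by
  refine homog_ext (f := lastFace H M * slot (modAct H.η M) 0 2 (prod_isSlotMap H.η))
    (g := lastFace H M * lastFace H M) (fun m l hl => ?_) hx
  simp only [Module.End.mul_apply]
  obtain ⟨l₁, l₂, l₃, rfl, h₁, h₂⟩ := split_word (l := l) (r := 0) (q := 2) (by omega)
  rw [List.length_eq_zero_iff] at h₁
  subst h₁
  obtain ⟨u, v, rfl⟩ := List.length_eq_two.1 h₂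
  rw [slot_mk _ 0 2 m l₃ rfl h₂]
  simp [lastFace_mk_cons, mul_smul]

theorem lastFace_degen (x : Chains H M) :
    lastFace H M (slot (modAct H.η M) 0 0 (prod_isSlotMap H.η) x) = x := by
  have : lastFace H M * slot (modAct H.η M) 0 0 (prod_isSlotMap H.η) = 1 := by
    refine wext fun m l => ?_
    have e := slot_mk (ρ := modAct H.η M) (prod_isSlotMap H.η) 0 0 m (l₁ := []) (l₂ := []) l rfl rfl
    simp only [List.nil_append, List.prod_nil] at e
    rw [Module.End.mul_apply, e, lastFace_mk_cons]
    simp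
  exact LinearMap.congr_fun this x

theorem lastFace_act {n : ℕ} (a : A) {x : Chains H M}
    (hx : x ∈ homog H.η (modAct H.η M) (n + 1)) :
    lastFace H M (act H.η (modAct H.η M) a x) = act H.η (modAct H.η M) a (lastFace H M x) := by
  refine homog_ext (f := lastFace H M * act H.η (modAct H.η M) a)
    (g := act H.η (modAct H.η M) a * lastFace H M) (fun m l hl => ?_) hx
  simp only [Module.End.mul_apply]
  obtain ⟨u, l, rfl⟩ := List.exists_cons_of_length_eq_add_one hl
  rcases List.eq_nil_or_concat l with rfl | ⟨l, v, rfl⟩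
  · have e := act_mk_concat (η := H.η) (ρ := modAct H.η M) a m [] u
    simp only [List.nil_append] at e
    rw [e, lastFace_mk_cons, lastFace_mk_cons, act_mk_nil, modAct_apply, act_rightModule_mul]
  · have e := act_mk_concat (η := H.η) (ρ := modAct H.η M) a m (u :: l) v
    simp only [List.cons_append] at e
    rw [List.concat_eq_append, e, lastFace_mk_cons, lastFace_mk_cons, act_mk_concat]

theorem lastFace_cap {p n : ℕ} (φ : Cochain (k := k) H.η p) (h : p + 1 ≤ n) {x : Chains H M}
    (hx : x ∈ homog H.η (modAct H.η M) n) :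
    lastFace H M (cap (modAct H.η M) φ x) = cap (modAct H.η M) φ (lastFace H M x) := by
  refine homog_ext (f := lastFace H M * cap (modAct H.η M) φ)
    (g := cap (modAct H.η M) φ * lastFace H M) (fun m l hl => ?_) hx
  simp only [Module.End.mul_apply]
  obtain ⟨l₁, l₂, rfl, h₁⟩ := split_word₂ (l := l) (r := n - p) (by omega)
  have h₂ : l₂.length = p := by simp at hl; omega
  rw [cap_mk φ m l₁ h₂, lastFace_act (n := n - p - 1) _ (wmk_mem_homog m (by omega))]
  obtain ⟨u, l₁, rfl⟩ := List.exists_cons_of_length_pos (l := l₁) (by omega)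
  rw [List.cons_append, lastFace_mk_cons, lastFace_mk_cons, cap_mk φ _ l₁ h₂]

end LastFace

end HopfAlgd

namespace HopfAlgd

/-! ### Expansions of words under the translation map -/

section Expand

open LeftHopfAlgebroid LeftBialgebroid

variable {k A U : Type*} [CommRing k] [Ring A] [Algebra k A] [Ring U] [Algebra k U]
  (H : LeftHopfAlgebroid k A U)

/-- A list of pairs that represents `(u¹₊, …, uⁿ₊) ⊗ uⁿ₋ ⋯ u¹₋`. -/
noncomputable def expand : List U → List (List U × U)
  | [] => [([], 1)]
  | u :: l => (H.tr u).flatMap fun q => (expand l).map fun e => (q.1 :: e.1, e.2 * q.2)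

theorem bsum_expand_nil {Z : Type*} [AddCommGroup Z] (F : List U → U → Z) :
    bsum (expand H []) F = F [] 1 := by simp [expand]

theorem bsum_expand_cons {Z : Type*} [AddCommGroup Z] (u : U) (l : List U)
    (F : List U → U → Z) : bsum (expand H (u :: l)) F =
      bsum (H.tr u) fun x y => bsum (expand H l) fun xs h => F (x :: xs) (h * y) := by
  rw [expand, bsum_flatMap]
  simp only [bsum_map]

theorem bsum_expand_append {Z : Type*} [AddCommGroup Z] (l l' : List U)
    (F : List U → U → Z) : bsum (expand H (l ++ l')) F =
      bsum (expand H l) fun xs h => bsum (expand H l') fun xs' h' => F (xs ++ xs') (h' * h) := by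
  induction l generalizing F with
  | nil => simp [bsum_expand_nil]
  | cons u l ih =>
    rw [List.cons_append, bsum_expand_cons, bsum_expand_cons]
    simp only [ih, mul_assoc, List.cons_append]

theorem length_of_mem_expand {l : List U} {q : List U × U} (hq : q ∈ expand H l) :
    q.1.length = l.length := by
  induction l generalizing q with
  | nil => simp [expand] at hq; simp [hq]
  | cons u l ih =>
    simp only [expand, List.mem_flatMap, List.mem_map] at hq
    obtain ⟨x, -, e, he, rfl⟩ := hq
    simp [ih he]

variable {M : Type*} [AddCommGroup M] [Module k M] (ρ : A →ₐ[k] Module.End k M)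

/-- The composite of the operators `step` over the letters of a word. -/
noncomputable def steps (l : List U) : Module.End k (State H ρ) :=
  l.foldl (fun g u => step H ρ u * g) 1

theorem foldl_step (l : List U) (g : Module.End k (State H ρ)) (z : State H ρ) :
    l.foldl (fun z u => step H ρ u z) (g z) = (l.foldl (fun g u => step H ρ u * g) g) z := by
  induction l generalizing g with
  | nil => rfl
  | cons u l ih => exact ih (step H ρ u * g)

theorem steps_apply (l : List U) (z : State H ρ) :
    steps H ρ l z = l.foldl (fun z u => step H ρ u z) z := (foldl_step H ρ l 1 z).symm

theorem steps_cons (u : U) (l : List U) (z : State H ρ) :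
    steps H ρ (u :: l) z = steps H ρ l (step H ρ u z) := by
  simp [steps_apply]

theorem steps_append (l l' : List U) (z : State H ρ) :
    steps H ρ (l ++ l') z = steps H ρ l' (steps H ρ l z) := by
  simp [steps_apply]

theorem stMk_bal : IsBal (k := k) (act H.η ρ) (fun a : A => LinearMap.mulLeft k (tgt H.η a))
    fun x h => stMk H ρ (x ⊗ₜ h) := balMk_isBal _ _

theorem state_ext {Z : Type*} [AddCommGroup Z] [Module k Z] {f g : State H ρ →ₗ[k] Z}
    (h : ∀ x u, f (stMk H ρ (x ⊗ₜ u)) = g (stMk H ρ (x ⊗ₜ u))) : f = g := bal_ext h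

variable {H ρ} in
theorem stMk_left {W : Type*} [AddCommGroup W] [Module k W] {f : W → Words H.η ρ}
    (hf : IsLinearMap k f) (u : U) : IsLinearMap k fun w => stMk H ρ (f w ⊗ₜ u) :=
  (((stMk_bal H ρ).left u).mk' ∘ₗ hf.mk').isLinear

variable {H ρ} in
theorem stMk_right {W : Type*} [AddCommGroup W] [Module k W] {f : W → U}
    (hf : IsLinearMap k f) (x : Words H.η ρ) : IsLinearMap k fun w => stMk H ρ (x ⊗ₜ f w) :=
  (((stMk_bal H ρ).right x).mk' ∘ₗ hf.mk').isLinear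

theorem app_isLinear (x : Words H.η ρ) : IsLinearMap k fun v : U => app v x :=
  ((LinearMap.applyₗ x) ∘ₗ appHom H ρ).isLinear

variable {H ρ} in
/-- Functions on `{}_▸U ⊗ U_◁` obtained by appending a letter to a word. -/
theorem app_bal (x : Words H.η ρ) (g : U) :
    H.BalOp fun v w => stMk H ρ (app v x ⊗ₜ (w * g)) where
  left w := stMk_left (app_isLinear H ρ x) _
  right v := stMk_right (LinearMap.mulRight k g).isLinear _
  bal a v w := by
    have := (stMk_bal H ρ).bal a (app v x) (w * g)
    rw [← Module.End.mul_apply, act_app] at this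
    simpa [mul_assoc] using this

theorem step_stMk (v : U) (x : Words H.η ρ) (g : U) : step H ρ v (stMk H ρ (x ⊗ₜ g)) =
    bsum (H.tr v) fun p q => stMk H ρ (app p x ⊗ₜ (q * g)) := by
  rw [step_mk, ← H.mk_tr, tens, map_bsum, map_bsum]
  exact map_bsum (LinearMap.applyₗ (R := k) (M₂ := State H ρ) (x ⊗ₜ[k] g)) _ _

theorem steps_stMk (l : List U) (m : M) (l₁ : List U) (g : U) :
    steps H ρ l (stMk H ρ (wmk H.η ρ m l₁ ⊗ₜ g)) =
      bsum (expand H l) fun xs h => stMk H ρ (wmk H.η ρ m (l₁ ++ xs) ⊗ₜ (h * g)) := by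
  induction l generalizing l₁ g with
  | nil => simp [bsum_expand_nil, steps]
  | cons u l ih =>
    rw [steps_cons, step_stMk, map_bsum, bsum_expand_cons]
    simp only [app_mk, ih, mul_assoc, List.append_assoc, List.cons_append, List.nil_append]

/-- Slot functions that are compatible with the translation map. -/
def TransCompat (q : ℕ) (f : List U → U) : Prop :=
  ∀ l : List U, l.length = q →
    H.trans (f l) = bsum (expand H l) fun xs h => H.mkUopU (f xs ⊗ₜ h)

variable {H} in
theorem TransCompat.tr_eq {q : ℕ} {f : List U → U} (hc : TransCompat H q f) {l : List U}
    (hl : l.length = q) {Z : Type*} [AddCommGroup Z] [Module k Z] {F : U → U → Z}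
    (h : H.BalOp F) : bsum (H.tr (f l)) F = bsum (expand H l) fun xs h => F (f xs) h := by
  rw [← BalOp.lift_trans h, hc l hl, map_bsum]
  rfl

theorem step_of_transCompat {q : ℕ} {f : List U → U} (hc : TransCompat H q f) {l : List U}
    (hl : l.length = q) (m : M) (l₁ : List U) (g : U) :
    step H ρ (f l) (stMk H ρ (wmk H.η ρ m l₁ ⊗ₜ g)) =
      bsum (expand H l) fun xs h => stMk H ρ (wmk H.η ρ m (l₁ ++ [f xs]) ⊗ₜ (h * g)) := by
  rw [step_stMk, TransCompat.tr_eq hc hl (app_bal _ _)]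
  simp only [app_mk]

/-- Iterated multiplicativity of the translation map; the second legs come out in reversed order, as
`expand` records them. It applies to inner faces and, through the empty product, to degeneracies. -/
theorem prod_transCompat (q : ℕ) : TransCompat H q (List.prod : List U → U) := by
  intro l _
  induction l generalizing q with
  | nil =>
    rw [bsum_expand_nil, List.prod_nil, ← H.mk_tr, balMk_tens, BalOp.one (balMk_isBal _ _)]
  | cons u l ih =>
    rw [bsum_expand_cons, List.prod_cons, ← H.mk_tr, balMk_tens, BalOp.mul (balMk_isBal _ _)]
    congr 1; funext x y
    have h := BalOp.mul_right_snd (BalOp.mul_left_fst (balMk_isBal (fun a : A =>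
      LinearMap.mulRight k (tgt H.η a)) (fun a => LinearMap.mulLeft k (tgt H.η a))) x) y
    rw [← BalOp.lift_trans h, ih _ rfl, map_bsum]
    simp only [List.prod_cons]
    rfl

/-! The compatibility of `D_φ` with the translation map. -/

/-- The words with first entry `w` in `U`, with one further letter `h`, balanced by
`(w t(a), …) ⊗ h = (w, …) ⊗ t(a) h`. -/
abbrev WU : Type _ := BalTensor (fun a : A => H.rmulWord (tgt H.η a))
  (fun a : A => LinearMap.mulLeft k (tgt H.η a))

/-- The canonical projection. -/
noncomputable abbrev mkWU : Words H.η H.srcAct ⊗[k] U →ₗ[k] WU H :=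
  balMk (fun a : A => H.rmulWord (tgt H.η a)) (fun a : A => LinearMap.mulLeft k (tgt H.η a))

theorem mkWU_bal : IsBal (k := k) (fun a : A => H.rmulWord (tgt H.η a))
    (fun a : A => LinearMap.mulLeft k (tgt H.η a)) fun x h => mkWU H (x ⊗ₜ h) := balMk_isBal _ _

variable {H} in
theorem mkWU_left {W : Type*} [AddCommGroup W] [Module k W] {f : W → Words H.η H.srcAct}
    (hf : IsLinearMap k f) (u : U) : IsLinearMap k fun w => mkWU H (f w ⊗ₜ u) :=
  (((mkWU_bal H).left u).mk' ∘ₗ hf.mk').isLinear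

variable {H} in
theorem mkWU_right {W : Type*} [AddCommGroup W] [Module k W] {f : W → U}
    (hf : IsLinearMap k f) (x : Words H.η H.srcAct) :
    IsLinearMap k fun w => mkWU H (x ⊗ₜ f w) :=
  (((mkWU_bal H).right x).mk' ∘ₗ hf.mk').isLinear

variable {H} in
theorem mkWU_balOp (b : U) (l : List U) (c : U) :
    H.BalOp fun x y => mkWU H (wmk H.η H.srcAct (b * x) l ⊗ₜ (y * c)) where
  left y := mkWU_left (((wmk_isWordMap H.η H.srcAct).lin_left l).mk' ∘ₗ
    LinearMap.mulLeft k b).isLinear _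
  right x := mkWU_right (LinearMap.mulRight k c).isLinear _
  bal a x y := by
    simpa [mul_assoc] using (mkWU_bal H).bal a (wmk H.η H.srcAct (b * x) l) (y * c)

/-- The map `(w, u¹, …, uⁿ) ↦ (w₊, u¹, …, uⁿ) ⊗ w₋`. -/
noncomputable def transWord : Words H.η H.srcAct →ₗ[k] WU H :=
  wlift (fun w l => bsum (H.tr w) fun x y => mkWU H (wmk H.η H.srcAct x l ⊗ₜ y)) (by
    have h : ∀ l, H.BalOp fun x y => mkWU H (wmk H.η H.srcAct x l ⊗ₜ y) := fun l => by
      simpa using mkWU_balOp 1 l 1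
    refine ⟨fun l => BalOp.isLinear (h l), fun w l₁ l₂ => bsum_isLinear _ fun x y =>
      mkWU_left ((wmk_isWordMap H.η H.srcAct).lin_letter x l₁ l₂) y,
      fun a w u l => ?_, fun a w l₁ u v l₂ => ?_⟩
    · have e : H.srcAct a w = src H.η a * w := rfl
      rw [e, BalOp.src_mul (h _)]
      congr 1; funext x y
      rw [← (wmk_isWordMap H.η H.srcAct).front]
      rfl
    · simp only [(wmk_isWordMap H.η H.srcAct).inner])

theorem transWord_mk (w : U) (l : List U) : transWord H (wmk H.η H.srcAct w l) =
    bsum (H.tr w) fun x y => mkWU H (wmk H.η H.srcAct x l ⊗ₜ y) := wlift_mk _ _ _ _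

/-- The operator `z ⊗ h ↦ prep x z ⊗ h y`. -/
noncomputable def prepWU (x y : U) : Module.End k (WU H) :=
  balLift (mkWU H ∘ₗ TensorProduct.map (H.prep x) (LinearMap.mulRight k y)) (by
    intro a z h
    have := (mkWU_bal H).bal a (H.prep x z) (h * y)
    have e := LinearMap.congr_fun (H.prep_rmulWord (tgt H.η a) x) z
    rw [Module.End.mul_apply, Module.End.mul_apply] at e
    simp only [LinearMap.comp_apply, TensorProduct.map_tmul, e, LinearMap.mulRight_apply,
      LinearMap.mulLeft_apply, mul_assoc] at this ⊢
    exact this)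

theorem prepWU_mk (x y : U) (z : Words H.η H.srcAct) (h : U) :
    prepWU H x y (mkWU H (z ⊗ₜ h)) = mkWU H (H.prep x z ⊗ₜ (h * y)) := rfl

theorem prep_wmk (u w : U) (l : List U) : H.prep u (wmk H.η H.srcAct w l) =
    bsum (H.cop u) fun x y => wmk H.η H.srcAct (y * w) (x :: l) := by
  rw [prep_mk, ← H.mk_cop, tens, map_bsum, map_bsum]
  rfl

/-- On `(w, l)` the left side is `(u₊₂w₊, u₊₁, l) ⊗ w₋u₋` and the right side is `(u₂₊w₊, u₁, l) ⊗
w₋u₂₋`; `cop_tr` identifies them. -/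
theorem prepWU_transWord (u : U) (z : Words H.η H.srcAct) :
    bsum (H.tr u) (fun x y => prepWU H x y (transWord H z)) = transWord H (H.prep u z) := by
  have lin : IsLinearMap k fun z => bsum (H.tr u) fun x y => prepWU H x y (transWord H z) :=
    bsum_isLinear _ fun x y => (prepWU H x y ∘ₗ transWord H).isLinear
  suffices h : lin.mk' = transWord H ∘ₗ H.prep u from LinearMap.congr_fun h z
  refine wext fun w l => ?_
  simp only [IsLinearMap.mk'_apply, LinearMap.comp_apply, transWord_mk, map_bsum, prepWU_mk,
    prep_wmk]
  have key := cop_tr (H := H) (G := fun a b c => bsum (H.tr w) fun p q =>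
      mkWU H (wmk H.η H.srcAct (b * p) (a :: l) ⊗ₜ (q * c)))
    (fun b c => bsum_isLinear _ fun p q => mkWU_left
      ((wmk_isWordMap H.η H.srcAct).lin_letter (b * p) [] l) _)
    (fun a c => bsum_isLinear _ fun p q => mkWU_left
      (((wmk_isWordMap H.η H.srcAct).lin_left (a :: l)).mk' ∘ₗ
        LinearMap.mulRight k p).isLinear _)
    (fun a b => bsum_isLinear _ fun p q => mkWU_right (LinearMap.mulLeft k q).isLinear _)
    (fun e a b c => by
      congr 1; funext p q
      rw [← (wmk_isWordMap H.η H.srcAct).front]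
      simp [srcHom_apply, mul_assoc])
    (fun e a b c => by
      simpa [mul_assoc] using BalOp.takeuchi (mkWU_balOp (H := H) b (a :: l) c) e w) u
  have e1 : ∀ x y : U, (bsum (H.tr w) fun p q => bsum (H.cop x) fun x₁ x₂ =>
      mkWU H (wmk H.η H.srcAct (x₂ * p) (x₁ :: l) ⊗ₜ[k] (q * y))) =
      bsum (H.cop x) fun x₁ x₂ => bsum (H.tr w) fun p q =>
        mkWU H (wmk H.η H.srcAct (x₂ * p) (x₁ :: l) ⊗ₜ[k] (q * y)) := fun x y => bsum_comm _ _ _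
  have e3 : ∀ (x p q : U), mkWU H ((bsum (H.cop x) fun x₁ x₂ =>
      wmk H.η H.srcAct (x₂ * p) (x₁ :: l)) ⊗ₜ[k] q) = bsum (H.cop x) fun x₁ x₂ =>
      mkWU H (wmk H.η H.srcAct (x₂ * p) (x₁ :: l) ⊗ₜ[k] q) := fun x p q =>
    map_bsum ((mkWU_bal H).left q).mk' _ _
  simp only [e3, e1]
  rw [key]
  congr 1; funext x y
  have := BalOp.mul (mkWU_balOp (H := H) 1 (x :: l) 1) y w
  simp only [mul_one, one_mul] at this
  exact this.symm

theorem expand_coactWord (l : List U) :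
    bsum (expand H l) (fun xs h => mkWU H (H.coactWord xs ⊗ₜ h)) =
      transWord H (H.coactWord l) := by
  induction l with
  | nil =>
    have := BalOp.one (mkWU_balOp (H := H) 1 [] 1)
    simp only [mul_one, one_mul] at this
    rw [bsum_expand_nil, coactWord, List.foldr_nil, transWord_mk, this]
  | cons u l ih =>
    have e : ∀ xs x, H.coactWord (x :: xs) = H.prep x (H.coactWord xs) := fun _ _ => rfl
    rw [bsum_expand_cons, e, ← prepWU_transWord, ← ih]
    simp only [map_bsum, prepWU_mk, e]

variable {p : ℕ} (φ : Cochain (k := k) H.η p)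

/-- The map `z ⊗ h ↦ contract z ⊗ h`. -/
noncomputable def contractWU : WU H →ₗ[k] H.UopU :=
  balLift (H.mkUopU ∘ₗ (H.contract φ).rTensor U) (by
    intro a z h
    simpa [contract_rmulWord] using
      (balMk_isBal (fun a : A => LinearMap.mulRight k (tgt H.η a))
        (fun a => LinearMap.mulLeft k (tgt H.η a))).bal a (H.contract φ z) h)

theorem contractWU_mk (z : Words H.η H.srcAct) (h : U) :
    contractWU H φ (mkWU H (z ⊗ₜ h)) = H.mkUopU (H.contract φ z ⊗ₜ h) := rfl

theorem contractWU_transWord (z : Words H.η H.srcAct) :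
    contractWU H φ (transWord H z) = H.trans (H.contract φ z) := by
  suffices h : contractWU H φ ∘ₗ transWord H = H.trans ∘ₗ H.contract φ from
    LinearMap.congr_fun h z
  refine wext fun w l => ?_
  simp only [LinearMap.comp_apply, transWord_mk, map_bsum, contractWU_mk, contract_mk]
  rw [← H.mk_tr, balMk_tens, BalOp.src_mul (balMk_isBal _ _)]

/-- The coaction on words is compatible with translation (`expand_coactWord`), and the contraction
by `φ` only multiplies by some `s(a)` on the left, which translation carries to the first leg. This
is what lets `t` move past `D_φ`. -/
theorem DD_transCompat (q : ℕ) : TransCompat H q (H.DD φ) := by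
  intro l _
  simp only [DD]
  rw [← contractWU_transWord, ← expand_coactWord, map_bsum]
  simp only [contractWU_mk]

end Expand

/-! ### The extra degeneracy -/

section Extra

open LeftHopfAlgebroid LeftBialgebroid

variable {k A U : Type*} [CommRing k] [Ring A] [Algebra k A] [Ring U] [Algebra k U]
  {M : Type*} [AddCommGroup M] [Module k M] [Module Uᵐᵒᵖ M] [IsScalarTower k Uᵐᵒᵖ M]
  {H : LeftHopfAlgebroid k A U} (C : ModuleComodule H.toLeftBialgebroid M)

/-- The operator `(m, u¹, …, uⁿ) ↦ (m₀, u¹₊, …, uⁿ₊, uⁿ₋ ⋯ u¹₋ m₋₁)`. -/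
noncomputable def coextra : Module.End k (Chains H.toLeftBialgebroid M) :=
  join H (modAct H.η M) ∘ₗ spread C

theorem cyc_apply (x : Chains H.toLeftBialgebroid M) :
    cyc C x = lastFace H.toLeftBialgebroid M (coextra C x) := rfl

theorem join_stMk (x : Chains H.toLeftBialgebroid M) (h : U) :
    join H (modAct H.η M) (stMk H (modAct H.η M) (x ⊗ₜ h)) = app h x := rfl

theorem spread_mk (m : M) (l : List U) : spread C (wmk H.η (modAct H.η M) m l) =
    steps H (modAct H.η M) l (startState C m) := by
  rw [steps_apply]
  exact wlift_mk _ _ _ _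

theorem exists_coa (m : M) : ∃ L, tensMk H.η (fun a => modAct H.η M a) (tens k L) =
    C.coact m := by
  obtain ⟨X, hX⟩ := balMk_surjective _ _ (C.coact m)
  obtain ⟨L, rfl⟩ := exists_tens X
  exact ⟨L, hX⟩

/-- A list of pairs that represents `m₋₁ ⊗ m₀`. -/
noncomputable def coa (m : M) : List (U × M) := (exists_coa C m).choose

theorem mk_coa (m : M) : tensMk H.η (fun a => modAct H.η M a) (tens k (coa C m)) =
    C.coact m := (exists_coa C m).choose_spec

theorem startState_eq (m : M) : startState C m = bsum (coa C m) fun h m₀ =>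
    stMk H (modAct H.η M) (wmk H.η (modAct H.η M) m₀ [] ⊗ₜ h) := by
  rw [startState, LinearMap.comp_apply, ← mk_coa, tens, map_bsum, map_bsum]
  rfl

theorem coextra_mk (m : M) (l : List U) : coextra C (wmk H.η (modAct H.η M) m l) =
    bsum (coa C m) fun h₀ m₀ => bsum (expand H l) fun xs h =>
      wmk H.η (modAct H.η M) m₀ (xs ++ [h * h₀]) := by
  rw [coextra, LinearMap.comp_apply, spread_mk, startState_eq]
  simp only [map_bsum, steps_stMk, join_stMk, app_mk, List.nil_append]

theorem coextra_mem {n : ℕ} {x : Chains H.toLeftBialgebroid M}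
    (hx : x ∈ homog H.η (modAct H.η M) n) :
    coextra C x ∈ homog H.η (modAct H.η M) (n + 1) := by
  refine map_mem_homog (fun m l hl => ?_) hx
  rw [coextra_mk]
  refine list_sum_mem fun z hz => ?_
  obtain ⟨q, hq, rfl⟩ := List.mem_map.1 hz
  refine list_sum_mem fun z hz => ?_
  obtain ⟨q', hq', rfl⟩ := List.mem_map.1 hz
  exact wmk_mem_homog _ (by simp [length_of_mem_expand H hq', hl])

/-- `TransCompat` says that stepping over the letter `f(l₂)` equals stepping over the letters of
`l₂` and applying `f` to the first legs, so the accumulated last letter is the same on both sides.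
-/
theorem coextra_slot {f : List U → U} (hf : IsSlotMap (k := k) H.η f) {n r q : ℕ}
    (hc : TransCompat H q f) (h : r + q ≤ n) {x : Chains H.toLeftBialgebroid M}
    (hx : x ∈ homog H.η (modAct H.η M) n) :
    coextra C (slot (modAct H.η M) r q hf x) = slot (modAct H.η M) r q hf (coextra C x) := by
  refine homog_ext (f := coextra C * slot (modAct H.η M) r q hf)
    (g := slot (modAct H.η M) r q hf * coextra C) (fun m l hl => ?_) hx
  simp only [Module.End.mul_apply]
  obtain ⟨l₁, l₂, l₃, rfl, h₁, h₂⟩ := split_word (l := l) (r := r) (q := q) (by omega)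
  rw [slot_mk hf r q m l₃ h₁ h₂, coextra_mk C m (l₁ ++ (l₂ ++ l₃)), coextra, LinearMap.comp_apply, spread_mk,
    startState_eq]
  simp only [map_bsum]
  congr 1; funext h₀ m₀
  rw [steps_append, steps_cons, steps_stMk, bsum_expand_append]
  simp only [map_bsum]
  refine bsum_mem_congr _ fun q₁ hq₁ => ?_
  rw [bsum_expand_append, step_of_transCompat H _ hc h₂]
  simp only [map_bsum]
  refine bsum_mem_congr _ fun q₂ hq₂ => ?_
  simp only [steps_stMk, map_bsum, join_stMk, app_mk]
  refine bsum_mem_congr _ fun q₃ hq₃ => ?_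
  have e := slot_mk (ρ := modAct H.η M) hf r q m₀ (l₁ := q₁.1) (l₂ := q₂.1)
    (q₃.1 ++ [q₃.2 * (q₂.2 * (q₁.2 * h₀))])
    (by rw [length_of_mem_expand H hq₁, h₁]) (by rw [length_of_mem_expand H hq₂, h₂])
  simp only [List.append_assoc, List.nil_append, List.cons_append, mul_assoc] at e ⊢
  rw [e]

theorem cap_counit_app (h : U) (x : Chains H.toLeftBialgebroid M) :
    cap (modAct H.η M) H.counitCochain (app h x) = act H.η (modAct H.η M) (H.ε h) x := by
  have : cap (modAct H.η M) H.counitCochain * app h = act H.η (modAct H.η M) (H.ε h) := by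
    refine wext fun m l => ?_
    rw [Module.End.mul_apply, app_mk, cap_mk H.counitCochain m l (by rfl)]
    rfl
  exact LinearMap.congr_fun this x

/-- By `tr_counit` the letters `v₊ t(ε(v₋g))` add up to `t(ε(g)) v`. Thus letters can be stripped
off from the right in `cap_counit_coextra`. -/
theorem cap_counit_join_step (v : U) (z : State H (modAct H.η M)) :
    cap (modAct H.η M) H.counitCochain (join H _ (step H _ v z)) =
      app v (cap (modAct H.η M) H.counitCochain (join H _ z)) := by
  suffices h : cap (modAct H.η M) H.counitCochain ∘ₗ join H _ ∘ₗ step H _ v =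
      app v ∘ₗ cap (modAct H.η M) H.counitCochain ∘ₗ join H _ from LinearMap.congr_fun h z
  refine state_ext _ _ fun x g => ?_
  simp only [LinearMap.comp_apply]
  rw [step_stMk, join_stMk, map_bsum, map_bsum, cap_counit_app]
  have e : ∀ p q, cap (modAct H.η M) H.counitCochain (join H _
      (stMk H (modAct H.η M) (app p x ⊗ₜ (q * g)))) = app (p * tgt H.η (H.ε (q * g))) x := by
    intro p q
    rw [join_stMk, cap_counit_app, ← Module.End.mul_apply, act_app]
  simp only [e]
  have e' := map_bsum (app_isLinear H (modAct H.η M) x).mk' (H.tr v)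
    fun p q => p * tgt H.η (H.ε (q * g))
  rw [tr_counit] at e'
  refine e'.symm.trans ?_
  change app (tgt H.η (H.ε g) * v) x = _
  rw [← app_act]
  rfl

/-- The relation `d₀ s_{-1} = id`: induction on the word from the right, with the counit of the
coaction as base. -/
theorem cap_counit_coextra (x : Chains H.toLeftBialgebroid M) :
    cap (modAct H.η M) H.counitCochain (coextra C x) = x := by
  suffices h : cap (modAct H.η M) H.counitCochain * coextra C = 1 from LinearMap.congr_fun h x
  refine wext fun m l => ?_
  rw [Module.End.mul_apply, coextra, LinearMap.comp_apply, spread_mk]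
  induction l using List.reverseRecOn with
  | nil =>
    rw [startState_eq, steps_apply, List.foldl_nil, map_bsum, map_bsum]
    have := C.counit m _ (mk_coa C m)
    rw [tens, map_bsum] at this
    simp only [join_stMk, cap_counit_app, act_mk_nil]
    nth_rewrite 2 [← this]
    exact (map_bsum ((wmk_isWordMap H.η (modAct H.η M)).lin_left []).mk' _ _).symm
  | append_singleton l v ih =>
    rw [steps_append, steps_cons]
    change cap _ _ (join H _ (step H _ v (steps H _ l (startState C m)))) = _
    rw [cap_counit_join_step, ih]
    simp

theorem merge_app_app (x : Chains H.toLeftBialgebroid M) {n : ℕ}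
    (hx : x ∈ homog H.η (modAct H.η M) n) (u v : U) :
    slot (modAct H.η M) n 2 (prod_isSlotMap H.η) (app v (app u x)) = app (u * v) x := by
  refine homog_ext (f := slot (modAct H.η M) n 2 (prod_isSlotMap H.η) * app v * app u)
    (g := app (u * v)) (fun m l hl => ?_) hx
  have e := slot_mk (ρ := modAct H.η M) (prod_isSlotMap H.η) n 2 m (l₂ := [u, v]) [] hl rfl
  simp at e
  simp [e]

/-- Multiplying the two last letters `v₊` and `v₋g` gives `s(ε(v)) g` by `tr_mul`. -/
theorem merge_join_step (v : U) {n : ℕ} (m : M) (l : List U) (hl : l.length = n) (g : U) :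
    slot (modAct H.η M) n 2 (prod_isSlotMap H.η) (join H _ (step H _ v
      (stMk H (modAct H.η M) (wmk H.η _ m l ⊗ₜ g)))) =
    join H _ (srcState H _ (H.ε v) (stMk H (modAct H.η M) (wmk H.η _ m l ⊗ₜ g))) := by
  rw [step_stMk, srcState_mk, join_stMk, map_bsum, map_bsum]
  simp only [join_stMk]
  simp only [merge_app_app _ (wmk_mem_homog m hl)]
  rw [← tr_mul]
  have := map_bsum ((app_isLinear H (modAct H.η M) (wmk H.η _ m l)).mk' ∘ₗ
    LinearMap.mulRight k g) (H.tr v) fun x y => x * y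
  simp only [LinearMap.comp_apply, LinearMap.mulRight_apply, IsLinearMap.mk'_apply, mul_assoc]
    at this
  exact this.symm

/-- A factor `t(a)` on the right of the last letter becomes `s(a)` on the left of its second leg
(`srcState_step`); in degree `0` this is the `A`-linearity of the coaction. -/
theorem spread_act (a : A) (x : Chains H.toLeftBialgebroid M) :
    spread C (act H.η (modAct H.η M) a x) = srcState H _ a (spread C x) := by
  suffices h : spread C ∘ₗ act H.η (modAct H.η M) a = srcState H _ a ∘ₗ spread C from
    LinearMap.congr_fun h x
  refine wext fun m l => ?_
  simp only [LinearMap.comp_apply]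
  rcases List.eq_nil_or_concat l with rfl | ⟨l, u, rfl⟩
  · rw [act_mk_nil, spread_mk, spread_mk]
    exact startState_act C a m
  · rw [List.concat_eq_append, act_mk_concat, spread_mk, spread_mk, steps_append, steps_append,
      steps_cons, steps_cons, ← srcState_step]
    rfl

/-- The relation `s_{-1} d₀ = d₁ s_{-1}`: either way the last letter of the expansion of `u¹, …, uⁿ`
gets multiplied by `s(ε(uⁿ⁺¹))`, by `spread_act` on one side and `merge_join_step` on the other. -/
theorem coextra_cap_counit {n : ℕ} {x : Chains H.toLeftBialgebroid M}
    (hx : x ∈ homog H.η (modAct H.η M) (n + 1)) :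
    coextra C (cap (modAct H.η M) H.counitCochain x) =
      slot (modAct H.η M) n 2 (prod_isSlotMap H.η) (coextra C x) := by
  refine homog_ext (f := coextra C * cap (modAct H.η M) H.counitCochain)
    (g := slot (modAct H.η M) n 2 (prod_isSlotMap H.η) * coextra C) (fun m l hl => ?_) hx
  simp only [Module.End.mul_apply]
  rcases List.eq_nil_or_concat l with rfl | ⟨l, v, rfl⟩
  · simp at hl
  · rw [List.concat_eq_append, cap_mk _ m l (l₂ := [v]) rfl]
    change coextra C (act _ _ (H.ε v) _) = _
    rw [coextra, LinearMap.comp_apply, spread_act, LinearMap.comp_apply, spread_mk, spread_mk,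
      steps_append, steps_cons, startState_eq]
    simp only [map_bsum, steps_stMk]
    congr 1; funext h₀ m₀
    refine bsum_mem_congr _ fun q hq => ?_
    simp only [List.nil_append]
    rw [← merge_join_step v m₀ q.1 (n := n)
      (by rw [length_of_mem_expand H hq]; simpa using hl)]
    rfl

/-! #### The square of the extra degeneracy -/

/-- The map `(m, u¹, …, uⁿ) ↦ (m, u¹, …, uⁿ⁻¹) ⊗ uⁿ`, equal to `0` for `n = 0`. -/
noncomputable def unjoinFun (H : LeftHopfAlgebroid k A U) (m : M) (l : List U) :
    State H (modAct H.η M) :=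
  match l.getLast? with
  | none => 0
  | some u => stMk H (modAct H.η M) (wmk H.η (modAct H.η M) m l.dropLast ⊗ₜ u)

@[simp] theorem unjoinFun_concat (m : M) (l : List U) (u : U) :
    unjoinFun H m (l ++ [u]) = stMk H (modAct H.η M) (wmk H.η (modAct H.η M) m l ⊗ₜ u) := by
  simp [unjoinFun]

theorem unjoinFun_isWordMap : IsWordMap H.η (modAct H.η M) (unjoinFun H (M := M)) where
  lin_left l := by
    rcases List.eq_nil_or_concat l with rfl | ⟨l, u, rfl⟩
    · exact (0 : M →ₗ[k] _).isLinear
    · simp only [List.concat_eq_append, unjoinFun_concat]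
      exact stMk_left ((wmk_isWordMap H.η (modAct H.η M)).lin_left l) u
  lin_letter m l₁ l₂ := by
    rcases List.eq_nil_or_concat l₂ with rfl | ⟨l, u, rfl⟩
    · simp_rw [unjoinFun_concat]
      exact (stMk_bal H (modAct H.η M)).right _
    · simp_rw [List.concat_eq_append, ← List.cons_append, ← List.append_assoc, unjoinFun_concat]
      exact stMk_left ((wmk_isWordMap H.η (modAct H.η M)).lin_letter m l₁ l) u
  front b m u l := by
    rcases List.eq_nil_or_concat l with rfl | ⟨l, v, rfl⟩
    · rw [← List.nil_append [u], ← List.nil_append [tgt H.η b * u], unjoinFun_concat,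
        unjoinFun_concat]
      simpa using (stMk_bal H (modAct H.η M)).bal b (wmk H.η (modAct H.η M) m []) u
    · simp_rw [List.concat_eq_append, ← List.cons_append, unjoinFun_concat]
      rw [(wmk_isWordMap H.η (modAct H.η M)).front]
  inner b m l₁ u v l₂ := by
    rcases List.eq_nil_or_concat l₂ with rfl | ⟨l, w, rfl⟩
    · have h := fun x y : U => unjoinFun_concat (H := H) m (l₁ ++ [x]) y
      simp only [List.append_assoc, List.cons_append, List.nil_append] at h
      rw [h, h]
      simpa using (stMk_bal H (modAct H.η M)).bal b (wmk H.η (modAct H.η M) m (l₁ ++ [u])) v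
    · have h := fun x y : U => unjoinFun_concat (H := H) m (l₁ ++ x :: y :: l) w
      simp only [List.append_assoc, List.cons_append] at h
      rw [List.concat_eq_append, h, h, (wmk_isWordMap H.η (modAct H.η M)).inner]

/-- The map `(m, u¹, …, uⁿ) ↦ (m, u¹, …, uⁿ⁻¹) ⊗ uⁿ`. -/
noncomputable def unjoin (H : LeftHopfAlgebroid k A U) (M : Type*) [AddCommGroup M] [Module k M]
    [Module Uᵐᵒᵖ M] [IsScalarTower k Uᵐᵒᵖ M] :
    Chains H.toLeftBialgebroid M →ₗ[k] State H (modAct H.η M) :=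
  wlift (unjoinFun H) unjoinFun_isWordMap

theorem unjoin_app (h : U) (x : Chains H.toLeftBialgebroid M) :
    unjoin H M (app h x) = stMk H (modAct H.η M) (x ⊗ₜ h) := by
  have lin := (stMk_bal H (modAct H.η M)).left h
  suffices e : unjoin H M ∘ₗ app h = lin.mk' from LinearMap.congr_fun e x
  refine wext fun m l => ?_
  rw [LinearMap.comp_apply, app_mk, unjoin, wlift_mk, unjoinFun_concat]
  rfl

/-- Keeping the last letter apart loses nothing, so operators on states such as `step` can be
transported to words; `splitLast` is defined this way. -/
theorem unjoin_join (z : State H (modAct H.η M)) : unjoin H M (join H _ z) = z := by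
  suffices h : unjoin H M ∘ₗ join H _ = LinearMap.id from LinearMap.congr_fun h z
  refine state_ext _ _ fun x u => ?_
  rw [LinearMap.comp_apply, join_stMk, unjoin_app, LinearMap.id_apply]

/-- The operator `(m, u¹, …, uⁿ) ↦ (m, u¹, …, uⁿ⁻¹, v₊, v₋ uⁿ)`. -/
noncomputable def splitLast (H : LeftHopfAlgebroid k A U) (M : Type*) [AddCommGroup M]
    [Module k M] [Module Uᵐᵒᵖ M] [IsScalarTower k Uᵐᵒᵖ M] (v : U) :
    Module.End k (Chains H.toLeftBialgebroid M) :=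
  join H _ ∘ₗ step H _ v ∘ₗ unjoin H M

theorem splitLast_app (v h : U) (x : Chains H.toLeftBialgebroid M) :
    splitLast H M v (app h x) = bsum (H.tr v) fun p q => app (q * h) (app p x) := by
  rw [splitLast, LinearMap.comp_apply, LinearMap.comp_apply, unjoin_app, step_stMk, map_bsum]
  rfl

theorem splitLast_join (v : U) (z : State H (modAct H.η M)) :
    splitLast H M v (join H _ z) = join H _ (step H _ v z) := by
  rw [splitLast, LinearMap.comp_apply, LinearMap.comp_apply, unjoin_join]

theorem splitLast_act (v : U) (a : A) (x : Chains H.toLeftBialgebroid M) :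
    splitLast H M v (act H.η (modAct H.η M) a x) =
      act H.η (modAct H.η M) a (splitLast H M v x) := by
  suffices h : splitLast H M v * act H.η (modAct H.η M) a =
      act H.η (modAct H.η M) a * splitLast H M v from LinearMap.congr_fun h x
  refine wext fun m l => ?_
  simp only [Module.End.mul_apply]
  rcases List.eq_nil_or_concat l with rfl | ⟨l, u, rfl⟩
  · have e : ∀ m, unjoin H M (wmk H.η (modAct H.η M) m []) = 0 := fun m => wlift_mk _ _ _ _
    rw [act_mk_nil]
    simp [splitLast, e]
  · rw [List.concat_eq_append, act_mk_concat, ← app_mk, ← app_mk, splitLast_app, splitLast_app,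
      map_bsum]
    congr 1; funext p q
    rw [← Module.End.mul_apply (act _ _ _), act_app, mul_assoc]

/-- The operator `splitLast` on states. -/
noncomputable def splitState (H : LeftHopfAlgebroid k A U) (M : Type*) [AddCommGroup M]
    [Module k M] [Module Uᵐᵒᵖ M] [IsScalarTower k Uᵐᵒᵖ M] (v : U) :
    Module.End k (State H (modAct H.η M)) :=
  balLift (stMk H (modAct H.η M) ∘ₗ (splitLast H M v).rTensor U) (by
    intro a x h
    simp only [LinearMap.comp_apply, LinearMap.rTensor_tmul, splitLast_act]
    exact (stMk_bal H (modAct H.η M)).bal a (splitLast H M v x) h)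

theorem splitState_stMk (v : U) (x : Chains H.toLeftBialgebroid M) (h : U) :
    splitState H M v (stMk H (modAct H.η M) (x ⊗ₜ h)) =
      stMk H (modAct H.η M) (splitLast H M v x ⊗ₜ h) := rfl

theorem step_isLin (z : State H (modAct H.η M)) :
    IsLinearMap k fun v : U => step H (modAct H.η M) v z :=
  (LinearMap.applyₗ z ∘ₗ (step_isLinear H (modAct H.η M)).mk').isLinear

/-- On `x ⊗ g`, rewriting `v₊₊ ⊗ v₋ ⊗ v₊₋` as `v₊ ⊗ v₋₁ ⊗ v₋₂` by `tr_tr` yields `(x, v₊, (v₋₁h)₊) ⊗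
(v₋₁h)₋v₋₂g`, and `BalOp.gal_mul` turns this into `(x, v₊, v₋h₊) ⊗ h₋g`. -/
theorem step_step (v h : U) (z : State H (modAct H.η M)) :
    bsum (H.tr v) (fun p q => step H _ (q * h) (step H _ p z)) =
      splitState H M v (step H _ h z) := by
  have lin : IsLinearMap k fun z => bsum (H.tr v) fun p q =>
      step H (modAct H.η M) (q * h) (step H (modAct H.η M) p z) :=
    bsum_isLinear _ fun p q => (step H _ (q * h) ∘ₗ step H _ p).isLinear
  suffices e : lin.mk' = splitState H M v ∘ₗ step H _ h from LinearMap.congr_fun e z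
  refine state_ext _ _ fun x g => ?_
  simp only [IsLinearMap.mk'_apply, LinearMap.comp_apply]
  have key := tr_tr (H := H) (G := fun a b c => step H (modAct H.η M) (b * h)
      (stMk H (modAct H.η M) (app a x ⊗ₜ (c * g))))
    (fun b c => (step H _ (b * h) ∘ₗ (stMk_left (app_isLinear H _ x) (c * g)).mk').isLinear)
    (fun a c => isLinear_mul_right (step_isLin _) h)
    (fun a b => (step H _ (b * h) ∘ₗ (stMk_right
      (LinearMap.mulRight k g).isLinear (app a x)).mk').isLinear)
    (fun e a b c => by
      congr 1
      simpa [mul_assoc] using (app_bal (H := H) x g).bal e a c)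
    (fun e a b c => by
      rw [mul_assoc, ← step_srcState, Module.End.mul_apply, srcState_mk, mul_assoc]) v
  have e1 : ∀ p q, step H (modAct H.η M) (q * h) (step H _ p (stMk H _ (x ⊗ₜ g))) =
      bsum (H.tr p) fun p' q' => step H _ (q * h) (stMk H _ (app p' x ⊗ₜ (q' * g))) := by
    intro p q
    rw [step_stMk, map_bsum]
  simp only [e1]
  rw [key]
  have e2 : ∀ p q, (bsum (H.cop q) fun y₁ y₂ => step H (modAct H.η M) (y₁ * h)
      (stMk H _ (app p x ⊗ₜ (y₂ * g)))) = bsum (H.tr h) fun p' q' =>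
        stMk H _ (app (q * p') (app p x) ⊗ₜ (q' * g)) := by
    intro p q
    rw [← BalOp.gal_mul (app_bal (app p x) g) q h]
    simp only [step_stMk, mul_assoc]
  simp only [e2]
  rw [bsum_comm, step_stMk, map_bsum]
  congr 1; funext p q
  rw [splitState_stMk, splitLast_app]
  exact (map_bsum ((stMk_bal H (modAct H.η M)).left (q * g)).mk' _ _).symm

/-- The operator `x ⊗ h ↦ step h (spread x)`. -/
noncomputable def respread : Module.End k (State H (modAct H.η M)) :=
  IsBal.lift (ρ := act H.η (modAct H.η M)) (l := fun a : A => LinearMap.mulLeft k (tgt H.η a))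
    (F := fun x h => step H _ h (spread C x))
    { left := fun h => (step H _ h ∘ₗ spread C).isLinear
      right := fun x => step_isLin _
      bal := fun a x h => by
        rw [spread_act, ← Module.End.mul_apply, step_srcState]
        rfl }

theorem respread_stMk (x : Chains H.toLeftBialgebroid M) (h : U) :
    respread C (stMk H _ (x ⊗ₜ h)) = step H _ h (spread C x) := rfl

theorem spread_app (h : U) (x : Chains H.toLeftBialgebroid M) :
    spread C (app h x) = step H _ h (spread C x) := by
  suffices e : spread C ∘ₗ app h = step H _ h ∘ₗ spread C from LinearMap.congr_fun e x
  refine wext fun m l => ?_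
  simp only [LinearMap.comp_apply, app_mk, spread_mk, steps_append]
  rfl

theorem coextra_join (z : State H (modAct H.η M)) :
    coextra C (join H _ z) = join H _ (respread C z) := by
  suffices e : coextra C ∘ₗ join H _ = join H _ ∘ₗ respread C from LinearMap.congr_fun e z
  refine state_ext _ _ fun x h => ?_
  simp only [LinearMap.comp_apply, join_stMk, respread_stMk, coextra, spread_app]

theorem respread_step (v : U) (z : State H (modAct H.η M)) :
    respread C (step H _ v z) = splitState H M v (respread C z) := by
  suffices e : respread C ∘ₗ step H _ v = splitState H M v ∘ₗ respread C from
    LinearMap.congr_fun e z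
  refine state_ext _ _ fun x h => ?_
  simp only [LinearMap.comp_apply, respread_stMk, step_stMk, map_bsum, spread_app]
  exact step_step v h _

/-- Coassociativity of the coaction rewrites the left side as `(m₀, m₋₁₁₊) ⊗ m₋₁₁₋m₋₁₂`, and
`BalOp.gal` contracts the legs of `m₋₁` to `m₋₁ ⊗ 1`. -/
theorem respread_startState (m : M) : respread C (startState C m) =
    stMk H _ (join H _ (startState C m) ⊗ₜ 1) := by
  have htri : IsTriBal (k := k) (fun a => LinearMap.mulLeft k (tgt H.η a)) (lsrc H.η)
      (fun a => LinearMap.mulLeft k (tgt H.η a)) (fun a => modAct H.η M a)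
      fun a b m' => step H (modAct H.η M) a (stMk H _ (wmk H.η (modAct H.η M) m' [] ⊗ₜ b)) := by
    refine ⟨fun b m' => step_isLin _, fun a m' => (step H _ a ∘ₗ
      ((stMk_bal H (modAct H.η M)).right _).mk').isLinear, fun a b => (step H _ a ∘ₗ
      (stMk_left ((wmk_isWordMap H.η (modAct H.η M)).lin_left []) b).mk').isLinear,
      fun e a b m' => ?_, fun e a b m' => ?_⟩
    · simp only [LinearMap.mulLeft_apply]
      rw [← step_srcState, Module.End.mul_apply, srcState_mk]
    · congr 1
      rw [← act_mk_nil]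
      exact ((stMk_bal H (modAct H.η M)).bal e (wmk H.η (modAct H.η M) m' []) b).symm
  have := IsTriBal.lift_eq htri (C.coassoc m _
    (bsum (coa C m) fun x y => tens k (H.cop x) ⊗ₜ[k] y)
    (bsum (coa C m) fun x y => x ⊗ₜ[k] tens k (coa C y)) (mk_coa C m)
    (by
      rw [map_bsum, tens, map_bsum]
      congr 1; funext x y
      rw [LinearMap.rTensor_tmul, LinearMap.rTensor_tmul, H.mk_cop])
    (by
      rw [map_bsum, tens, map_bsum]
      congr 1; funext x y
      rw [LinearMap.lTensor_tmul, LinearMap.lTensor_tmul, mk_coa]))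
  rw [map_bsum, map_bsum, map_bsum] at this
  simp only [htri.lift_tens] at this
  have e1 : respread C (startState C m) = bsum (coa C m) fun x y => bsum (coa C y) fun b m' =>
      step H (modAct H.η M) x (stMk H _ (wmk H.η (modAct H.η M) m' [] ⊗ₜ b)) := by
    rw [startState_eq, map_bsum]
    congr 1; funext x y
    rw [respread_stMk, spread_mk]
    change step H _ x (startState C y) = _
    rw [startState_eq, map_bsum]
  rw [e1, ← this, startState_eq, map_bsum,
    ← IsLinearMap.mk'_apply ((stMk_bal H (modAct H.η M)).left 1), map_bsum]
  congr 1; funext x y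
  have e : tens k (H.cop x) ⊗ₜ[k] y = bsum (H.cop x) fun x₁ x₂ => (x₁ ⊗ₜ[k] x₂) ⊗ₜ[k] y := by
    rw [tens, ← TensorProduct.mk_apply, ← LinearMap.flip_apply, map_bsum]
    rfl
  rw [e, map_bsum, map_bsum, IsLinearMap.mk'_apply, join_stMk]
  have g := BalOp.gal (app_bal (H := H) (wmk H.η (modAct H.η M) y []) 1) x
  simp only [mul_one] at g
  rw [← g]
  congr 1; funext x₁ x₂
  exact step_stMk _ _ _ _ _

theorem respread_spread (x : Chains H.toLeftBialgebroid M) :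
    respread C (spread C x) = stMk H _ (coextra C x ⊗ₜ 1) := by
  have lin : IsLinearMap k fun x => stMk H (modAct H.η M) (coextra C x ⊗ₜ (1 : U)) :=
    stMk_left (coextra C).isLinear 1
  suffices e : respread C ∘ₗ spread C = lin.mk' from LinearMap.congr_fun e x
  refine wext fun m l => ?_
  simp only [IsLinearMap.mk'_apply, LinearMap.comp_apply]
  induction l using List.reverseRecOn with
  | nil =>
    rw [coextra, LinearMap.comp_apply, spread_mk]
    exact respread_startState C m
  | append_singleton l v ih =>
    rw [← app_mk, spread_app, respread_step, ih, splitState_stMk]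
    congr 2
    rw [coextra, LinearMap.comp_apply, splitLast_join, LinearMap.comp_apply, spread_app]

/-- The relation `s_{-1} s_{-1} = s₀ s_{-1}`: on a second application the translation of the last
letter absorbs everything and `1` remains. Every vanishing in the reduced quotient that involves two
extra degeneracies comes from here. -/
theorem coextra_coextra (x : Chains H.toLeftBialgebroid M) :
    coextra C (coextra C x) = app 1 (coextra C x) := by
  change coextra C (join H _ (spread C x)) = _
  rw [coextra_join, respread_spread, join_stMk]

end Extra

end HopfAlgd

namespace HopfAlgd

/-! ### The operators `D_φ` and the differential of cochains -/

section Differential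

open LeftHopfAlgebroid LeftBialgebroid

variable {k A U : Type*} [CommRing k] [Ring A] [Algebra k A] [Ring U] [Algebra k U]
  (H : LeftHopfAlgebroid k A U)

variable {H} in
theorem wmk_balUU (w : U) (l : List U) :
    H.BalUU fun x y => wmk H.η H.srcAct (y * w) (x :: l) where
  left y := (wmk_isWordMap H.η H.srcAct).lin_letter (y * w) [] l
  right x := (((wmk_isWordMap H.η H.srcAct).lin_left (x :: l)).mk' ∘ₗ
    LinearMap.mulRight k w).isLinear
  bal a x y := by
    simpa [srcHom_apply, mul_assoc] using
      ((wmk_isWordMap H.η H.srcAct).front a (y * w) x l).symm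

theorem coactWord_cons (u : U) (l : List U) :
    H.coactWord (u :: l) = H.prep u (H.coactWord l) := rfl

theorem prep_mem {n : ℕ} (u : U) {z : Words H.η H.srcAct} (hz : z ∈ homog H.η H.srcAct n) :
    H.prep u z ∈ homog H.η H.srcAct (n + 1) := by
  refine map_mem_homog (fun w l hl => ?_) hz
  rw [prep_wmk]
  refine list_sum_mem fun z hz => ?_
  obtain ⟨q, hq, rfl⟩ := List.mem_map.1 hz
  exact wmk_mem_homog _ (by simp [hl])

theorem coactWord_mem (l : List U) : H.coactWord l ∈ homog H.η H.srcAct l.length := by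
  induction l with
  | nil => exact wmk_mem_homog _ rfl
  | cons u l ih => exact prep_mem H u ih

theorem slot_prep {f : List U → U} (hf : IsSlotMap (k := k) H.η f) (r q : ℕ) (u : U)
    (z : Words H.η H.srcAct) :
    slot H.srcAct (r + 1) q hf (H.prep u z) = H.prep u (slot H.srcAct r q hf z) := by
  suffices h : slot H.srcAct (r + 1) q hf * H.prep u = H.prep u * slot H.srcAct r q hf from
    LinearMap.congr_fun h z
  refine wext fun w l => ?_
  simp only [Module.End.mul_apply]
  rw [prep_wmk, map_bsum]
  by_cases h : r + q ≤ l.length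
  · obtain ⟨l₁, l₂, l₃, rfl, h₁, h₂⟩ := split_word h
    rw [slot_mk hf r q w l₃ h₁ h₂, prep_wmk]
    congr 1; funext x y
    exact slot_mk hf (r + 1) q (y * w) (l₁ := x :: l₁) l₃ (by simp [h₁]) h₂
  · rw [slot_mk_of_lt hf r q w (by omega), map_zero]
    have e : ∀ x y : U, slot H.srcAct (r + 1) q hf (wmk H.η H.srcAct (y * w) (x :: l)) = 0 :=
      fun x y => slot_mk_of_lt hf _ q _ (by simp; omega)
    simp only [e]
    simp [bsum]

theorem slot_prep_prep (u v : U) (z : Words H.η H.srcAct) :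
    slot H.srcAct 0 2 (prod_isSlotMap H.η) (H.prep u (H.prep v z)) = H.prep (u * v) z := by
  suffices h : slot H.srcAct 0 2 (prod_isSlotMap H.η) * H.prep u * H.prep v = H.prep (u * v) from
    LinearMap.congr_fun h z
  refine wext fun w l => ?_
  simp only [Module.End.mul_apply]
  rw [prep_wmk, prep_wmk, BalUU.mul (wmk_balUU w l), map_bsum, map_bsum, bsum_comm]
  congr 1; funext x y
  rw [prep_wmk, map_bsum]
  congr 1; funext x' y'
  have e := slot_mk (ρ := H.srcAct) (prod_isSlotMap H.η) 0 2 (y' * (y * w)) (l₁ := [])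
    (l₂ := [x', x]) l rfl rfl
  simp only [List.nil_append, List.cons_append, List.prod_cons, List.prod_nil, mul_one] at e
  rw [e, mul_assoc]

theorem slot_coactWord_merge (l₁ l₂ : List U) (u v : U) :
    slot H.srcAct l₁.length 2 (prod_isSlotMap H.η) (H.coactWord (l₁ ++ u :: v :: l₂)) =
      H.coactWord (l₁ ++ (u * v) :: l₂) := by
  induction l₁ with
  | nil => exact slot_prep_prep H u v _
  | cons x l₁ ih =>
    rw [List.cons_append, coactWord_cons, List.length_cons, slot_prep, ih]
    rfl

theorem prep_one (z : Words H.η H.srcAct) :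
    H.prep 1 z = slot H.srcAct 0 0 (prod_isSlotMap H.η) z := by
  refine LinearMap.congr_fun (wext fun w l => ?_) z
  have e := slot_mk (ρ := H.srcAct) (prod_isSlotMap H.η) 0 0 w (l₁ := []) (l₂ := []) l rfl rfl
  simp only [List.nil_append, List.prod_nil] at e
  rw [prep_wmk, BalUU.one (wmk_balUU w l), e, one_mul]

theorem slot_coactWord_one (l₁ l₂ : List U) :
    slot H.srcAct l₁.length 0 (prod_isSlotMap H.η) (H.coactWord (l₁ ++ l₂)) =
      H.coactWord (l₁ ++ 1 :: l₂) := by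
  induction l₁ with
  | nil => exact (prep_one H _).symm
  | cons x l₁ ih =>
    rw [List.cons_append, coactWord_cons, List.length_cons, slot_prep, ih]
    rfl

/-- Only the empty word needs an argument: there the action on the first entry has to pass to the
new letter, which is the Takeuchi condition. -/
theorem prep_act (a : A) (u : U) (z : Words H.η H.srcAct) :
    H.prep u (act H.η H.srcAct a z) = act H.η H.srcAct a (H.prep u z) := by
  suffices h : H.prep u * act H.η H.srcAct a = act H.η H.srcAct a * H.prep u from
    LinearMap.congr_fun h z
  refine wext fun w l => ?_
  simp only [Module.End.mul_apply]
  rcases List.eq_nil_or_concat l with rfl | ⟨l, v, rfl⟩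
  · have e := fun x y : U => act_mk_concat (η := H.η) (ρ := H.srcAct) a (y * w) [] x
    simp only [List.nil_append] at e
    rw [act_mk_nil, prep_wmk, prep_wmk, map_bsum]
    simp only [e]
    rw [BalUU.takeuchi (wmk_balUU w []) a u]
    simp [srcHom_apply, mul_assoc]
  · have e := fun x y : U => act_mk_concat (η := H.η) (ρ := H.srcAct) a (y * w) (x :: l) v
    simp only [List.cons_append] at e
    rw [List.concat_eq_append, act_mk_concat, prep_wmk, prep_wmk, map_bsum]
    simp only [e]

theorem cap_counit_prep {n : ℕ} (u : U) {z : Words H.η H.srcAct}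
    (hz : z ∈ homog H.η H.srcAct (n + 1)) :
    cap H.srcAct H.counitCochain (H.prep u z) = H.prep u (cap H.srcAct H.counitCochain z) := by
  refine homog_ext (f := cap H.srcAct H.counitCochain * H.prep u)
    (g := H.prep u * cap H.srcAct H.counitCochain) (fun w l hl => ?_) hz
  rcases List.eq_nil_or_concat l with rfl | ⟨l, v, rfl⟩
  · simp at hl
  · simp only [Module.End.mul_apply, List.concat_eq_append]
    have e := fun x y : U => cap_mk (ρ := H.srcAct) H.counitCochain (y * w) (x :: l) (l₂ := [v]) rfl
    simp only [List.cons_append] at e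
    rw [cap_mk _ w l (l₂ := [v]) rfl, prep_act, prep_wmk, prep_wmk, map_bsum, map_bsum]
    simp only [e]

/-- The counit of the last first leg recombines with its second leg to `s(ε(v₁))v₂ = v`, which
stands at the right end of the product of second legs. This produces the summand `D_φ(…) v` of
`DD_delta`. -/
theorem cap_counit_coactWord (l : List U) (v : U) :
    cap H.srcAct H.counitCochain (H.coactWord (l ++ [v])) = H.rmulWord v (H.coactWord l) := by
  induction l with
  | nil =>
    rw [List.nil_append, coactWord_cons]
    change cap H.srcAct H.counitCochain (H.prep v (wmk H.η H.srcAct 1 [])) =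
      H.rmulWord v (wmk H.η H.srcAct 1 [])
    have e := fun x y : U =>
      cap_mk (ρ := H.srcAct) H.counitCochain (y * 1) [] (l₂ := [x]) rfl
    simp only [List.nil_append] at e
    rw [prep_wmk, map_bsum, rmulWord_mk]
    simp only [e, act_mk_nil]
    have := map_bsum ((wmk_isWordMap H.η H.srcAct).lin_left []).mk' (H.cop v)
      fun x y => src H.η (H.ε x) * y
    rw [cop_counit_left] at this
    simp only [mul_one, one_mul]
    exact this.symm
  | cons u l ih =>
    rw [List.cons_append, coactWord_cons,
      cap_counit_prep H (n := l.length) u (by simpa using coactWord_mem H (l ++ [v])), ih,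
      coactWord_cons]
    exact LinearMap.congr_fun (H.prep_rmulWord v u) _

variable {p : ℕ} (φ : Cochain (k := k) H.η p)

theorem contract_act (a : A) (w : U) (l : List U) :
    H.contract φ (act H.η H.srcAct a (wmk H.η H.srcAct w l)) =
      src H.η (H.lastAct φ a l) * w := by
  rcases List.eq_nil_or_concat l with rfl | ⟨l, v, rfl⟩
  · simp [lastAct, src_mul, mul_assoc, srcHom_apply]
  · simp [lastAct]

/-- The sum of all terms but the first one of the differential, after the coaction. -/
noncomputable def contractAux : Words H.η H.srcAct →ₗ[k] U :=
  ∑ i ∈ Finset.Icc 1 p, (-1 : ℤ) ^ i •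
    (H.contract φ ∘ₗ slot H.srcAct (i - 1) 2 (prod_isSlotMap H.η))
  + (-1 : ℤ) ^ (p + 1) • (H.contract φ ∘ₗ cap H.srcAct H.counitCochain)

theorem contract_delta_mk (w : U) (l : List U) (hl : l.length = p + 1) :
    H.contract (H.delta φ) (wmk H.η H.srcAct w l) =
      src H.η (H.headTerm φ l) * w + contractAux H φ (wmk H.η H.srcAct w l) := by
  have e₁ : ∀ i, i + 2 ≤ p + 1 → H.contract φ (slot H.srcAct i 2 (prod_isSlotMap H.η)
      (wmk H.η H.srcAct w l)) =
      src H.η (φ.toFun (l.take i ++ ((l.drop i).take 2).prod :: l.drop (i + 2))) * w := by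
    intro i hi
    rw [slot, wlift_mk, slotFun, if_pos (by omega), contract_mk]
  have e₂ : H.contract φ (cap H.srcAct H.counitCochain (wmk H.η H.srcAct w l)) =
      src H.η (H.lastTerm φ l) * w := by
    rcases List.eq_nil_or_concat l with rfl | ⟨l, v, rfl⟩
    · simp at hl
    · rw [List.concat_eq_append, cap_mk _ w l (l₂ := [v]) rfl, contract_act]
      simp [lastTerm, counitCochain]
  have e₃ : (H.delta φ).toFun l = H.deltaFun φ l := rfl
  rw [contract_mk, e₃, deltaFun, if_pos hl]
  simp only [contractAux, LinearMap.add_apply, LinearMap.sum_apply, LinearMap.smul_apply,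
    LinearMap.comp_apply, e₂, ← srcHom_apply, map_add, map_sum, map_zsmul, add_mul, Finset.sum_mul,
    smul_mul_assoc, add_assoc]
  congr 2
  refine Finset.sum_congr rfl fun i hi => ?_
  rw [Finset.mem_Icc] at hi
  rw [e₁ _ (by omega), srcHom_apply, show i - 1 + 2 = i + 1 by omega]

/-- The head term of `δφ` contributes `s(ε(u₁ s(φ(l)))) u₂ w`. Since `Δ(u s(a)) = u₁ s(a) ⊗ u₂`,
counitality reduces it to `u s(φ(l)) w`. -/
theorem contract_delta_prep (u : U) {z : Words H.η H.srcAct} (hz : z ∈ homog H.η H.srcAct p) :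
    H.contract (H.delta φ) (H.prep u z) =
      u * H.contract φ z + contractAux H φ (H.prep u z) := by
  refine homog_ext (f := H.contract (H.delta φ) ∘ₗ H.prep u)
    (g := LinearMap.mulLeft k u ∘ₗ H.contract φ + contractAux H φ ∘ₗ H.prep u)
    (fun w l hl => ?_) hz
  simp only [LinearMap.add_apply, LinearMap.comp_apply, LinearMap.mulLeft_apply, prep_wmk,
    map_bsum]
  have e := fun x y : U => contract_delta_mk H φ (y * w) (x :: l) (by simpa using hl)
  simp only [e, bsum_add, headTerm, contract_mk]
  congr 1
  have hb : H.BalUU fun x y => src H.η (H.ε x) * (y * w) :=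
    { left := fun y => ((LinearMap.mulRight k (y * w)) ∘ₗ (srcHom H.η).toLinearMap ∘ₗ
        H.ε).isLinear
      right := fun x => (LinearMap.mulLeft k (src H.η (H.ε x)) ∘ₗ LinearMap.mulRight k w).isLinear
      bal := fun a x y => by simp [ε_tgt_mul, src_mul, mul_assoc] }
  rw [← BalUU.mul_src hb, ← mul_assoc]
  have := map_bsum (LinearMap.mulRight k w) (H.cop (u * src H.η (φ.toFun l)))
    fun x y => src H.η (H.ε x) * y
  rw [cop_counit_left] at this
  simpa [mul_assoc] using this.symm

/-- All counits in `δφ` turn into multiplications in `U`: the head and last terms become products of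
the outer letters with `D_φ`. Hence `D_{δφ}` is built from insertions of `D_φ` and merges of letters
alone. -/
theorem DD_delta {l l₀ l₁ : List U} {u v : U} (hl : l.length = p + 1) (h₀ : l = u :: l₁)
    (h₁ : l = l₀ ++ [v]) : H.DD (H.delta φ) l = u * H.DD φ l₁ +
      (∑ i ∈ Finset.Icc 1 p, (-1 : ℤ) ^ i •
        H.DD φ (l.take (i - 1) ++ ((l.drop (i - 1)).take 2).prod :: l.drop (i + 1)) +
      (-1 : ℤ) ^ (p + 1) • (H.DD φ l₀ * v)) := by
  subst h₀
  have hl₁ : l₁.length = p := by simpa using hl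
  rw [DD, coactWord_cons, contract_delta_prep H φ u (hl₁ ▸ coactWord_mem H l₁),
    ← coactWord_cons]
  simp only [contractAux, LinearMap.add_apply, LinearMap.sum_apply, LinearMap.smul_apply,
    LinearMap.comp_apply]
  congr 2
  · refine Finset.sum_congr rfl fun i hi => ?_
    rw [Finset.mem_Icc] at hi
    congr 1
    obtain ⟨a, b, c, hw, ha, hb⟩ := split_word (l := u :: l₁) (r := i - 1) (q := 2) (by omega)
    obtain ⟨x, y, rfl⟩ := List.length_eq_two.1 hb
    have e := slot_coactWord_merge H a c x y
    rw [ha] at e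
    rw [hw, show a ++ ([x, y] ++ c) = a ++ x :: y :: c by simp, e, DD]
    congr 2
    rw [show i + 1 = (i - 1) + 2 by omega, ← ha]
    simp
  · rw [h₁, cap_counit_coactWord, contract_rmulWord, DD]

/-- The map `(w, u¹, …, uⁿ) ↦ (ε(w), u¹, …, uⁿ)`. -/
noncomputable def counitWord : Words H.η H.srcAct →ₗ[k] Words H.η (Algebra.lmul k A) :=
  wlift (fun w l => wmk H.η (Algebra.lmul k A) (H.ε w) l)
    { lin_left := fun l => (((wmk_isWordMap H.η (Algebra.lmul k A)).lin_left l).mk' ∘ₗ H.ε).isLinear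
      lin_letter := fun w l₁ l₂ => (wmk_isWordMap H.η (Algebra.lmul k A)).lin_letter _ _ _
      front := fun a w u l => by
        simpa [srcHom_apply, ε_src_mul] using
          (wmk_isWordMap H.η (Algebra.lmul k A)).front a (H.ε w) u l
      inner := fun a w l₁ u v l₂ => (wmk_isWordMap H.η (Algebra.lmul k A)).inner _ _ _ _ _ _ }

theorem counitWord_mk (w : U) (l : List U) : counitWord H (wmk H.η H.srcAct w l) =
    wmk H.η (Algebra.lmul k A) (H.ε w) l := wlift_mk _ _ _ _

/-- The operator `(b, u¹, …, uⁿ) ↦ (1, u t(b), u¹, …, uⁿ)`. -/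
noncomputable def prepCounit (u : U) : Module.End k (Words H.η (Algebra.lmul k A)) :=
  wlift (fun b l => wmk H.η (Algebra.lmul k A) 1 (u * tgt H.η b :: l))
    { lin_left := fun l => ⟨fun b c => by
          simp only [tgt_add, mul_add]
          exact ((wmk_isWordMap H.η (Algebra.lmul k A)).lin_letter 1 [] l).map_add _ _,
        fun c b => by
          simp only [tgt_smul, mul_smul_comm]
          exact ((wmk_isWordMap H.η (Algebra.lmul k A)).lin_letter 1 [] l).map_smul _ _⟩
      lin_letter := fun b l₁ l₂ =>
        (wmk_isWordMap H.η (Algebra.lmul k A)).lin_letter 1 (u * tgt H.η b :: l₁) l₂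
      front := fun a b v l => by
        simpa [tgt_mul, mul_assoc] using
          (wmk_isWordMap H.η (Algebra.lmul k A)).inner a 1 [] (u * tgt H.η b) v l
      inner := fun a b l₁ v w l₂ =>
        (wmk_isWordMap H.η (Algebra.lmul k A)).inner a 1 (u * tgt H.η b :: l₁) v w l₂ }

theorem prepCounit_mk (u : U) (b : A) (l : List U) :
    prepCounit H u (wmk H.η (Algebra.lmul k A) b l) =
      wmk H.η (Algebra.lmul k A) 1 (u * tgt H.η b :: l) := wlift_mk _ _ _ _

theorem counitWord_prep (u : U) (z : Words H.η H.srcAct) :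
    counitWord H (H.prep u z) = prepCounit H u (counitWord H z) := by
  suffices h : counitWord H ∘ₗ H.prep u = prepCounit H u ∘ₗ counitWord H from
    LinearMap.congr_fun h z
  refine wext fun w l => ?_
  have e : ∀ x y : U, wmk H.η (Algebra.lmul k A) (H.ε (y * w)) (x :: l) =
      wmk H.η (Algebra.lmul k A) (H.ε (y * src H.η (H.ε w))) (x :: l) := fun x y => by
    rw [H.ε_mul_src]
  have hb : H.BalUU fun x y => wmk H.η (Algebra.lmul k A) (H.ε y) (x :: l) :=
    { left := fun y => (wmk_isWordMap H.η (Algebra.lmul k A)).lin_letter (H.ε y) [] l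
      right := fun x => (((wmk_isWordMap H.η (Algebra.lmul k A)).lin_left (x :: l)).mk' ∘ₗ
        H.ε).isLinear
      bal := fun a x y => by
        simpa [ε_src_mul] using
          ((wmk_isWordMap H.η (Algebra.lmul k A)).front a (H.ε y) x l).symm }
  simp only [LinearMap.comp_apply, prep_wmk, map_bsum, counitWord_mk, prepCounit_mk, e]
  -- The Takeuchi condition moves `ε(w)` from the second leg to the first as `x t(ε(w))`; `e'` then
  -- moves `ε(y)` there as well, and counitality restores `u`.
  rw [← BalUU.takeuchi hb]
  have e' : ∀ x y : U, wmk H.η (Algebra.lmul k A) (H.ε y) (x * tgt H.η (H.ε w) :: l) =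
      wmk H.η (Algebra.lmul k A) 1 (tgt H.η (H.ε y) * x * tgt H.η (H.ε w) :: l) := fun x y => by
    have := (wmk_isWordMap H.η (Algebra.lmul k A)).front (H.ε y) 1 (x * tgt H.η (H.ε w)) l
    simpa [mul_assoc] using this
  simp only [e']
  have := map_bsum (((wmk_isWordMap H.η (Algebra.lmul k A)).lin_letter 1 [] l).mk' ∘ₗ
    LinearMap.mulRight k (tgt H.η (H.ε w))) (H.cop u) fun x y => tgt H.η (H.ε y) * x
  rw [cop_counit_right] at this
  exact this.symm

theorem counitWord_coactWord (l : List U) :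
    counitWord H (H.coactWord l) = wmk H.η (Algebra.lmul k A) 1 l := by
  induction l with
  | nil =>
    change counitWord H (wmk H.η H.srcAct 1 []) = _
    rw [counitWord_mk, H.ε_one]
  | cons u l ih => rw [coactWord_cons, counitWord_prep, ih, prepCounit_mk, tgt_one, mul_one]

theorem pairing_counitWord (z : Words H.η H.srcAct) :
    H.pairing φ (counitWord H z) = H.ε (H.contract φ z) := by
  suffices h : H.pairing φ ∘ₗ counitWord H = H.ε ∘ₗ H.contract φ from LinearMap.congr_fun h z
  refine wext fun w l => ?_
  simp only [LinearMap.comp_apply, counitWord_mk, pairing_mk, contract_mk, ε_src_mul]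

/-- `ε ∘ D_φ = φ`. -/
theorem ε_DD (l : List U) : H.ε (H.DD φ l) = φ.toFun l := by
  rw [DD, ← pairing_counitWord, counitWord_coactWord, pairing_mk, mul_one]

variable {H φ}

theorem contract_degen (hφ : IsReduced φ) (r : ℕ) (z : Words H.η H.srcAct) :
    H.contract φ (slot H.srcAct r 0 (prod_isSlotMap H.η) z) = 0 := by
  suffices h : H.contract φ ∘ₗ slot H.srcAct r 0 (prod_isSlotMap H.η) = 0 from
    LinearMap.congr_fun h z
  refine wext fun w l => ?_
  by_cases h : r ≤ l.length
  · obtain ⟨l₁, l₂, rfl, h₁⟩ := split_word₂ h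
    have e := slot_mk (ρ := H.srcAct) (prod_isSlotMap H.η) r 0 w (l₂ := []) l₂ h₁ rfl
    simp only [List.nil_append, List.prod_nil] at e
    rw [LinearMap.comp_apply, e, contract_mk, hφ]
    simp [← srcHom_apply]
  · rw [LinearMap.comp_apply, slot_mk_of_lt _ _ _ _ (by omega)]
    simp

/-- Since `Δ 1 = 1 ⊗ 1`, an argument `1` survives the coaction as an argument `1` of `φ`. -/
theorem DD_eq_zero (hφ : IsReduced φ) (l₁ l₂ : List U) : H.DD φ (l₁ ++ 1 :: l₂) = 0 := by
  rw [DD, ← slot_coactWord_one, contract_degen hφ]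

end Differential

end HopfAlgd

namespace HopfAlgd

/-! ### Insertion of `D_φ` in words -/

section Insertion

open LeftHopfAlgebroid LeftBialgebroid

variable {k A U : Type*} [CommRing k] [Ring A] [Algebra k A] [Ring U] [Algebra k U]
  {H : LeftHopfAlgebroid k A U} {M : Type*} [AddCommGroup M] [Module k M]
  {ρ : A →ₐ[k] Module.End k M} {p : ℕ} (φ : Cochain (k := k) H.η p)

/-- As `ε ∘ D_φ = φ`, the cap product is `d₀` after the last insertion, so relations for `ι_φ`
follow from those for faces and insertions. -/
theorem cap_eq_cap_counit {n : ℕ} (h : p ≤ n) {x : Words H.η ρ} (hx : x ∈ homog H.η ρ n) :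
    cap ρ φ x = cap ρ H.counitCochain (slot ρ (n - p) p (H.DD_isSlotMap φ) x) := by
  refine homog_ext (g := cap ρ H.counitCochain ∘ₗ slot ρ (n - p) p (H.DD_isSlotMap φ))
    (fun m l hl => ?_) hx
  obtain ⟨l₁, l₂, rfl, h₁⟩ := split_word₂ (l := l) (r := n - p) (by omega)
  have h₂ : l₂.length = p := by simp at hl; omega
  have e := slot_mk (ρ := ρ) (H.DD_isSlotMap φ) (n - p) p m [] h₁ h₂
  simp only [List.append_nil] at e
  rw [LinearMap.comp_apply, e, cap_mk φ m l₁ h₂,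
    cap_mk H.counitCochain m l₁ (l₂ := [H.DD φ l₂]) rfl]
  congr 2
  exact (ε_DD H φ l₂).symm

theorem slot_DD_delta {n r : ℕ} (h : r + (p + 1) ≤ n) {x : Words H.η ρ}
    (hx : x ∈ homog H.η ρ n) :
    slot ρ r (p + 1) (H.DD_isSlotMap (H.delta φ)) x =
      slot ρ r 2 (prod_isSlotMap H.η) (slot ρ (r + 1) p (H.DD_isSlotMap φ) x) +
      (∑ i ∈ Finset.Icc 1 p, (-1 : ℤ) ^ i • slot ρ r p (H.DD_isSlotMap φ)
        (slot ρ (r + (i - 1)) 2 (prod_isSlotMap H.η) x) +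
      (-1 : ℤ) ^ (p + 1) • slot ρ r 2 (prod_isSlotMap H.η)
        (slot ρ r p (H.DD_isSlotMap φ) x)) := by
  refine (homog_ext (g := slot ρ r 2 (prod_isSlotMap H.η) ∘ₗ
      slot ρ (r + 1) p (H.DD_isSlotMap φ) +
    (∑ i ∈ Finset.Icc 1 p, (-1 : ℤ) ^ i • (slot ρ r p (H.DD_isSlotMap φ) ∘ₗ
        slot ρ (r + (i - 1)) 2 (prod_isSlotMap H.η)) +
      (-1 : ℤ) ^ (p + 1) • (slot ρ r 2 (prod_isSlotMap H.η) ∘ₗ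
        slot ρ r p (H.DD_isSlotMap φ)))) (fun m l hl => ?_) hx).trans (by
      simp only [LinearMap.add_apply, LinearMap.sum_apply, LinearMap.smul_apply,
        LinearMap.comp_apply])
  simp only [LinearMap.add_apply, LinearMap.sum_apply, LinearMap.smul_apply, LinearMap.comp_apply]
  obtain ⟨l₁, l₂, l₃, rfl, h₁, h₂⟩ := split_word (l := l) (r := r) (q := p + 1) (by omega)
  obtain ⟨u, l₁', rfl⟩ := List.exists_cons_of_length_eq_add_one h₂
  obtain ⟨l₀, v, hv⟩ : ∃ l₀ v, u :: l₁' = l₀ ++ [v] := by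
    rcases List.eq_nil_or_concat (u :: l₁') with h | ⟨l, v, h⟩
    · cases h
    · exact ⟨l, v, by simpa using h⟩
  have hl₁' : l₁'.length = p := by simpa using h₂
  have hl₀ : l₀.length = p := by have := congrArg List.length hv; simp at this; omega
  rw [slot_mk _ r (p + 1) m l₃ h₁ h₂, DD_delta H φ h₂ rfl hv]
  have hlin := (wmk_isWordMap H.η ρ).lin_letter m l₁ l₃
  have hadd := fun x y => hlin.map_add x y
  rw [hadd, hadd]
  have e₁ : slot ρ r 2 (prod_isSlotMap H.η) (slot ρ (r + 1) p (H.DD_isSlotMap φ)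
      (wmk H.η ρ m (l₁ ++ (u :: l₁' ++ l₃)))) =
      wmk H.η ρ m (l₁ ++ (u * H.DD φ l₁') :: l₃) := by
    have a := slot_mk (ρ := ρ) (H.DD_isSlotMap φ) (r + 1) p m (l₁ := l₁ ++ [u]) l₃
      (by simp [h₁]) hl₁'
    have b := slot_mk (ρ := ρ) (prod_isSlotMap H.η) r 2 m (l₂ := [u, H.DD φ l₁']) l₃ h₁ rfl
    simp at a b
    rw [List.cons_append, a, b]
  have e₂ : slot ρ r 2 (prod_isSlotMap H.η) (slot ρ r p (H.DD_isSlotMap φ)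
      (wmk H.η ρ m (l₁ ++ (u :: l₁' ++ l₃)))) =
      wmk H.η ρ m (l₁ ++ (H.DD φ l₀ * v) :: l₃) := by
    have a := slot_mk (ρ := ρ) (H.DD_isSlotMap φ) r p m (l₁ := l₁) (v :: l₃) h₁ hl₀
    have b := slot_mk (ρ := ρ) (prod_isSlotMap H.η) r 2 m (l₂ := [H.DD φ l₀, v]) l₃ h₁ rfl
    simp at a b
    rw [hv, List.append_assoc, List.cons_append, List.nil_append, a, b]
  rw [e₁, e₂]
  have hsmul := fun (c : ℤ) x => map_zsmul hlin.mk' c x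
  simp only [IsLinearMap.mk'_apply] at hsmul
  congr 2
  · refine (map_sum hlin.mk' _ _).trans (Finset.sum_congr rfl fun i hi => ?_)
    rw [Finset.mem_Icc] at hi
    rw [IsLinearMap.mk'_apply, hsmul]
    congr 1
    obtain ⟨a, b, c, hw, ha, hb⟩ := split_word (l := u :: l₁') (r := i - 1) (q := 2) (by omega)
    have e := slot_mk (ρ := ρ) (prod_isSlotMap H.η) (r + (i - 1)) 2 m (l₁ := l₁ ++ a)
      (c ++ l₃) (by simp [h₁, ha]) hb
    have e' := slot_mk (ρ := ρ) (H.DD_isSlotMap φ) r p m (l₁ := l₁) (l₂ := a ++ b.prod :: c) l₃ h₁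
      (by have := congrArg List.length hw; simp at this ⊢; omega)
    rw [show i + 1 = (i - 1) + 2 by omega, ← ha, hw]
    rw [← ha] at e
    simp only [List.append_assoc, List.cons_append] at e e' ⊢
    rw [e, e']
    simp [← hb, ← List.drop_drop]
  · exact hsmul _ _

/-- The simplicial relation `d₀ d₁ = d₀ d₀`, from the axiom `ε(u t(ε(v))) = ε(uv)`. -/
theorem cap_counit_merge {ρ : A →ₐ[k] Module.End k M} {n : ℕ} {x : Words H.η ρ}
    (hx : x ∈ homog H.η ρ (n + 2)) :
    cap ρ H.counitCochain (slot ρ n 2 (prod_isSlotMap H.η) x) =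
      cap ρ H.counitCochain (cap ρ H.counitCochain x) := by
  refine homog_ext (f := cap ρ H.counitCochain ∘ₗ slot ρ n 2 (prod_isSlotMap H.η))
    (g := cap ρ H.counitCochain ∘ₗ cap ρ H.counitCochain) (fun m l hl => ?_) hx
  obtain ⟨l₁, l₂, rfl, h₁⟩ := split_word₂ (l := l) (r := n) (by omega)
  obtain ⟨u, v, rfl⟩ := List.length_eq_two.1 (by simp at hl; omega : l₂.length = 2)
  have e := slot_mk (ρ := ρ) (prod_isSlotMap H.η) n 2 m (l₂ := [u, v]) [] h₁ rfl
  have e₁ := cap_mk (ρ := ρ) H.counitCochain m (l₁ ++ [u]) (l₂ := [v]) rfl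
  have e₂ := act_mk_concat (η := H.η) (ρ := ρ) (H.ε v) m l₁ u
  simp only [List.append_nil, List.append_assoc, List.cons_append, List.nil_append, List.prod_cons,
    List.prod_nil, mul_one] at e e₁
  simp only [LinearMap.comp_apply]
  rw [e, e₁, cap_mk H.counitCochain m l₁ (l₂ := [u * v]) rfl]
  change act _ _ (H.ε (u * v)) _ = cap ρ H.counitCochain (act _ _ (H.ε v) _)
  rw [e₂, cap_mk H.counitCochain m l₁ (l₂ := [u * tgt H.η (H.ε v)]) rfl, ← H.ε_mul_tgt]
  rfl

variable {φ}

theorem slot_DD_degen (hφ : IsReduced φ) {r j : ℕ} (h₁ : r ≤ j) (h₂ : j < r + p)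
    (x : Words H.η ρ) :
    slot ρ r p (H.DD_isSlotMap φ) (slot ρ j 0 (prod_isSlotMap H.η) x) = 0 := by
  suffices h : slot ρ r p (H.DD_isSlotMap φ) * slot ρ j 0 (prod_isSlotMap H.η) = 0 from
    LinearMap.congr_fun h x
  refine wext fun m l => ?_
  rw [Module.End.mul_apply, LinearMap.zero_apply]
  by_cases h : j ≤ l.length
  · obtain ⟨a, b, rfl, ha⟩ := split_word₂ h
    have e := slot_mk (ρ := ρ) (prod_isSlotMap H.η) j 0 m (l₂ := []) b ha rfl
    simp only [List.nil_append, List.prod_nil] at e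
    rw [e]
    by_cases hl : r + p ≤ (a ++ 1 :: b).length
    · obtain ⟨a₁, a₂, rfl, ha₁⟩ := split_word₂ (l := a) (r := r) (by omega)
      obtain ⟨b₁, b₂, rfl, hb₁⟩ := split_word₂ (l := b) (r := r + p - j - 1)
        (by simp at hl ha; omega)
      have e' := slot_mk (ρ := ρ) (H.DD_isSlotMap φ) r p m (l₂ := a₂ ++ 1 :: b₁) b₂ ha₁
        (by simp at hl ha ⊢; omega)
      simp only [List.append_assoc, List.cons_append] at e' ⊢
      rw [e', DD_eq_zero hφ]
      exact ((wmk_isWordMap H.η ρ).lin_letter m a₁ b₂).map_zero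
    · exact slot_mk_of_lt _ _ _ _ (by omega)
  · rw [slot_mk_of_lt _ _ _ _ (by omega), map_zero]

theorem cap_degen (hφ : IsReduced φ) {n r : ℕ} (h₁ : n < r + p) (h₂ : r ≤ n) {x : Words H.η ρ}
    (hx : x ∈ homog H.η ρ n) : cap ρ φ (slot ρ r 0 (prod_isSlotMap H.η) x) = 0 := by
  have hx' := slot_mem (r := r) (q := 0) (prod_isSlotMap H.η) (by omega) hx
  by_cases h : p ≤ n + 1
  · rw [cap_eq_cap_counit φ (by omega) hx', slot_DD_degen hφ (by omega) (by omega), map_zero]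
  · exact cap_eq_zero φ (by omega) hx'

theorem pairing_degen (hφ : IsReduced φ) (r : ℕ) (z : Words H.η (Algebra.lmul k A)) :
    H.pairing φ (slot (Algebra.lmul k A) r 0 (prod_isSlotMap H.η) z) = 0 := by
  suffices h : H.pairing φ ∘ₗ slot (Algebra.lmul k A) r 0 (prod_isSlotMap H.η) = 0 from
    LinearMap.congr_fun h z
  refine wext fun w l => ?_
  by_cases h : r ≤ l.length
  · obtain ⟨l₁, l₂, rfl, h₁⟩ := split_word₂ h
    have e := slot_mk (ρ := Algebra.lmul k A) (prod_isSlotMap H.η) r 0 w (l₂ := []) l₂ h₁ rfl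
    simp only [List.nil_append, List.prod_nil] at e
    rw [LinearMap.comp_apply, e, pairing_mk, hφ, zero_mul]
    rfl
  · rw [LinearMap.comp_apply, slot_mk_of_lt _ _ _ _ (by omega)]
    simp

theorem delta_isReduced (hφ : IsReduced φ) : IsReduced (H.delta φ) := by
  intro l₁ l₂
  by_cases hl : l₁.length + l₂.length = p
  swap
  · exact (H.delta φ).off _ (by simp; omega)
  change H.deltaFun φ _ = 0
  rw [deltaFun_eq _ _ _ (by simp; omega)]
  set z := wmk H.η (Algebra.lmul k A) 1 (l₁ ++ l₂) with hz
  have hzm : z ∈ homog H.η (Algebra.lmul k A) p := wmk_mem_homog _ (by simpa using hl)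
  have hzp : H.pairing φ z = φ.toFun (l₁ ++ l₂) := by rw [hz, pairing_mk, mul_one]
  have e := slot_mk (ρ := Algebra.lmul k A) (prod_isSlotMap H.η) l₁.length 0 1 (l₂ := []) l₂ rfl rfl
  simp only [List.nil_append, List.prod_nil] at e
  rw [← e, ← hz, deltaAux]
  simp only [LinearMap.add_apply, LinearMap.sum_apply, LinearMap.smul_apply, LinearMap.comp_apply]
  set r := l₁.length with hr
  set f := φ.toFun (l₁ ++ l₂) with hf
  -- With `r` letters in front of the unit, only its merges with its neighbours, `i = r` and `i = r
  -- + 1`, remove it. They contribute opposite signs; every other merge leaves a unit among the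
  -- arguments of `φ`.
  have hterm : ∀ i ∈ Finset.Icc 1 p, (-1 : ℤ) ^ i • H.pairing φ
      (slot (Algebra.lmul k A) (i - 1) 2 (prod_isSlotMap H.η)
        (slot (Algebra.lmul k A) r 0 (prod_isSlotMap H.η) z)) =
      (if i = r then (-1 : ℤ) ^ r • f else 0) + if i = r + 1 then (-1 : ℤ) ^ (r + 1) • f else 0 := by
    intro i hi
    rw [Finset.mem_Icc] at hi
    rcases lt_trichotomy i r with h | h | h
    · rw [if_neg (by omega), if_neg (by omega)]
      have := slot_slot (ρ := Algebra.lmul k A) (prod_isSlotMap H.η) (prod_isSlotMap H.η)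
        (r := i - 1) (r' := r - 2) 2 0 (by omega) z
      rw [show r - 2 + 2 = r by omega] at this
      rw [this, pairing_degen hφ]
      simp
    · have := merge_degen_right (r := i - 1) (by omega) hzm
      rw [show i - 1 + 1 = r by omega] at this
      rw [this, if_pos h, if_neg (by omega), hzp, h, add_zero]
    · rcases Nat.eq_or_lt_of_le h with h | h
      · have := merge_degen_left (r := r) (by omega) hzm
        rw [show i - 1 = r by omega, this, if_neg (by omega), if_pos (by omega), hzp, zero_add, ← h]
      · rw [if_neg (by omega), if_neg (by omega)]
        have := slot_slot (ρ := Algebra.lmul k A) (prod_isSlotMap H.η) (prod_isSlotMap H.η)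
          (r := r) (r' := i - 2) 0 2 (by omega) z
        rw [show i - 2 + 1 = i - 1 by omega] at this
        rw [← this, pairing_degen hφ]
        simp
  rw [Finset.sum_congr rfl hterm, Finset.sum_add_distrib, Finset.sum_ite_eq', Finset.sum_ite_eq']
  simp only [Finset.mem_Icc]
  have hhead : H.headTerm φ (l₁ ++ 1 :: l₂) = if r = 0 then f else 0 := by
    rcases l₁ with _ | ⟨u, l₁⟩
    · simp [headTerm, hr, hf, ε_src]
    · have := hφ l₁ l₂
      simp [headTerm, hr, this, ← srcHom_apply]
  have hlast : H.pairing φ (cap (Algebra.lmul k A) H.counitCochain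
      (slot (Algebra.lmul k A) r 0 (prod_isSlotMap H.η) z)) = if r = p then f else 0 := by
    split_ifs with h
    · rw [h, cap_counit_degen hzm, hzp]
    · rw [cap_slot (prod_isSlotMap H.η) H.counitCochain (by omega) hzm, pairing_degen hφ]
  rw [hhead, hlast]
  -- For a unit in the interior the two merges cancel. For `r = 0` the head term replaces the
  -- missing merge, for `r = p` the last term does, and for `r = p = 0` these two cancel each other.
  have hrp : r ≤ p := by omega
  rcases Nat.eq_zero_or_pos r with h | h
  · rw [if_pos h, if_neg (by omega), h]
    rcases Nat.eq_zero_or_pos p with h' | h'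
    · simp [h']
    · rw [if_pos (by omega), if_neg (by omega)]
      simp
  · rw [if_neg (by omega), if_pos (by omega)]
    rcases Nat.eq_or_lt_of_le hrp with h' | h'
    · rw [if_neg (by omega), if_pos h', h', pow_succ]
      simp
    · rw [if_pos (by omega), if_neg (by omega), pow_succ]
      simp

end Insertion

end HopfAlgd

namespace HopfAlgd

/-! ### The relations of the paracyclic module -/

section Paracyclic

open LeftHopfAlgebroid LeftBialgebroid

variable {k A U : Type*} [CommRing k] [Ring A] [Algebra k A] [Ring U] [Algebra k U]
  {M : Type*} [AddCommGroup M] [Module k M] [Module Uᵐᵒᵖ M] [IsScalarTower k Uᵐᵒᵖ M]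
  {H : LeftHopfAlgebroid k A U}

theorem face_zero (n : ℕ) : face H.toLeftBialgebroid M n 0 =
    cap (modAct H.η M) H.counitCochain := if_pos rfl

theorem face_last {n : ℕ} (h : 1 ≤ n) : face H.toLeftBialgebroid M n n =
    lastFace H.toLeftBialgebroid M := by rw [face, if_neg (by omega), if_pos rfl]

theorem face_inner {n i : ℕ} (h : 1 ≤ i) (h' : i < n) : face H.toLeftBialgebroid M n i =
    slot (modAct H.η M) (n - i - 1) 2 (prod_isSlotMap H.η) := by
  rw [face, if_neg (by omega), if_neg (by omega)]

theorem face_mem {n i : ℕ} (h : i ≤ n + 1) {x : Chains H.toLeftBialgebroid M}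
    (hx : x ∈ homog H.η (modAct H.η M) (n + 1)) :
    face H.toLeftBialgebroid M (n + 1) i x ∈ homog H.η (modAct H.η M) n := by
  rcases Nat.eq_zero_or_pos i with rfl | hi
  · rw [face_zero]
    have := cap_mem H.counitCochain (by omega) hx
    rwa [Nat.add_sub_cancel] at this
  rcases Nat.eq_or_lt_of_le h with rfl | h
  · rw [face_last (by omega)]
    exact lastFace_mem hx
  · rw [face_inner hi h]
    have := slot_mem (r := n + 1 - i - 1) (q := 2) (prod_isSlotMap H.η) (by omega) hx
    rwa [show n + 1 + 1 - 2 = n by omega] at this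

theorem face_lastFace {n j : ℕ} (h : j ≤ n) (hn : 1 ≤ n) {x : Chains H.toLeftBialgebroid M}
    (hx : x ∈ homog H.η (modAct H.η M) (n + 1)) :
    face H.toLeftBialgebroid M n j (lastFace H.toLeftBialgebroid M x) =
      lastFace H.toLeftBialgebroid M (face H.toLeftBialgebroid M (n + 1) j x) := by
  rcases Nat.eq_zero_or_pos j with rfl | hj
  · rw [face_zero, face_zero, lastFace_cap _ (by omega) hx]
  rcases Nat.eq_or_lt_of_le h with rfl | h
  · rw [face_last hn, face_inner hj (by omega), show j + 1 - j - 1 = 0 by omega,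
      lastFace_merge (by omega) hx]
  · rw [face_inner hj h, face_inner hj (by omega), show n + 1 - j - 1 = n - j - 1 + 1 by omega,
      lastFace_slot _ (by omega) hx]

variable (C : ModuleComodule H.toLeftBialgebroid M)

/-- `s_n` puts a unit directly behind `m`; `coextra` leaves it there and the last face absorbs it.
-/
theorem extraDegen_eq : extraDegen C = coextra C := by
  refine wext fun m l => ?_
  rw [extraDegen, gr_mk, Module.End.mul_apply, degen, Nat.sub_self, cyc_apply,
    coextra_slot C _ (prod_transCompat H 0) (by omega) (wmk_mem_homog m rfl), lastFace_degen]

theorem cyc_mem {n : ℕ} {x : Chains H.toLeftBialgebroid M}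
    (hx : x ∈ homog H.η (modAct H.η M) n) : cyc C x ∈ homog H.η (modAct H.η M) n :=
  lastFace_mem (coextra_mem C hx)

theorem cyc_pow_mem {n : ℕ} (j : ℕ) {x : Chains H.toLeftBialgebroid M}
    (hx : x ∈ homog H.η (modAct H.η M) n) : (cyc C ^ j) x ∈ homog H.η (modAct H.η M) n := by
  induction j with
  | zero => exact hx
  | succ j ih => rw [pow_succ', Module.End.mul_apply]; exact cyc_mem C ih

/-- The only position change comes from the last face, which removes the first letter and so shifts
every later block by one. -/
theorem cyc_slot {f : List U → U} (hf : IsSlotMap (k := k) H.η f) {n r q : ℕ}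
    (hc : TransCompat H q f) (h : r + 1 + q ≤ n) {x : Chains H.toLeftBialgebroid M}
    (hx : x ∈ homog H.η (modAct H.η M) n) :
    cyc C (slot (modAct H.η M) (r + 1) q hf x) = slot (modAct H.η M) r q hf (cyc C x) := by
  rw [cyc_apply, coextra_slot C hf hc h hx, lastFace_slot hf (by omega) (coextra_mem C hx),
    cyc_apply]

theorem cyc_pow_slot {f : List U → U} (hf : IsSlotMap (k := k) H.η f) {n r q : ℕ}
    (hc : TransCompat H q f) (j : ℕ) (h : r + j + q ≤ n) {x : Chains H.toLeftBialgebroid M}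
    (hx : x ∈ homog H.η (modAct H.η M) n) :
    (cyc C ^ j) (slot (modAct H.η M) (r + j) q hf x) =
      slot (modAct H.η M) r q hf ((cyc C ^ j) x) := by
  induction j generalizing r with
  | zero => rfl
  | succ j ih =>
    rw [pow_succ', Module.End.mul_apply, show r + (j + 1) = r + 1 + j by omega,
      ih (r := r + 1) (by omega), cyc_slot C hf hc (by omega) (cyc_pow_mem C j hx),
      Module.End.mul_apply]

theorem cyc_degen_zero {n : ℕ} {x : Chains H.toLeftBialgebroid M}
    (hx : x ∈ homog H.η (modAct H.η M) n) :
    cyc C (slot (modAct H.η M) 0 0 (prod_isSlotMap H.η) x) = coextra C x := by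
  rw [cyc_apply, coextra_slot C _ (prod_transCompat H 0) (by omega) hx, lastFace_degen]

theorem coextra_coextra' {n : ℕ} {x : Chains H.toLeftBialgebroid M}
    (hx : x ∈ homog H.η (modAct H.η M) n) : coextra C (coextra C x) =
      slot (modAct H.η M) (n + 1) 0 (prod_isSlotMap H.η) (coextra C x) := by
  rw [coextra_coextra, app_one_eq_degen (coextra_mem C hx)]

theorem cyc_coextra {n : ℕ} {x : Chains H.toLeftBialgebroid M}
    (hx : x ∈ homog H.η (modAct H.η M) n) : cyc C (coextra C x) =
      slot (modAct H.η M) n 0 (prod_isSlotMap H.η) (cyc C x) := by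
  rw [cyc_apply, coextra_coextra' C hx, lastFace_slot _ (by omega) (coextra_mem C hx), cyc_apply]

/-- After one rotation the extra degeneracy has become an ordinary one at the end, and further
rotations carry its unit towards the front. Thus `t J, …, tⁿ⁺¹ J` are all degenerate. -/
theorem cyc_pow_coextra {n j : ℕ} (h : j ≤ n) {x : Chains H.toLeftBialgebroid M}
    (hx : x ∈ homog H.η (modAct H.η M) n) : (cyc C ^ (j + 1)) (coextra C x) =
      slot (modAct H.η M) (n - j) 0 (prod_isSlotMap H.η) ((cyc C ^ (j + 1)) x) := by
  rw [pow_succ, Module.End.mul_apply, cyc_coextra C hx, Module.End.mul_apply,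
    ← cyc_pow_slot C _ (prod_transCompat H 0) (r := n - j) j (by omega) (cyc_mem C hx),
    show n - j + j = n by omega]

theorem face_coextra {n i : ℕ} (h : i < n) {x : Chains H.toLeftBialgebroid M}
    (hx : x ∈ homog H.η (modAct H.η M) n) :
    face H.toLeftBialgebroid M (n + 1) (i + 1) (coextra C x) =
      coextra C (face H.toLeftBialgebroid M n i x) := by
  rw [face_inner (by omega) (by omega)]
  rcases Nat.eq_zero_or_pos i with rfl | hi
  · obtain ⟨n, rfl⟩ : ∃ n', n = n' + 1 := ⟨n - 1, by omega⟩
    rw [face_zero, coextra_cap_counit C hx]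
    rfl
  · rw [face_inner hi h, coextra_slot C _ (prod_transCompat H 2) (by omega) hx]
    congr 2
    omega

theorem face_cyc {n i : ℕ} (h : i < n) {x : Chains H.toLeftBialgebroid M}
    (hx : x ∈ homog H.η (modAct H.η M) n) :
    face H.toLeftBialgebroid M n (i + 1) (cyc C x) = cyc C (face H.toLeftBialgebroid M n i x) := by
  rw [cyc_apply, face_lastFace (by omega) (by omega) (coextra_mem C hx), face_coextra C h hx,
    cyc_apply]

theorem face_zero_cyc {n : ℕ} (h : 1 ≤ n) {x : Chains H.toLeftBialgebroid M}
    (hx : x ∈ homog H.η (modAct H.η M) n) :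
    face H.toLeftBialgebroid M n 0 (cyc C x) = face H.toLeftBialgebroid M n n x := by
  rw [cyc_apply, face_lastFace (by omega) h (coextra_mem C hx), face_zero, cap_counit_coextra,
    face_last h]

/-- The operator `T` on chains of degree `n`. -/
theorem cycT_apply {n : ℕ} {x : Chains H.toLeftBialgebroid M}
    (hx : x ∈ homog H.η (modAct H.η M) n) : cycT C x = (cyc C ^ (n + 1)) x := gr_apply _ hx

theorem cycT_mem {n : ℕ} {x : Chains H.toLeftBialgebroid M}
    (hx : x ∈ homog H.η (modAct H.η M) n) : cycT C x ∈ homog H.η (modAct H.η M) n := by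
  rw [cycT_apply C hx]
  exact cyc_pow_mem C _ hx

theorem pow_apply_add {Z : Type*} [AddCommGroup Z] [Module k Z] (f : Module.End k Z) (i j : ℕ)
    (x : Z) : (f ^ i) ((f ^ j) x) = (f ^ (i + j)) x := by
  rw [pow_add, Module.End.mul_apply]

theorem face_cyc_pow {n i : ℕ} (j : ℕ) (h : i + j ≤ n) {x : Chains H.toLeftBialgebroid M}
    (hx : x ∈ homog H.η (modAct H.η M) n) :
    face H.toLeftBialgebroid M n (i + j) ((cyc C ^ j) x) =
      (cyc C ^ j) (face H.toLeftBialgebroid M n i x) := by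
  induction j with
  | zero => rfl
  | succ j ih =>
    rw [pow_succ', Module.End.mul_apply, ← add_assoc, face_cyc C (by omega) (cyc_pow_mem C j hx),
      ih (by omega), Module.End.mul_apply]

/-- Split `T` in degree `n + 1` as `tⁱ · t · tⁿ⁺¹⁻ⁱ`. Then `d_i tⁱ = tⁱ d₀`, next `d₀ t = d_{n+1}`,
and finally `d_{n+1} tⁿ⁺¹⁻ⁱ = tⁿ⁺¹⁻ⁱ d_i`. -/
theorem face_cycT {n i : ℕ} (h : i ≤ n + 1) {x : Chains H.toLeftBialgebroid M}
    (hx : x ∈ homog H.η (modAct H.η M) (n + 1)) :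
    face H.toLeftBialgebroid M (n + 1) i (cycT C x) =
      cycT C (face H.toLeftBialgebroid M (n + 1) i x) := by
  rw [cycT_apply C hx, cycT_apply C (face_mem h hx)]
  have e : n + 1 + 1 = i + (1 + (n + 1 - i)) := by omega
  have h₁ := face_cyc_pow C (n := n + 1) (i := 0) i (by omega)
    (cyc_pow_mem C (1 + (n + 1 - i)) hx)
  rw [zero_add] at h₁
  rw [e, pow_add, Module.End.mul_apply, h₁, pow_add, Module.End.mul_apply, pow_one,
    face_zero_cyc C (by omega) (cyc_pow_mem C _ hx)]
  have h₂ := face_cyc_pow C (n := n + 1) (i := i) (n + 1 - i) (by omega) hx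
  rw [show i + (n + 1 - i) = n + 1 by omega] at h₂
  rw [h₂, pow_apply_add, show i + (n + 1 - i) = n + 1 by omega]

theorem cyc_cycT {n : ℕ} {x : Chains H.toLeftBialgebroid M}
    (hx : x ∈ homog H.η (modAct H.η M) n) : cyc C (cycT C x) = cycT C (cyc C x) := by
  rw [cycT_apply C hx, cycT_apply C (cyc_mem C hx), ← Module.End.mul_apply, ← Module.End.mul_apply,
    ← pow_succ, ← pow_succ']

/-- In degree `n + 1`, `T J = t · tⁿ⁺¹ J = t s_n tⁿ⁺¹`, and `t s_n` is `J` again. -/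
theorem coextra_cycT {n : ℕ} {x : Chains H.toLeftBialgebroid M}
    (hx : x ∈ homog H.η (modAct H.η M) n) :
    coextra C (cycT C x) = cycT C (coextra C x) := by
  rw [cycT_apply C hx, cycT_apply C (coextra_mem C hx), pow_succ' (cyc C) (n + 1),
    Module.End.mul_apply, cyc_pow_coextra C le_rfl hx, Nat.sub_self,
    cyc_degen_zero C (cyc_pow_mem C _ hx)]

theorem degen_cycT {n r : ℕ} (h : r ≤ n) {x : Chains H.toLeftBialgebroid M}
    (hx : x ∈ homog H.η (modAct H.η M) n) :
    slot (modAct H.η M) r 0 (prod_isSlotMap H.η) (cycT C x) =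
      cycT C (slot (modAct H.η M) r 0 (prod_isSlotMap H.η) x) := by
  have hx' := slot_mem (r := r) (q := 0) (prod_isSlotMap H.η) (by omega) hx
  have e : n + 1 - 0 + 1 = (n - r + 1) + (1 + r) := by omega
  have h₁ := cyc_pow_slot C (prod_isSlotMap H.η) (prod_transCompat H 0) (r := 0) r (by omega) hx
  rw [zero_add] at h₁
  rw [cycT_apply C hx, cycT_apply C hx', e, pow_add (cyc C) (n - r + 1), Module.End.mul_apply,
    pow_add (cyc C) 1 r, Module.End.mul_apply, h₁, pow_one, cyc_degen_zero C (cyc_pow_mem C _ hx),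
    cyc_pow_coextra C (by omega) (cyc_pow_mem C _ hx), pow_apply_add]
  congr 3 <;> omega

end Paracyclic

end HopfAlgd

namespace HopfAlgd

/-! ### A summation by parts -/

section Summation

open Finset

variable {G : Type*} [AddCommGroup G] {K p : ℕ} {a c : ℕ → ℕ → G} {e : ℕ → G} (σ : ℤ)

/-- Here `a i j` stands for the `j`-th face of the `i`-th insertion, `c i j` for the `i`-th
insertion in the `j`-th face, and `e i` for the insertion of the differential. Below and above the
diagonal `i + j = K` the face misses the inserted block (`h₁`, `h₂`). On the diagonal it merges the
block with its right neighbour, and the corresponding left merge belongs to the insertion `i + 1`,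
so neighbouring insertions pair up by `h₃`. The diagonal term of the last insertion has no partner.
-/
theorem sum_faces_row {m : ℕ} (hm : m ≤ K)
    (h₁ : ∀ i j, i + j < K → a i j = σ • c i j)
    (h₂ : ∀ i j, i < K → K < i + j → j ≤ K → a (i + 1) j = σ • c i (j + p - 1))
    (h₃ : ∀ i, i < K → a (i + 1) (K - i) + a i (K - i) + e i =
      σ • ∑ j ∈ Ico (K - i) (K + p - i), c i j) :
    ∑ i ∈ range (m + 1), ∑ j ∈ range (K + 1), a i j + ∑ i ∈ range m, e i =
      a m (K - m) + σ • (∑ i ∈ range m, ∑ j ∈ range (K + p), c i j +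
        ∑ j ∈ range (K - m), c m j) := by
  have split : ∀ i ∈ range (m + 1), ∑ j ∈ range (K + 1), a i j =
      σ • ∑ j ∈ range (K - i), c i j + a i (K - i) + ∑ j ∈ Ico (K - i + 1) (K + 1), a i j := by
    intro i hi
    rw [mem_range] at hi
    rw [range_eq_Ico, ← sum_Ico_consecutive _ (Nat.zero_le (K - i + 1)) (by omega), ← range_eq_Ico,
      sum_range_succ, smul_sum]
    congr 2
    refine sum_congr rfl fun j hj => h₁ i j ?_
    rw [mem_range] at hj
    omega
  rw [sum_congr rfl split, sum_add_distrib, sum_range_succ, sum_range_succ']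
  have tail : ∀ i ∈ range m, ∑ j ∈ Ico (K - (i + 1) + 1) (K + 1), a (i + 1) j =
      a (i + 1) (K - i) + σ • ∑ j ∈ Ico (K + p - i) (K + p), c i j := by
    intro i hi
    rw [mem_range] at hi
    rw [show K - (i + 1) + 1 = K - i by omega, sum_eq_sum_Ico_succ_bot (by omega)]
    congr 1
    rw [sum_congr rfl fun j hj => h₂ i j (by omega) (by rw [mem_Ico] at hj; omega)
      (by rw [mem_Ico] at hj; omega), ← smul_sum]
    congr 1
    refine sum_bij' (fun j _ => j + p - 1) (fun j _ => j + 1 - p) ?_ ?_ ?_ ?_ ?_ <;>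
      intro j hj <;> simp only [mem_Ico] at hj ⊢ <;> omega
  rw [sum_congr rfl tail]
  have row : ∑ i ∈ range m, (σ • ∑ j ∈ range (K - i), c i j + a i (K - i)) +
      ∑ i ∈ range m, (a (i + 1) (K - i) + σ • ∑ j ∈ Ico (K + p - i) (K + p), c i j) +
      ∑ i ∈ range m, e i = σ • ∑ i ∈ range m, ∑ j ∈ range (K + p), c i j := by
    rw [← sum_add_distrib, ← sum_add_distrib, smul_sum]
    refine sum_congr rfl fun i hi => ?_
    rw [mem_range] at hi
    have h := h₃ i (by omega)
    rw [range_eq_Ico (K + p), ← sum_Ico_consecutive _ (Nat.zero_le (K - i)) (by omega : K - i ≤ K + p),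
      ← sum_Ico_consecutive (c i) (by omega : K - i ≤ K + p - i) (by omega), smul_add, smul_add,
      ← h, ← range_eq_Ico]
    abel
  rw [smul_add, ← row, Nat.sub_zero, Ico_self, sum_empty]
  abel

/-- Each row is cut at `j = r`. The parts `j < r` of row `r`, completed by the partial row `i = K -
r`, are reassigned to row `r - 1`, which is the shape in which `lam_pow_bOp` presents `λʳ b`. -/
theorem sum_cyclic_shift {n : ℕ} (hK : K ≤ n) (c : ℕ → ℕ → ℕ → G) :
    ∑ r ∈ range (K + 1), (∑ i ∈ range (K - r), ∑ j ∈ range n, c r i j +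
      ∑ j ∈ range r, c r (K - r) j) =
    ∑ r ∈ range K, ∑ i ∈ range (K - r), (∑ j ∈ Ico r n, c r i j +
      ∑ j ∈ range (r + 1), c (r + 1) i j) := by
  have h : ∀ r ∈ range (K + 1), ∑ i ∈ range (K - r), ∑ j ∈ range n, c r i j +
      ∑ j ∈ range r, c r (K - r) j = ∑ i ∈ range (K - r), ∑ j ∈ Ico r n, c r i j +
      ∑ i ∈ range (K - r + 1), ∑ j ∈ range r, c r i j := by
    intro r hr
    rw [mem_range] at hr
    rw [sum_range_succ _ (K - r), ← add_assoc, ← sum_add_distrib]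
    congr 1
    refine sum_congr rfl fun i hi => ?_
    rw [range_eq_Ico, ← sum_Ico_consecutive _ (Nat.zero_le r) (by omega), add_comm, ← range_eq_Ico]
  rw [sum_congr rfl h, sum_add_distrib, sum_range_succ, sum_range_succ']
  simp only [Nat.sub_self, range_zero, sum_empty, sum_const_zero, add_zero, sum_add_distrib]
  congr 1
  refine sum_congr rfl fun r hr => ?_
  rw [mem_range] at hr
  rw [show K - (r + 1) + 1 = K - r by omega]

end Summation

end HopfAlgd

namespace HopfAlgd

/-! ### The signed cyclic operator and the homotopy between faces -/

section Homotopy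

open LeftHopfAlgebroid LeftBialgebroid

variable {k A U : Type*} [CommRing k] [Ring A] [Algebra k A] [Ring U] [Algebra k U]
  {M : Type*} [AddCommGroup M] [Module k M] [Module Uᵐᵒᵖ M] [IsScalarTower k Uᵐᵒᵖ M]
  {H : LeftHopfAlgebroid k A U} (C : ModuleComodule H.toLeftBialgebroid M)

theorem zsmul_neg_one_pow {G : Type*} [AddCommGroup G] {a b : ℕ} (h : Even a ↔ Even b) (x : G) :
    (-1 : ℤ) ^ a • x = (-1 : ℤ) ^ b • x := by rw [neg_one_pow_congr h]

/-- The signed cyclic operator, `(-1)ⁿ t` in degree `n`. -/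
noncomputable def lam : Module.End k (Chains H.toLeftBialgebroid M) :=
  gr fun n => (-1 : ℤ) ^ n • cyc C

theorem lam_apply {n : ℕ} {x : Chains H.toLeftBialgebroid M}
    (hx : x ∈ homog H.η (modAct H.η M) n) : lam C x = (-1 : ℤ) ^ n • cyc C x := gr_apply _ hx

theorem lam_pow_apply {n : ℕ} (j : ℕ) {x : Chains H.toLeftBialgebroid M}
    (hx : x ∈ homog H.η (modAct H.η M) n) :
    (lam C ^ j) x = (-1 : ℤ) ^ (j * n) • (cyc C ^ j) x := by
  induction j with
  | zero => simp
  | succ j ih =>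
    rw [pow_succ', Module.End.mul_apply, ih, map_zsmul, lam_apply C (cyc_pow_mem C j hx),
      smul_smul, ← pow_add, pow_succ', Module.End.mul_apply, add_mul, one_mul]

theorem lam_pow_mem {n : ℕ} (j : ℕ) {x : Chains H.toLeftBialgebroid M}
    (hx : x ∈ homog H.η (modAct H.η M) n) :
    (lam C ^ j) x ∈ homog H.η (modAct H.η M) n := by
  rw [lam_pow_apply C j hx]
  exact zsmul_mem_homog _ (cyc_pow_mem C j hx)

/-- The signed face operator `(-1)ʲ d_j` in degree `n`. -/
noncomputable def sface (H : LeftHopfAlgebroid k A U) (M : Type*) [AddCommGroup M] [Module k M]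
    [Module Uᵐᵒᵖ M] [IsScalarTower k Uᵐᵒᵖ M] (n j : ℕ) :
    Module.End k (Chains H.toLeftBialgebroid M) :=
  (-1 : ℤ) ^ j • face H.toLeftBialgebroid M n j

theorem sface_apply (n j : ℕ) (x : Chains H.toLeftBialgebroid M) :
    sface H M n j x = (-1 : ℤ) ^ j • face H.toLeftBialgebroid M n j x := rfl

theorem sface_mem {n i : ℕ} (h : i ≤ n + 1) {x : Chains H.toLeftBialgebroid M}
    (hx : x ∈ homog H.η (modAct H.η M) (n + 1)) :
    sface H M (n + 1) i x ∈ homog H.η (modAct H.η M) n :=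
  zsmul_mem_homog _ (face_mem h hx)

/-- The signs in `lam` and `sface` are chosen so that this relation, like `sface_last` and
`lam_ins`, carries no sign. -/
theorem lam_sface {n j : ℕ} (h : j < n) {x : Chains H.toLeftBialgebroid M}
    (hx : x ∈ homog H.η (modAct H.η M) n) :
    lam C (sface H M n j x) = sface H M n (j + 1) (lam C x) := by
  obtain ⟨n, rfl⟩ : ∃ n', n = n' + 1 := ⟨n - 1, by omega⟩
  rw [lam_apply C (sface_mem (by omega) hx), sface_apply, lam_apply C hx, map_zsmul, map_zsmul,
    sface_apply, face_cyc C h hx, smul_smul, smul_smul, ← pow_add, ← pow_add]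
  refine zsmul_neg_one_pow ?_ _
  grind

theorem lam_pow_sface {n i : ℕ} (j : ℕ) (h : i + j ≤ n) {x : Chains H.toLeftBialgebroid M}
    (hx : x ∈ homog H.η (modAct H.η M) n) :
    (lam C ^ j) (sface H M n i x) = sface H M n (i + j) ((lam C ^ j) x) := by
  induction j with
  | zero => rfl
  | succ j ih =>
    rw [pow_succ', Module.End.mul_apply, ih (by omega), lam_sface C (by omega) (lam_pow_mem C j hx),
      Module.End.mul_apply, add_assoc]

theorem sface_last {n : ℕ} (h : 1 ≤ n) {x : Chains H.toLeftBialgebroid M}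
    (hx : x ∈ homog H.η (modAct H.η M) n) : sface H M n n x = sface H M n 0 (lam C x) := by
  rw [sface_apply, sface_apply, lam_apply C hx, map_zsmul, face_zero_cyc C h hx, pow_zero, one_smul]

theorem bOp_apply {n : ℕ} {x : Chains H.toLeftBialgebroid M}
    (hx : x ∈ homog H.η (modAct H.η M) n) :
    bOp H.toLeftBialgebroid M x = ∑ j ∈ Finset.range (n + 1), sface H M n j x := by
  rw [bOp, gr_apply _ hx, LinearMap.sum_apply]
  rfl

theorem bOp_zero {x : Chains H.toLeftBialgebroid M} (hx : x ∈ homog H.η (modAct H.η M) 0) :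
    bOp H.toLeftBialgebroid M x = 0 := by
  rw [bOp_apply hx, Finset.sum_range_one, sface_apply, face_zero,
    cap_eq_zero H.counitCochain (by omega) hx, smul_zero]

theorem bOp_mem {n : ℕ} {x : Chains H.toLeftBialgebroid M}
    (hx : x ∈ homog H.η (modAct H.η M) (n + 1)) :
    bOp H.toLeftBialgebroid M x ∈ homog H.η (modAct H.η M) n := by
  rw [bOp_apply hx]
  exact Submodule.sum_mem _ fun j hj => sface_mem (by rw [Finset.mem_range] at hj; omega) hx

/-- Each passage of `λ` raises the index of a face by one, and the top face wraps around to `d₀ λ`.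
After `r` passages the faces are sorted by whether they have wrapped. -/
theorem lam_pow_bOp {n r : ℕ} (h : r < n) {x : Chains H.toLeftBialgebroid M}
    (hx : x ∈ homog H.η (modAct H.η M) n) :
    (lam C ^ r) (bOp H.toLeftBialgebroid M x) =
      ∑ j ∈ Finset.Ico r n, sface H M n j ((lam C ^ r) x) +
      ∑ j ∈ Finset.range (r + 1), sface H M n j ((lam C ^ (r + 1)) x) := by
  induction r with
  | zero =>
    rw [bOp_apply hx, Finset.sum_range_succ, Finset.sum_range_one, ← Finset.range_eq_Ico,
      sface_last C h hx, zero_add, pow_one]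
    rfl
  | succ r ih =>
    rw [pow_succ', Module.End.mul_apply, ih (by omega), map_add, map_sum, map_sum,
      Finset.sum_range_succ' _ (r + 1)]
    have e₁ : ∑ j ∈ Finset.Ico r n, lam C (sface H M n j ((lam C ^ r) x)) =
        ∑ j ∈ Finset.Ico (r + 1) n, sface H M n j ((lam C ^ (r + 1)) x) +
          sface H M n 0 ((lam C ^ (r + 1 + 1)) x) := by
      rw [pow_succ' _ (r + 1), Module.End.mul_apply, ← sface_last C (by omega) (lam_pow_mem C _ hx),
        ← Finset.sum_Ico_succ_top (by omega), ← Finset.sum_Ico_add' _ r n 1]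
      refine Finset.sum_congr rfl fun j hj => ?_
      rw [Finset.mem_Ico] at hj
      rw [lam_sface C (by omega) (lam_pow_mem C r hx), pow_succ', Module.End.mul_apply]
    have e₂ : ∑ j ∈ Finset.range (r + 1), lam C (sface H M n j ((lam C ^ (r + 1)) x)) =
        ∑ j ∈ Finset.range (r + 1), sface H M n (j + 1) ((lam C ^ (r + 1 + 1)) x) := by
      refine Finset.sum_congr rfl fun j hj => ?_
      rw [Finset.mem_range] at hj
      rw [lam_sface C (by omega) (lam_pow_mem C _ hx), pow_succ' _ (r + 1), Module.End.mul_apply]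
    rw [e₁, e₂, ← pow_succ' (lam C) r]
    abel

variable {p : ℕ} (φ : Cochain (k := k) H.η p)

/-- The operator `D_φ^{(r+1)-th}`, with the sign that makes it commute with the signed cyclic
operator. -/
noncomputable def ins (M : Type*) [AddCommGroup M] [Module k M]
    [Module Uᵐᵒᵖ M] [IsScalarTower k Uᵐᵒᵖ M] (n r : ℕ) :
    Module.End k (Chains H.toLeftBialgebroid M) :=
  (-1 : ℤ) ^ ((p + 1) * (n + r)) • slot (modAct H.η M) r p (H.DD_isSlotMap φ)

theorem ins_apply (n r : ℕ) (x : Chains H.toLeftBialgebroid M) : ins φ M n r x =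
    (-1 : ℤ) ^ ((p + 1) * (n + r)) • slot (modAct H.η M) r p (H.DD_isSlotMap φ) x := rfl

theorem ins_mem {n r N : ℕ} (h : r + p ≤ n) (hN : n + 1 = N + p) {x : Chains H.toLeftBialgebroid M}
    (hx : x ∈ homog H.η (modAct H.η M) n) : ins φ M n r x ∈ homog H.η (modAct H.η M) N := by
  have := slot_mem (H.DD_isSlotMap φ) h hx
  rw [show n + 1 - p = N by omega] at this
  exact zsmul_mem_homog _ this

theorem lam_ins {n r : ℕ} (h : r + 1 + p ≤ n) {x : Chains H.toLeftBialgebroid M}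
    (hx : x ∈ homog H.η (modAct H.η M) n) :
    lam C (ins φ M n (r + 1) x) = ins φ M n r (lam C x) := by
  obtain ⟨N, hN⟩ : ∃ N, n + 1 = N + p := ⟨n + 1 - p, by omega⟩
  rw [lam_apply C (ins_mem φ h hN hx), lam_apply C hx, map_zsmul, ins_apply, ins_apply, map_zsmul,
    cyc_slot C _ (DD_transCompat H φ p) h hx, smul_smul, smul_smul, ← pow_add, ← pow_add]
  refine zsmul_neg_one_pow ?_ _
  have : Even (n + 1) ↔ Even (N + p) := by rw [hN]
  simp only [Nat.even_add, Nat.even_mul, Nat.not_even_one, iff_false] at this ⊢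
  tauto

theorem lam_pow_ins {n r : ℕ} (j : ℕ) (h : r + j + p ≤ n) {x : Chains H.toLeftBialgebroid M}
    (hx : x ∈ homog H.η (modAct H.η M) n) :
    (lam C ^ j) (ins φ M n (r + j) x) = ins φ M n r ((lam C ^ j) x) := by
  induction j generalizing r with
  | zero => rfl
  | succ j ih =>
    rw [pow_succ', Module.End.mul_apply, show r + (j + 1) = r + 1 + j by omega, ih (by omega),
      lam_ins C φ (by omega) (lam_pow_mem C j hx), Module.End.mul_apply]

/-- Faces are counted from the right, so `i + j < K` means that the face acts to the right of the
inserted block and keeps its index. -/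
theorem sface_ins_of_lt {K i j : ℕ} (h : i + j < K) {x : Chains H.toLeftBialgebroid M}
    (hx : x ∈ homog H.η (modAct H.η M) (K + p)) :
    sface H M (K + 1) j (ins φ M (K + p) i x) =
      (-1 : ℤ) ^ (p + 1) • ins φ M (K + p - 1) i (sface H M (K + p) j x) := by
  have e : face H.toLeftBialgebroid M (K + 1) j (slot (modAct H.η M) i p (H.DD_isSlotMap φ) x) =
      slot (modAct H.η M) i p (H.DD_isSlotMap φ) (face H.toLeftBialgebroid M (K + p) j x) := by
    rcases Nat.eq_zero_or_pos j with rfl | hj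
    · rw [face_zero, face_zero, cap_slot _ _ (by omega) hx]
    · rw [face_inner hj (by omega), face_inner hj (by omega)]
      have := slot_slot (ρ := modAct H.η M) (H.DD_isSlotMap φ) (prod_isSlotMap H.η) (r := i)
        (r' := K - 1 - j) p 2 (by omega) x
      rw [show K + p - j - 1 = K - 1 - j + p by omega, this]
      congr 2
      omega
  rw [sface_apply, ins_apply, ins_apply, sface_apply, map_zsmul, map_zsmul, e, smul_smul, smul_smul,
    smul_smul, ← pow_add, ← pow_add, ← pow_add]
  refine zsmul_neg_one_pow ?_ _
  obtain ⟨K, rfl⟩ : ∃ K', K = K' + 1 := ⟨K - 1, by omega⟩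
  rw [show K + 1 + p - 1 = K + p by omega]
  simp only [Nat.even_add, Nat.even_mul, Nat.not_even_one, iff_false]
  tauto

/-- Here the face acts to the left of the block. Its index before the insertion is larger by `p -
1`, since `p` letters become one. -/
theorem sface_ins_of_gt {K i j : ℕ} (hi : i < K) (h : K < i + j) (hj : j ≤ K)
    {x : Chains H.toLeftBialgebroid M} :
    sface H M (K + 1) j (ins φ M (K + p) (i + 1) x) =
      (-1 : ℤ) ^ (p + 1) • ins φ M (K + p - 1) i (sface H M (K + p) (j + p - 1) x) := by
  have e : face H.toLeftBialgebroid M (K + 1) j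
      (slot (modAct H.η M) (i + 1) p (H.DD_isSlotMap φ) x) =
      slot (modAct H.η M) i p (H.DD_isSlotMap φ)
        (face H.toLeftBialgebroid M (K + p) (j + p - 1) x) := by
    rw [face_inner (by omega) (by omega), face_inner (by omega) (by omega)]
    have := slot_slot (ρ := modAct H.η M) (prod_isSlotMap H.η) (H.DD_isSlotMap φ) (r := K - j)
        (r' := i - 1) 2 p (by omega) x
    rw [show i - 1 + 2 = i + 1 by omega, show i - 1 + 1 = i by omega] at this
    rw [show K + 1 - j - 1 = K - j by omega, this]
    congr 3
    omega
  rw [sface_apply, ins_apply, ins_apply, sface_apply, map_zsmul, map_zsmul, e, smul_smul, smul_smul,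
    smul_smul, ← pow_add, ← pow_add, ← pow_add]
  refine zsmul_neg_one_pow ?_ _
  obtain ⟨K, rfl⟩ : ∃ K', K = K' + 1 := ⟨K - 1, by omega⟩
  obtain ⟨j, rfl⟩ : ∃ j', j = j' + 1 := ⟨j - 1, by omega⟩
  rw [show K + 1 + p - 1 = K + p by omega, show j + 1 + p - 1 = j + p by omega]
  simp only [Nat.even_add, Nat.even_mul, Nat.not_even_one, iff_false]
  tauto

theorem sum_slot_DD_merge {n i : ℕ} (h : i + p < n) (x : Chains H.toLeftBialgebroid M) :
    ∑ l ∈ Finset.Icc 1 p, (-1 : ℤ) ^ l • slot (modAct H.η M) i p (H.DD_isSlotMap φ)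
        (slot (modAct H.η M) (i + (l - 1)) 2 (prod_isSlotMap H.η) x) =
      ∑ j ∈ Finset.Ico (n - i - p) (n - i), (-1 : ℤ) ^ (n - i - j) •
        slot (modAct H.η M) i p (H.DD_isSlotMap φ) (face H.toLeftBialgebroid M n j x) := by
  refine Finset.sum_bij' (fun l _ => n - i - l) (fun j _ => n - i - j) ?_ ?_ ?_ ?_ ?_ <;>
    intro j hj <;> simp only [Finset.mem_Ico, Finset.mem_Icc] at hj ⊢ <;> try omega
  rw [face_inner (by omega) (by omega), show n - i - (n - i - j) = j by omega,
    show n - (n - i - j) - 1 = i + (j - 1) by omega]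

theorem zsmul_neg_one_pow_add {G : Type*} [AddCommGroup G] {a b : ℕ} (h : Even (a + b + 1))
    (y : G) : (-1 : ℤ) ^ a • y = -((-1 : ℤ) ^ b • y) := by
  rw [zsmul_neg_one_pow (b := b + 1), pow_succ, mul_neg_one, neg_smul]
  grind

/-- The signed form of `slot_DD_delta`: the two faces that merge the block with a neighbour cancel
the outer terms of `D_{δφ}`, and the merges inside the block remain. -/
theorem sface_ins_middle {K i : ℕ} (hi : i < K) {x : Chains H.toLeftBialgebroid M}
    (hx : x ∈ homog H.η (modAct H.η M) (K + p)) :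
    sface H M (K + 1) (K - i) (ins φ M (K + p) (i + 1) x) +
      sface H M (K + 1) (K - i) (ins φ M (K + p) i x) + ins (H.delta φ) M (K + p) i x =
      (-1 : ℤ) ^ (p + 1) • ∑ j ∈ Finset.Ico (K - i) (K + p - i),
        ins φ M (K + p - 1) i (sface H M (K + p) j x) := by
  have hsum := sum_slot_DD_merge φ (i := i) (n := K + p) (by omega) x
  rw [show K + p - i - p = K - i by omega] at hsum
  have eδ := slot_DD_delta φ (r := i) (by omega) hx
  rw [hsum] at eδ
  obtain ⟨d, rfl⟩ : ∃ d, K = i + d + 1 := ⟨K - i - 1, by omega⟩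
  have e₁ : sface H M (i + d + 1 + 1) (i + d + 1 - i) (ins φ M (i + d + 1 + p) (i + 1) x) =
      -((-1 : ℤ) ^ ((p + 1 + 1) * (i + d + 1 + p + i)) • slot (modAct H.η M) i 2
        (prod_isSlotMap H.η) (slot (modAct H.η M) (i + 1) p (H.DD_isSlotMap φ) x)) := by
    rw [sface_apply, ins_apply, map_zsmul, face_inner (by omega) (by omega),
      show i + d + 1 + 1 - (i + d + 1 - i) - 1 = i by omega, smul_smul, ← pow_add]
    refine zsmul_neg_one_pow_add ?_ _
    rw [show i + d + 1 - i = d + 1 by omega]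
    exact ⟨d + 1 + (p + 1) * (i + d + 1 + p + i) + i + 1 + p, by ring⟩
  have e₂ : sface H M (i + d + 1 + 1) (i + d + 1 - i) (ins φ M (i + d + 1 + p) i x) =
      -((-1 : ℤ) ^ ((p + 1 + 1) * (i + d + 1 + p + i)) • (-1 : ℤ) ^ (p + 1) •
        slot (modAct H.η M) i 2
        (prod_isSlotMap H.η) (slot (modAct H.η M) i p (H.DD_isSlotMap φ) x)) := by
    rw [sface_apply, ins_apply, map_zsmul, face_inner (by omega) (by omega),
      show i + d + 1 + 1 - (i + d + 1 - i) - 1 = i by omega, smul_smul, smul_smul, ← pow_add,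
      ← pow_add]
    refine zsmul_neg_one_pow_add ?_ _
    rw [show i + d + 1 - i = d + 1 by omega]
    exact ⟨d + 1 + (p + 1) * (i + d + 1 + p + i) + i + p + 1, by ring⟩
  have e₃ : ∀ {S : Chains H.toLeftBialgebroid M} (a b : Chains H.toLeftBialgebroid M),
      -a + -b + (a + (S + b)) = S := fun a b => by abel
  rw [e₁, e₂, ins_apply (H.delta φ), eδ, smul_add, smul_add, e₃, Finset.smul_sum, Finset.smul_sum]
  refine Finset.sum_congr rfl fun j hj => ?_
  rw [Finset.mem_Ico] at hj
  rw [ins_apply, sface_apply, map_zsmul, smul_smul, smul_smul, smul_smul, ← pow_add, ← pow_add,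
    ← pow_add]
  refine zsmul_neg_one_pow ?_ _
  obtain ⟨l, hl⟩ : ∃ l, i + d + 1 + p - i - j = l := ⟨_, rfl⟩
  have hjl : j + l = d + 1 + p := by omega
  rw [hl, show i + d + 1 + p - 1 = i + d + p by omega, ← Nat.even_add]
  refine ⟨(p + 1) * (i + d + 1 + p + i) + i + d + 1 + p, ?_⟩
  calc _ = (p + 1 + 1) * (i + d + 1 + p + i) + (p + 1 + (p + 1) * (i + d + p + i)) + (j + l) := by
        ring
    _ = _ := by rw [hjl]; ring

/-- The homotopy `∑ D_φ^{i-th} tʳ`, with signs. -/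
noncomputable def homotopy : Module.End k (Chains H.toLeftBialgebroid M) :=
  gr fun n => ∑ r ∈ Finset.range (n + 1 - p), ∑ i ∈ Finset.range (n + 1 - p - r),
    ins φ M n i * lam C ^ r

theorem homotopy_apply {n : ℕ} {x : Chains H.toLeftBialgebroid M}
    (hx : x ∈ homog H.η (modAct H.η M) n) : homotopy C φ x =
      ∑ r ∈ Finset.range (n + 1 - p), ∑ i ∈ Finset.range (n + 1 - p - r),
        ins φ M n i ((lam C ^ r) x) := by
  rw [homotopy, gr_apply _ hx]
  simp only [LinearMap.sum_apply, Module.End.mul_apply]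

theorem homotopy_mem {n N : ℕ} (hN : n + 1 = N + p) {x : Chains H.toLeftBialgebroid M}
    (hx : x ∈ homog H.η (modAct H.η M) n) :
    homotopy C φ x ∈ homog H.η (modAct H.η M) N := by
  rw [homotopy_apply C φ hx]
  refine Submodule.sum_mem _ fun r hr => Submodule.sum_mem _ fun i hi => ?_
  rw [Finset.mem_range] at hr hi
  exact ins_mem φ (by omega) hN (lam_pow_mem C r hx)

theorem normOp_apply {n : ℕ} {x : Chains H.toLeftBialgebroid M}
    (hx : x ∈ homog H.η (modAct H.η M) n) :
    normOp C x = ∑ r ∈ Finset.range (n + 1), (lam C ^ r) x := by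
  rw [normOp, gr_apply _ hx, LinearMap.sum_apply]
  exact Finset.sum_congr rfl fun r _ => (lam_pow_apply C r hx).symm

theorem normOp_mem {n : ℕ} {x : Chains H.toLeftBialgebroid M}
    (hx : x ∈ homog H.η (modAct H.η M) n) : normOp C x ∈ homog H.η (modAct H.η M) n := by
  rw [normOp_apply C hx]
  exact Submodule.sum_mem _ fun j _ => lam_pow_mem C j hx

/-- The unpaired diagonal term is `λʳ` of the face `d₀` of the insertion in the last place, and that
is `ι_φ`. -/
theorem sface_ins_diag {K r : ℕ} (hr : r ≤ K) {x : Chains H.toLeftBialgebroid M}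
    (hx : x ∈ homog H.η (modAct H.η M) (K + p)) :
    sface H M (K + 1) r (ins φ M (K + p) (K - r) ((lam C ^ r) x)) =
      (lam C ^ r) (iotaOp φ M x) := by
  have e := lam_pow_ins C φ (r := K - r) r (by omega) hx
  have e' := lam_pow_sface C (i := 0) r (by omega) (ins_mem φ (r := K) (N := K + 1) le_rfl
    (by omega) hx)
  rw [Nat.sub_add_cancel hr] at e
  rw [zero_add] at e'
  rw [← e, ← e', iotaOp, cap_eq_cap_counit φ (by omega) hx, Nat.add_sub_cancel, sface_apply,
    ins_apply, map_zsmul, face_zero, pow_zero, one_smul]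
  congr 1
  rw [zsmul_neg_one_pow (b := 0), pow_zero, one_smul]
  simp only [Nat.even_add, Nat.even_mul, Nat.not_even_one, iff_false, Even.zero]
  tauto

/-- The faces of the homotopy. -/
theorem sum_sface_homotopy {K : ℕ} {x : Chains H.toLeftBialgebroid M}
    (hx : x ∈ homog H.η (modAct H.η M) (K + p)) :
    ∑ j ∈ Finset.range (K + 1), sface H M (K + 1) j (homotopy C φ x) +
      homotopy C (H.delta φ) x =
    normOp C (iotaOp φ M x) +
      (-1 : ℤ) ^ (p + 1) • homotopy C φ (bOp H.toLeftBialgebroid M x) := by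
  have hι : iotaOp φ M x ∈ homog H.η (modAct H.η M) K := by
    have := cap_mem φ (by omega) hx
    rwa [Nat.add_sub_cancel] at this
  rw [homotopy_apply C φ hx, homotopy_apply C _ hx, normOp_apply C hι,
    show K + p + 1 - p = K + 1 by omega, show K + p + 1 - (p + 1) = K by omega]
  -- For fixed `r` the insertions run up to `m = K - r`. The unpaired term is `λʳ ι_φ x`, and these
  -- terms sum to `N ι_φ x`.
  have row : ∀ r ∈ Finset.range (K + 1),
      (∑ i ∈ Finset.range (K + 1 - r), ∑ j ∈ Finset.range (K + 1),
        sface H M (K + 1) j (ins φ M (K + p) i ((lam C ^ r) x)) +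
      ∑ i ∈ Finset.range (K - r), ins (H.delta φ) M (K + p) i ((lam C ^ r) x)) =
      (lam C ^ r) (iotaOp φ M x) + (-1 : ℤ) ^ (p + 1) •
        (∑ i ∈ Finset.range (K - r), ∑ j ∈ Finset.range (K + p),
          ins φ M (K + p - 1) i (sface H M (K + p) j ((lam C ^ r) x)) +
        ∑ j ∈ Finset.range r,
          ins φ M (K + p - 1) (K - r) (sface H M (K + p) j ((lam C ^ r) x))) := by
    intro r hr
    rw [Finset.mem_range] at hr
    have := sum_faces_row (K := K) (p := p) (m := K - r) ((-1 : ℤ) ^ (p + 1))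
      (a := fun i j => sface H M (K + 1) j (ins φ M (K + p) i ((lam C ^ r) x)))
      (c := fun i j => ins φ M (K + p - 1) i (sface H M (K + p) j ((lam C ^ r) x)))
      (e := fun i => ins (H.delta φ) M (K + p) i ((lam C ^ r) x)) (by omega)
      (fun i j h => sface_ins_of_lt φ h (lam_pow_mem C r hx))
      (fun i j hi h hj => sface_ins_of_gt φ hi h hj)
      (fun i hi => sface_ins_middle φ hi (lam_pow_mem C r hx))
    simp only [show K - (K - r) = r by omega] at this
    rw [show K + 1 - r = K - r + 1 by omega, this, sface_ins_diag C φ (by omega) hx]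
  have h₁ : ∑ j ∈ Finset.range (K + 1), sface H M (K + 1) j (∑ r ∈ Finset.range (K + 1),
      ∑ i ∈ Finset.range (K + 1 - r), ins φ M (K + p) i ((lam C ^ r) x)) =
      ∑ r ∈ Finset.range (K + 1), ∑ i ∈ Finset.range (K + 1 - r), ∑ j ∈ Finset.range (K + 1),
        sface H M (K + 1) j (ins φ M (K + p) i ((lam C ^ r) x)) := by
    simp only [map_sum]
    rw [Finset.sum_comm]
    exact Finset.sum_congr rfl fun r _ => Finset.sum_comm
  -- For `δφ` there is one power of `λ` less; the row `r = K` is empty and is added to match the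
  -- other sums.
  have h₂ : ∑ r ∈ Finset.range K, ∑ i ∈ Finset.range (K - r),
      ins (H.delta φ) M (K + p) i ((lam C ^ r) x) = ∑ r ∈ Finset.range (K + 1),
      ∑ i ∈ Finset.range (K - r), ins (H.delta φ) M (K + p) i ((lam C ^ r) x) := by
    rw [Finset.sum_range_succ]
    simp
  rw [h₁, h₂, ← Finset.sum_add_distrib, Finset.sum_congr rfl row, Finset.sum_add_distrib,
    ← Finset.smul_sum, sum_cyclic_shift (by omega : K ≤ K + p) fun r i j =>
      ins φ M (K + p - 1) i (sface H M (K + p) j ((lam C ^ r) x))]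
  congr 2
  -- Degree `0` is separate because `b` vanishes there and does not lower the degree.
  rcases Nat.eq_zero_or_pos (K + p) with h | h
  · obtain rfl : K = 0 := by omega
    obtain rfl : p = 0 := by omega
    rw [bOp_zero hx, map_zero]
    simp
  · obtain ⟨n, hn⟩ : ∃ n, K + p = n + 1 := ⟨K + p - 1, by omega⟩
    rw [hn] at hx ⊢
    rw [homotopy_apply C φ (bOp_mem hx), show n + 1 - p = K by omega, Nat.add_sub_cancel]
    refine Finset.sum_congr rfl fun r hr => Finset.sum_congr rfl fun i _ => ?_
    rw [Finset.mem_range] at hr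
    rw [lam_pow_bOp C (by omega) hx, map_add, map_sum, map_sum]

end Homotopy

end HopfAlgd

namespace HopfAlgd

/-! ### Identities on chains -/

section Identities

open LeftHopfAlgebroid LeftBialgebroid

variable {k A U : Type*} [CommRing k] [Ring A] [Algebra k A] [Ring U] [Algebra k U]
  {M : Type*} [AddCommGroup M] [Module k M] [Module Uᵐᵒᵖ M] [IsScalarTower k Uᵐᵒᵖ M]
  {H : LeftHopfAlgebroid k A U} (C : ModuleComodule H.toLeftBialgebroid M)
  {p : ℕ} (φ : Cochain (k := k) H.η p)

theorem face_iotaOp {n i : ℕ} (hi : 1 ≤ i) (h : i + p ≤ n) {x : Chains H.toLeftBialgebroid M}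
    (hx : x ∈ homog H.η (modAct H.η M) n) :
    face H.toLeftBialgebroid M (n - p) i (iotaOp φ M x) =
      iotaOp φ M (face H.toLeftBialgebroid M n (i + p) x) := by
  rw [iotaOp]
  rcases Nat.eq_or_lt_of_le h with rfl | h
  · rw [Nat.add_sub_cancel, face_last hi, face_last (by omega), lastFace_cap φ (by omega) hx]
  · rw [face_inner hi (by omega), face_inner (by omega) h, cap_slot _ φ (by omega) hx]
    congr 2
    omega

theorem iotaOp_mem {K : ℕ} {x : Chains H.toLeftBialgebroid M}
    (hx : x ∈ homog H.η (modAct H.η M) (K + p)) : iotaOp φ M x ∈ homog H.η (modAct H.η M) K := by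
  have := cap_mem φ (by omega) hx
  rwa [Nat.add_sub_cancel] at this

theorem iotaOp_eq_zero {n : ℕ} (h : n < p) {x : Chains H.toLeftBialgebroid M}
    (hx : x ∈ homog H.η (modAct H.η M) n) : iotaOp φ M x = 0 := cap_eq_zero φ h hx

/-- Apply `d₀` to `slot_DD_delta`. By `d₀ d₁ = d₀ d₀` the left product yields `d₀ ι_φ` and the right
product yields `ι_φ d₀`, while the inner merges are the faces `d₁, …, d_p` before `ι_φ`. -/
theorem iotaOp_delta {n : ℕ} (h : p + 1 ≤ n) {x : Chains H.toLeftBialgebroid M}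
    (hx : x ∈ homog H.η (modAct H.η M) n) :
    iotaOp (H.delta φ) M x = sface H M (n - p) 0 (iotaOp φ M x) +
      (-1 : ℤ) ^ (p + 1) • ∑ j ∈ Finset.range (p + 1), iotaOp φ M (sface H M n j x) := by
  obtain ⟨r, rfl⟩ : ∃ r, n = r + 1 + p := ⟨n - p - 1, by omega⟩
  have hD : ∀ i, i ≤ r + 1 → slot (modAct H.η M) i p (H.DD_isSlotMap φ) x ∈
      homog H.η (modAct H.η M) (r + 2) := fun i hi => by
    have := slot_mem (r := i) (q := p) (H.DD_isSlotMap φ) (by omega) hx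
    rwa [show r + 1 + p + 1 - p = r + 2 by omega] at this
  have hι : ∀ {y : Chains H.toLeftBialgebroid M}, y ∈ homog H.η (modAct H.η M) (r + p) →
      cap (modAct H.η M) φ y = cap (modAct H.η M) H.counitCochain
        (slot (modAct H.η M) r p (H.DD_isSlotMap φ) y) := fun {y} hy => by
    rw [cap_eq_cap_counit φ (by omega) hy, Nat.add_sub_cancel]
  have hface : ∀ j, j ≤ r + p + 1 → face H.toLeftBialgebroid M (r + 1 + p) j x ∈
      homog H.η (modAct H.η M) (r + p) := fun j hj => by
    rw [show r + 1 + p = r + p + 1 by omega] at hx ⊢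
    exact face_mem hj hx
  rw [iotaOp, cap_eq_cap_counit _ h hx, show r + 1 + p - (p + 1) = r by omega,
    slot_DD_delta φ (by omega) hx, sum_slot_DD_merge φ (n := r + 1 + p) (i := r) (by omega), map_add, map_add, map_sum,
    map_zsmul, cap_counit_merge (hD _ le_rfl), cap_counit_merge (hD _ (by omega)),
    Nat.add_sub_cancel, show r + 1 + p - r - p = 1 by omega, show r + 1 + p - r = p + 1 by omega,
    Finset.sum_range_succ', sface_apply (r + 1) 0, face_zero, pow_zero, one_smul, iotaOp,
    cap_eq_cap_counit φ (by omega) hx, Nat.add_sub_cancel]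
  congr 1
  rw [smul_add]
  congr 1
  · rw [Finset.smul_sum, Finset.sum_Ico_eq_sum_range, Nat.add_sub_cancel]
    refine Finset.sum_congr rfl fun j hj => ?_
    rw [Finset.mem_range] at hj
    rw [sface_apply, map_zsmul, map_zsmul, hι (hface (j + 1) (by omega)), smul_smul, ← pow_add,
      add_comm 1 j]
    refine zsmul_neg_one_pow ?_ _
    rw [← Nat.even_add]
    exact ⟨p + 1, by omega⟩
  · rw [sface_apply, pow_zero, one_smul, hι (hface 0 (by omega)), face_zero,
      ← cap_slot (n := r + 1 + p) (H.DD_isSlotMap φ) H.counitCochain (by omega) hx]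

/-- The commutator of `b` and `ι_φ`. -/
theorem bOp_iotaOp {n : ℕ} {x : Chains H.toLeftBialgebroid M}
    (hx : x ∈ homog H.η (modAct H.η M) n) :
    bOp H.toLeftBialgebroid M (iotaOp φ M x) =
      iotaOp (H.delta φ) M x + (-1 : ℤ) ^ p • iotaOp φ M (bOp H.toLeftBialgebroid M x) := by
  by_cases h : p + 1 ≤ n
  · obtain ⟨r, rfl⟩ : ∃ r, n = r + 1 + p := ⟨n - p - 1, by omega⟩
    rw [iotaOp_delta φ h hx, bOp_apply (iotaOp_mem φ hx), bOp_apply hx,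
      Finset.sum_range_succ', map_sum, show r + 1 + p + 1 = p + 1 + (r + 1) by omega,
      Finset.sum_range_add _ (p + 1), smul_add, Nat.add_sub_cancel]
    have e : ∑ i ∈ Finset.range (r + 1), sface H M (r + 1) (i + 1) (iotaOp φ M x) =
        (-1 : ℤ) ^ p • ∑ i ∈ Finset.range (r + 1),
          iotaOp φ M (sface H M (r + 1 + p) (p + 1 + i) x) := by
      rw [Finset.smul_sum]
      refine Finset.sum_congr rfl fun i hi => ?_
      rw [Finset.mem_range] at hi
      have := face_iotaOp φ (i := i + 1) (by omega) (by omega) hx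
      rw [Nat.add_sub_cancel] at this
      rw [sface_apply, sface_apply, map_zsmul, this, smul_smul, ← pow_add,
        show i + 1 + p = p + 1 + i by omega]
      refine zsmul_neg_one_pow ?_ _
      rw [← Nat.even_add]
      exact ⟨i + 1 + p, by omega⟩
    rw [e, pow_succ, mul_neg_one, neg_smul]
    abel
  -- In degrees `n ≤ p` everything vanishes; for `n = p` the image of `ι_φ` lies in degree `0`,
  -- where `b = 0`.
  · rw [iotaOp_eq_zero (H.delta φ) (by omega) hx, zero_add]
    have e₁ : bOp H.toLeftBialgebroid M (iotaOp φ M x) = 0 := by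
      rcases Nat.eq_or_lt_of_le (by omega : n ≤ p) with rfl | h'
      · exact bOp_zero (iotaOp_mem φ (by simpa using hx))
      · rw [iotaOp_eq_zero φ h' hx, map_zero]
    have e₂ : iotaOp φ M (bOp H.toLeftBialgebroid M x) = 0 := by
      rcases n with _ | n
      · rw [bOp_zero hx, map_zero]
      · exact iotaOp_eq_zero φ (by omega) (bOp_mem hx)
    rw [e₁, e₂, smul_zero]

/-- `d₀ J = id`, the last face of `J` is `t` by definition, and the remaining faces satisfy `d_{j+1}
J = J d_j`. The last face of `y` does not occur. -/
theorem bOp_coextra {m : ℕ} {y : Chains H.toLeftBialgebroid M}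
    (hy : y ∈ homog H.η (modAct H.η M) m) :
    bOp H.toLeftBialgebroid M (coextra C y) = y - lam C y -
      coextra C (∑ j ∈ Finset.range m, sface H M m j y) := by
  rw [bOp_apply (coextra_mem C hy), Finset.sum_range_succ, Finset.sum_range_succ', map_sum,
    sface_apply _ 0, face_zero, cap_counit_coextra, sface_apply, face_last (by omega), ← cyc_apply,
    lam_apply C hy, pow_succ, mul_neg_one, neg_smul, pow_zero, one_smul]
  have e : ∑ j ∈ Finset.range m, sface H M (m + 1) (j + 1) (coextra C y) =
      -∑ j ∈ Finset.range m, coextra C (sface H M m j y) := by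
    rw [← Finset.sum_neg_distrib]
    refine Finset.sum_congr rfl fun j hj => ?_
    rw [Finset.mem_range] at hj
    rw [sface_apply, sface_apply, map_zsmul, face_coextra C hj hy, pow_succ, mul_neg_one, neg_smul]
  rw [e]
  abel

/-- Since `λ` carries the term `(i + 1, r)` to `(i, r + 1)`, the difference telescopes. The row `r =
0` and the images of the terms with `i = 0` are left. -/
theorem homotopy_sub_lam {K : ℕ} {x : Chains H.toLeftBialgebroid M}
    (hx : x ∈ homog H.η (modAct H.η M) (K + p)) :
    homotopy C φ x - lam C (homotopy C φ x) =
      ∑ i ∈ Finset.range (K + 1), ins φ M (K + p) i x -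
        ∑ r ∈ Finset.range (K + 1), lam C (ins φ M (K + p) 0 ((lam C ^ r) x)) := by
  rw [homotopy_apply C φ hx, show K + p + 1 - p = K + 1 by omega, map_sum]
  have e : ∀ r ∈ Finset.range (K + 1), lam C (∑ i ∈ Finset.range (K + 1 - r),
      ins φ M (K + p) i ((lam C ^ r) x)) =
      ∑ i ∈ Finset.range (K + 1 - (r + 1)), ins φ M (K + p) i ((lam C ^ (r + 1)) x) +
        lam C (ins φ M (K + p) 0 ((lam C ^ r) x)) := by
    intro r hr
    rw [Finset.mem_range] at hr
    rw [show K + 1 - r = K - r + 1 by omega, show K + 1 - (r + 1) = K - r by omega,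
      Finset.sum_range_succ', map_add, map_sum]
    congr 1
    refine Finset.sum_congr rfl fun i hi => ?_
    rw [Finset.mem_range] at hi
    rw [lam_ins C φ (by omega) (lam_pow_mem C r hx), pow_succ', Module.End.mul_apply]
  rw [Finset.sum_congr rfl e, Finset.sum_add_distrib, ← sub_sub, Finset.sum_range_succ',
    Finset.sum_range_succ (fun r => ∑ i ∈ Finset.range (K + 1 - (r + 1)), _)]
  simp

/-- The value of `ι_φ` on the image of the extra degeneracy. -/
theorem cycT_iotaOp_coextra {K : ℕ} {z : Chains H.toLeftBialgebroid M}
    (hz : z ∈ homog H.η (modAct H.η M) (K + p)) :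
    cycT C (iotaOp φ M (coextra C z)) =
      cyc C (slot (modAct H.η M) 0 p (H.DD_isSlotMap φ) ((cyc C ^ (K + 1)) z)) := by
  have hJ : coextra C z ∈ homog H.η (modAct H.η M) (K + 1 + p) := by
    have := coextra_mem C hz
    rwa [show K + p + 1 = K + 1 + p by omega] at this
  have hw : slot (modAct H.η M) (K + 1) p (H.DD_isSlotMap φ) (coextra C z) ∈
      homog H.η (modAct H.η M) (K + 2) := by
    have := slot_mem (r := K + 1) (q := p) (H.DD_isSlotMap φ) (by omega) hJ
    rwa [show K + 1 + p + 1 - p = K + 2 by omega] at this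
  set y := (cyc C ^ (K + 1)) z with hy
  have hym : y ∈ homog H.η (modAct H.η M) (K + p) := cyc_pow_mem C _ hz
  have hD : slot (modAct H.η M) 0 p (H.DD_isSlotMap φ) y ∈ homog H.η (modAct H.η M) (K + 1) := by
    have := slot_mem (r := 0) (q := p) (H.DD_isSlotMap φ) (by omega) hym
    rwa [show K + p + 1 - p = K + 1 by omega] at this
  -- `T` is `t^{K+2}` here, and `ι_φ` is `d₀` after the last insertion. Pulling `t^{K+2}` inside
  -- makes `d₀` the last face, brings the insertion to the front, and turns `J` into a degeneracy
  -- right behind the inserted letter. The remaining `t` and the last face then absorb this unit.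
  have e₁ := face_cyc_pow C (i := 0) (K + 2) (by omega) hw
  have e₂ := cyc_pow_slot C (H.DD_isSlotMap φ) (DD_transCompat H φ p) (r := 0) (K + 1) (by omega) hJ
  have e₃ := slot_slot (ρ := modAct H.η M) (H.DD_isSlotMap φ) (prod_isSlotMap H.η) (r := 0)
    (r' := 0) p 0 le_rfl y
  have e₄ := lastFace_slot (H := H.toLeftBialgebroid) (prod_isSlotMap H.η) (r := 0) (q := 0)
    (n := K + 2) (by omega) (coextra_mem C hD)
  rw [zero_add] at e₁ e₂ e₃ e₄
  rw [cycT_apply C (iotaOp_mem φ hJ), iotaOp, cap_eq_cap_counit φ (by omega) hJ,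
    Nat.add_sub_cancel, ← face_zero (H := H) (M := M) (K + 2), ← e₁, face_last (by omega),
    pow_succ' (cyc C) (K + 1), Module.End.mul_apply, e₂,
    cyc_pow_coextra C (by omega) hz, show K + p - K = p by omega, ← hy, e₃,
    cyc_apply C (slot _ 1 0 _ _), coextra_slot C _ (prod_transCompat H 0) (by omega) hD, e₄,
    lastFace_degen, cyc_apply]

theorem insertLast_apply {K : ℕ} {x : Chains H.toLeftBialgebroid M}
    (hx : x ∈ homog H.η (modAct H.η M) (K + p)) :
    insertLast φ M x = slot (modAct H.η M) K p (H.DD_isSlotMap φ) x := by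
  rw [insertLast, gr_apply _ hx, if_pos (by omega), Nat.add_sub_cancel, insertAt,
    Nat.add_sub_cancel]

theorem zsmul_negOnePow {G : Type*} [AddCommGroup G] {a : ℤ} {b : ℕ} (h : Even (a + b)) (x : G) :
    a.negOnePow • x = (-1 : ℤ) ^ b • x := by
  have e : a.negOnePow = (b : ℤ).negOnePow := by
    rw [Int.negOnePow_eq_iff, Int.even_sub, ← Int.even_add]
    exact h
  rw [e, Units.smul_def, Int.negOnePow_def]
  simp

/-- Moving `D'_φ` from the last place to place `i` uses up `t^{n-p-i}`. With `r = n - p - j` the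
powers of `t` to its right then add up to `r + n + 1`, so a full `T` splits off. What remains under
`s_{-1}` is a summand of `homotopy`. -/
theorem SOp_eq : SOp C φ = coextra C * homotopy C φ * cycT C := by
  refine wext fun m l => ?_
  have hx := wmk_mem_homog (η := H.η) (ρ := modAct H.η M) m (l := l) rfl
  set x := wmk H.η (modAct H.η M) m l
  rw [SOp, gr_apply _ hx, Module.End.mul_apply, Module.End.mul_apply,
    homotopy_apply C φ (cycT_mem C hx)]
  by_cases h : p ≤ l.length
  swap
  · rw [if_neg h, show l.length + 1 - p = 0 by omega]
    simp
  rw [if_pos h]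
  obtain ⟨K, hK⟩ : ∃ K, l.length = K + p := ⟨l.length - p, by omega⟩
  rw [hK] at hx ⊢
  -- Reflection of the outer sum substitutes `r = K - j`.
  rw [Nat.add_sub_cancel, show K + p + 1 - p = K + 1 by omega, ← Finset.sum_range_reflect]
  simp only [LinearMap.sum_apply, map_sum]
  refine Finset.sum_congr rfl fun r hr => ?_
  rw [Finset.mem_range] at hr
  rw [show K + 1 - 1 - r + 1 = K + 1 - r by omega]
  refine Finset.sum_congr rfl fun i hi => ?_
  rw [Finset.mem_range] at hi
  have e := cyc_pow_slot C (H.DD_isSlotMap φ) (DD_transCompat H φ p) (r := i) (K - i) (by omega)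
    (cyc_pow_mem C (K + p + i + 1 - (K + 1 - 1 - r)) hx)
  rw [show i + (K - i) = K by omega] at e
  have hT : (lam C ^ r) (cycT C x) = (-1 : ℤ) ^ (r * (K + p)) •
      (cyc C ^ (K - i)) ((cyc C ^ (K + p + i + 1 - (K + 1 - 1 - r))) x) := by
    rw [lam_pow_apply C r (cycT_mem C hx), cycT_apply C hx, pow_apply_add, pow_apply_add]
    congr 3
    omega
  rw [hT, map_zsmul, map_zsmul, ins_apply, map_zsmul, ← e, smul_smul, ← pow_add]
  change Int.negOnePow _ • (extraDegen C) _ = _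
  rw [extraDegen_eq, ← insertLast_apply φ (cyc_pow_mem C _ hx)]
  refine zsmul_negOnePow ?_ _
  obtain ⟨s, rfl⟩ : ∃ s, K = s + r := ⟨K - r, by omega⟩
  rw [show s + r + 1 - 1 - r = s by omega]
  obtain ⟨w, hw⟩ := Int.even_mul_succ_self (s + r + p)
  push_cast
  exact ⟨w + p * i, by linear_combination hw⟩

end Identities

end HopfAlgd

namespace HopfAlgd

/-! ### Descent to the reduced cyclic quotient -/

section Descent

open LeftHopfAlgebroid LeftBialgebroid

variable {k A U : Type*} [CommRing k] [Ring A] [Algebra k A] [Ring U] [Algebra k U]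
  {M : Type*} [AddCommGroup M] [Module k M] [Module Uᵐᵒᵖ M] [IsScalarTower k Uᵐᵒᵖ M]
  {H : LeftHopfAlgebroid k A U} (C : ModuleComodule H.toLeftBialgebroid M)
  {p : ℕ} {φ : Cochain (k := k) H.η p}

theorem imT_le_comap {f : Module.End k (Chains H.toLeftBialgebroid M)}
    {Q : Submodule k (Chains H.toLeftBialgebroid M)}
    (h : ∀ n x, x ∈ homog H.η (modAct H.η M) n → f (x - cycT C x) ∈ Q) :
    imT C ≤ Q.comap f := by
  have e : Q.mkQ ∘ₗ f ∘ₗ (1 - cycT C) = 0 := wext fun m l =>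
    (Submodule.Quotient.mk_eq_zero _).2 (h _ _ (wmk_mem_homog m rfl))
  rintro _ ⟨z, rfl⟩
  have h := LinearMap.congr_fun e z
  exact (Submodule.Quotient.mk_eq_zero Q).1 h

theorem sub_cycT_mem_imT (x : Chains H.toLeftBialgebroid M) : x - cycT C x ∈ imT C := ⟨x, rfl⟩

theorem degen_mem_degenerate {n r : ℕ} (h : r ≤ n) {x : Chains H.toLeftBialgebroid M}
    (hx : x ∈ homog H.η (modAct H.η M) n) :
    slot (modAct H.η M) r 0 (prod_isSlotMap H.η) x ∈ degenerate H.toLeftBialgebroid M := by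
  refine map_mem_homog (P := degenerate H.toLeftBialgebroid M) (fun m l hl => ?_) hx
  refine Submodule.subset_span ⟨m, l, n - r, by omega, ?_⟩
  rw [degen, show l.length - (n - r) = r by omega]

theorem degenerate_le_comap {f : Module.End k (Chains H.toLeftBialgebroid M)}
    {Q : Submodule k (Chains H.toLeftBialgebroid M)}
    (h : ∀ n r x, r ≤ n → x ∈ homog H.η (modAct H.η M) n →
      f (slot (modAct H.η M) r 0 (prod_isSlotMap H.η) x) ∈ Q) :
    degenerate H.toLeftBialgebroid M ≤ Q.comap f := by
  rw [degenerate, Submodule.span_le]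
  rintro _ ⟨m, l, j, -, rfl⟩
  exact h _ _ _ (Nat.sub_le _ _) (wmk_mem_homog m rfl)

theorem redCycKer_le_comap {f : Module.End k (Chains H.toLeftBialgebroid M)}
    (h₁ : imT C ≤ (imT C).comap f)
    (h₂ : ∀ n r x, r ≤ n → x ∈ homog H.η (modAct H.η M) n →
      f (slot (modAct H.η M) r 0 (prod_isSlotMap H.η) x) ∈ degenerate H.toLeftBialgebroid M) :
    redCycKer C ≤ (redCycKer C).comap f :=
  sup_le (h₁.trans (Submodule.comap_mono le_sup_left))
    ((degenerate_le_comap h₂).trans (Submodule.comap_mono le_sup_right))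

theorem coextra_imT : imT C ≤ (imT C).comap (coextra C) :=
  imT_le_comap C fun n x hx => by
    rw [map_sub, coextra_cycT C hx]
    exact sub_cycT_mem_imT C _

theorem lam_imT : imT C ≤ (imT C).comap (lam C) :=
  imT_le_comap C fun n x hx => by
    rw [map_sub, lam_apply C hx, lam_apply C (cycT_mem C hx), cyc_cycT C hx, ← smul_sub]
    exact zsmul_mem (sub_cycT_mem_imT C _) _

theorem lam_pow_imT (r : ℕ) : imT C ≤ (imT C).comap (lam C ^ r) := by
  induction r with
  | zero => exact fun _ h => h
  | succ r ih =>
    intro x hx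
    rw [Submodule.mem_comap, pow_succ', Module.End.mul_apply]
    exact lam_imT C (ih hx)

theorem cycT_imT : imT C ≤ (imT C).comap (cycT C) :=
  imT_le_comap C fun n x _ => by
    rw [map_sub]
    exact sub_cycT_mem_imT C _

theorem cap_counit_imT :
    imT C ≤ (imT C).comap (cap (modAct H.η M) H.counitCochain) :=
  imT_le_comap C fun n x hx => by
    rcases n with _ | n
    · rw [cap_eq_zero _ (by omega) (Submodule.sub_mem _ hx (cycT_mem C hx))]
      exact Submodule.zero_mem _
    · rw [map_sub, ← face_zero (n + 1), face_cycT C (by omega) hx]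
      exact sub_cycT_mem_imT C _

theorem bOp_imT : imT C ≤ (imT C).comap (bOp H.toLeftBialgebroid M) :=
  imT_le_comap C fun n x hx => by
    have hx' := cycT_mem C hx
    rcases n with _ | n
    · rw [map_sub, bOp_zero hx, bOp_zero hx', sub_zero]
      exact Submodule.zero_mem _
    · rw [map_sub, bOp_apply hx, bOp_apply hx', ← Finset.sum_sub_distrib]
      refine Submodule.sum_mem _ fun j hj => ?_
      rw [Finset.mem_range] at hj
      rw [sface_apply, sface_apply, face_cycT C (by omega) hx, ← smul_sub]
      exact zsmul_mem (sub_cycT_mem_imT C _) _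

theorem normOp_imT : imT C ≤ (imT C).comap (normOp C) :=
  imT_le_comap C fun n x hx => by
    rw [normOp_apply C (Submodule.sub_mem _ hx (cycT_mem C hx))]
    exact Submodule.sum_mem _ fun r _ => lam_pow_imT C r (sub_cycT_mem_imT C x)

theorem cyc_imT : imT C ≤ (imT C).comap (cyc C) :=
  imT_le_comap C fun n x hx => by
    rw [map_sub, cyc_cycT C hx]
    exact sub_cycT_mem_imT C _

theorem BOp_apply (x : Chains H.toLeftBialgebroid M) : BOp C x =
    coextra C (normOp C x) - cyc C (coextra C (normOp C x)) := by
  rw [BOp, extraDegen_eq]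
  rfl

theorem BOp_imT : imT C ≤ (imT C).comap (BOp C) := fun x hx => by
  have h := coextra_imT C (normOp_imT C hx)
  rw [Submodule.mem_comap, BOp_apply]
  exact Submodule.sub_mem _ h (cyc_imT C h)

variable {C}

theorem slot_imT (hφ : IsMCochain C φ) (r : ℕ) :
    imT C ≤ (imT C).comap (slot (modAct H.η M) r p (H.DD_isSlotMap φ)) := hφ (r + 1) (by omega)

theorem ins_imT (hφ : IsMCochain C φ) (n r : ℕ) : imT C ≤ (imT C).comap (ins φ M n r) :=
  fun x hx => by
    have h : slot (modAct H.η M) r p (H.DD_isSlotMap φ) x ∈ imT C := slot_imT hφ r hx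
    rw [Submodule.mem_comap, ins_apply]
    exact zsmul_mem h _

theorem homotopy_imT (hφ : IsMCochain C φ) : imT C ≤ (imT C).comap (homotopy C φ) :=
  imT_le_comap C fun n x hx => by
    rw [homotopy_apply C φ (Submodule.sub_mem _ hx (cycT_mem C hx))]
    exact Submodule.sum_mem _ fun r _ => Submodule.sum_mem _ fun i _ =>
      ins_imT hφ n i (lam_pow_imT C r (sub_cycT_mem_imT C x))

theorem SOp_imT (hφ : IsMCochain C φ) : imT C ≤ (imT C).comap (SOp C φ) := fun x hx => by
  rw [Submodule.mem_comap, SOp_eq]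
  exact coextra_imT C (homotopy_imT hφ (cycT_imT C hx))

theorem iotaOp_imT (hφ : IsMCochain C φ) : imT C ≤ (imT C).comap (iotaOp φ M) :=
  imT_le_comap C fun n x hx => by
    have hx' := Submodule.sub_mem _ hx (cycT_mem C hx)
    by_cases h : p ≤ n
    · rw [iotaOp, cap_eq_cap_counit φ h hx']
      exact cap_counit_imT C (slot_imT hφ _ (sub_cycT_mem_imT C x))
    · rw [iotaOp_eq_zero φ (by omega) hx']
      exact Submodule.zero_mem _

/-- By `slot_DD_delta` the insertion of `D_{δφ}` is a combination of insertions of `D_φ` and merges,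
and merges commute with `T` because they are inner faces. -/
theorem delta_isMCochain (hφ : IsMCochain C φ) : IsMCochain C (H.delta φ) := by
  rintro (_ | r) hr
  · omega
  rw [insertAt, Nat.add_sub_cancel]
  have merge : ∀ {n s : ℕ} {x : Chains H.toLeftBialgebroid M}, s + 2 ≤ n →
      x ∈ homog H.η (modAct H.η M) n → cycT C (slot (modAct H.η M) s 2 (prod_isSlotMap H.η) x) =
        slot (modAct H.η M) s 2 (prod_isSlotMap H.η) (cycT C x) := by
    intro n s x hs hx
    obtain ⟨n, rfl⟩ : ∃ n', n = n' + 1 := ⟨n - 1, by omega⟩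
    have := face_cycT C (i := n - s) (by omega) hx
    rw [face_inner (by omega) (by omega), show n + 1 - (n - s) - 1 = s by omega] at this
    exact this.symm
  have merge_imT : ∀ s, imT C ≤ (imT C).comap
      (slot (modAct H.η M) s 2 (prod_isSlotMap H.η)) := fun s =>
    imT_le_comap C fun n x hx => by
      by_cases h : s + 2 ≤ n
      · rw [map_sub, ← merge h hx]
        exact sub_cycT_mem_imT C _
      · rw [slot_eq_zero _ (by omega) (Submodule.sub_mem _ hx (cycT_mem C hx))]
        exact Submodule.zero_mem _
  refine imT_le_comap C fun n x hx => ?_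
  have hx' := Submodule.sub_mem _ hx (cycT_mem C hx)
  by_cases h : r + (p + 1) ≤ n
  · rw [slot_DD_delta φ h hx']
    have hT := sub_cycT_mem_imT C x
    have e₁ : ∀ s s' : ℕ, slot (modAct H.η M) s 2 (prod_isSlotMap H.η)
        (slot (modAct H.η M) s' p (H.DD_isSlotMap φ) (x - cycT C x)) ∈ imT C := fun s s' =>
      merge_imT s (slot_imT hφ s' hT)
    have e₂ : ∀ s s' : ℕ, slot (modAct H.η M) s p (H.DD_isSlotMap φ)
        (slot (modAct H.η M) s' 2 (prod_isSlotMap H.η) (x - cycT C x)) ∈ imT C := fun s s' =>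
      slot_imT hφ s (merge_imT s' hT)
    exact Submodule.add_mem _ (e₁ _ _) (Submodule.add_mem _
      (Submodule.sum_mem _ fun i _ => zsmul_mem (e₂ _ _) _) (zsmul_mem (e₁ _ _) _))
  · rw [slot_eq_zero _ (by omega) hx']
    exact Submodule.zero_mem _

variable (C) in
/-- The images of the degeneracies and of the extra degeneracy on chains of degree `n`. -/
inductive ExtraDegenerate (n : ℕ) : Chains H.toLeftBialgebroid M → Prop
  | degen {j : ℕ} {y : Chains H.toLeftBialgebroid M} (hj : j ≤ n)
      (hy : y ∈ homog H.η (modAct H.η M) n) :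
      ExtraDegenerate n (slot (modAct H.η M) j 0 (prod_isSlotMap H.η) y)
  | extra {y : Chains H.toLeftBialgebroid M} (hy : y ∈ homog H.η (modAct H.η M) n) :
      ExtraDegenerate n (coextra C y)

theorem ExtraDegenerate.cyc_pow_coextra {n s : ℕ} (hs : s ≤ n + 1)
    {y : Chains H.toLeftBialgebroid M} (hy : y ∈ homog H.η (modAct H.η M) n) :
    ExtraDegenerate C n ((cyc C ^ s) (coextra C y)) := by
  rcases s with _ | s
  · exact .extra hy
  · rw [HopfAlgd.cyc_pow_coextra C (by omega) hy]
    exact .degen (by omega) (cyc_pow_mem C _ hy)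

/-- Rotation moves the unit of a degeneracy to the front. The next `t` makes it an extra degeneracy,
and further ones an ordinary degeneracy again. The bound on `s` ensures that this cycle is not
exceeded. -/
theorem ExtraDegenerate.cyc_pow {n s : ℕ} (hs : s ≤ n + 1) {w : Chains H.toLeftBialgebroid M}
    (hw : ExtraDegenerate C n w) : ExtraDegenerate C n ((cyc C ^ s) w) := by
  cases hw with
  | extra hy => exact cyc_pow_coextra hs hy
  | @degen r y hr hy =>
    by_cases h : s ≤ r
    · have e := cyc_pow_slot C (prod_isSlotMap H.η) (prod_transCompat H 0) (r := r - s) s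
        (by omega) hy
      rw [Nat.sub_add_cancel h] at e
      rw [e]
      exact .degen (by omega) (cyc_pow_mem C _ hy)
    · have e := cyc_pow_slot C (prod_isSlotMap H.η) (prod_transCompat H 0) (r := 0) r
        (by omega) hy
      rw [zero_add] at e
      rw [show s = (s - r - 1) + (1 + r) by omega, pow_add, Module.End.mul_apply, pow_add,
        Module.End.mul_apply, e, pow_one, cyc_degen_zero C (cyc_pow_mem C _ hy)]
      exact cyc_pow_coextra (by omega) (cyc_pow_mem C _ hy)

/-- `J` commutes with ordinary degeneracies and satisfies `J J = s₀ J`. Without the outer `J` an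
extra degeneracy need not be degenerate. -/
theorem ExtraDegenerate.coextra_mem {n : ℕ} {w : Chains H.toLeftBialgebroid M}
    (hw : ExtraDegenerate C n w) : coextra C w ∈ degenerate H.toLeftBialgebroid M := by
  cases hw with
  | extra hy =>
    rw [coextra_coextra' C hy]
    exact degen_mem_degenerate le_rfl (HopfAlgd.coextra_mem C hy)
  | degen hr hy =>
    rw [coextra_slot C _ (prod_transCompat H 0) (by omega) hy]
    exact degen_mem_degenerate (by omega) (HopfAlgd.coextra_mem C hy)

/-- A unit before or behind the block survives the insertion; a unit inside it kills the insertion,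
since `φ` is reduced. -/
theorem slot_DD_mem_degenerate (hφ : IsReduced φ) {n i j : ℕ} (hi : i + p ≤ n + 1) (hj : j ≤ n)
    {y : Chains H.toLeftBialgebroid M} (hy : y ∈ homog H.η (modAct H.η M) n) :
    slot (modAct H.η M) i p (H.DD_isSlotMap φ)
      (slot (modAct H.η M) j 0 (prod_isSlotMap H.η) y) = 0 ∨ ∃ l z, l ≤ n + 1 - p ∧
      z ∈ homog H.η (modAct H.η M) (n + 1 - p) ∧ slot (modAct H.η M) i p (H.DD_isSlotMap φ)
      (slot (modAct H.η M) j 0 (prod_isSlotMap H.η) y) =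
        slot (modAct H.η M) l 0 (prod_isSlotMap H.η) z := by
  by_cases h₁ : j < i
  · have e := slot_slot (ρ := modAct H.η M) (prod_isSlotMap H.η) (H.DD_isSlotMap φ) (r := j)
      (r' := i - 1) 0 p (by omega) y
    rw [show i - 1 + 1 = i by omega, add_zero] at e
    exact .inr ⟨j, _, by omega, slot_mem (r := i - 1) (q := p) _ (by omega) hy, e.symm⟩
  by_cases h₂ : j < i + p
  · exact .inl (slot_DD_degen hφ (by omega) h₂ y)
  · have e := slot_slot (ρ := modAct H.η M) (H.DD_isSlotMap φ) (prod_isSlotMap H.η) (r := i)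
      (r' := j - p) p 0 (by omega) y
    rw [show j - p + p = j by omega] at e
    exact .inr ⟨j - p + 1, _, by omega, slot_mem (r := i) (q := p) _ (by omega) hy, e⟩

/-- For an extra degeneracy, `J D_φ J = D_φ J J = D_φ s₀ J`. The new unit stands at the very end,
behind the block, so it passes through `D_φ`. -/
theorem ExtraDegenerate.coextra_slot_mem (hφ : IsReduced φ) {n i : ℕ} (hi : i + p ≤ n + 1)
    {w : Chains H.toLeftBialgebroid M} (hw : ExtraDegenerate C n w) :
    coextra C (slot (modAct H.η M) i p (H.DD_isSlotMap φ) w) ∈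
      degenerate H.toLeftBialgebroid M := by
  cases hw with
  | degen hj hy =>
    rcases slot_DD_mem_degenerate hφ hi hj hy with e | ⟨l, z, hl, hz, e⟩
    · rw [e, map_zero]
      exact Submodule.zero_mem _
    · rw [e]
      exact (ExtraDegenerate.degen hl hz).coextra_mem
  | @extra y hy =>
    have hJ := HopfAlgd.coextra_mem C hy
    have e := slot_slot (ρ := modAct H.η M) (H.DD_isSlotMap φ) (prod_isSlotMap H.η) (r := i)
      (r' := n + 1 - p) p 0 (by omega) (coextra C y)
    rw [Nat.sub_add_cancel (by omega)] at e
    rw [coextra_slot C _ (DD_transCompat H φ p) hi hJ, coextra_coextra' C hy, e]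
    exact degen_mem_degenerate (by omega) (slot_mem _ hi hJ)

theorem ExtraDegenerate.coextra_homotopy_mem (hφ : IsReduced φ) {n : ℕ}
    {w : Chains H.toLeftBialgebroid M} (hw : ExtraDegenerate C n w)
    (hm : w ∈ homog H.η (modAct H.η M) (n + 1)) :
    coextra C (homotopy C φ w) ∈ degenerate H.toLeftBialgebroid M := by
  rw [homotopy_apply C φ hm, map_sum]
  refine Submodule.sum_mem _ fun r hr => ?_
  rw [map_sum]
  refine Submodule.sum_mem _ fun i hi => ?_
  rw [Finset.mem_range] at hr hi
  rw [lam_pow_apply C r hm, map_zsmul, map_zsmul, ins_apply, map_zsmul]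
  exact zsmul_mem (zsmul_mem (coextra_slot_mem hφ (by omega) (hw.cyc_pow (by omega))) _) _

theorem ExtraDegenerate.coextra_normOp_mem {n : ℕ}
    {w : Chains H.toLeftBialgebroid M} (hw : ExtraDegenerate C n w)
    (hm : w ∈ homog H.η (modAct H.η M) (n + 1)) :
    coextra C (normOp C w) ∈ degenerate H.toLeftBialgebroid M := by
  rw [normOp_apply C hm, map_sum]
  refine Submodule.sum_mem _ fun r hr => ?_
  rw [Finset.mem_range] at hr
  rw [lam_pow_apply C r hm, map_zsmul]
  exact zsmul_mem (hw.cyc_pow (by omega)).coextra_mem _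

/-- Because of this the factor `id - t` of `B` acts as the identity in the reduced quotient, and `B`
becomes `J N`. -/
theorem cyc_coextra_mem {n : ℕ} {y : Chains H.toLeftBialgebroid M}
    (hy : y ∈ homog H.η (modAct H.η M) n) :
    cyc C (coextra C y) ∈ degenerate H.toLeftBialgebroid M := by
  rw [cyc_coextra C hy]
  exact degen_mem_degenerate le_rfl (cyc_mem C hy)

theorem face_degen_eq {n r i : ℕ} (hr : r ≤ n) (hi : i = n - r ∨ i = n - r + 1)
    {x : Chains H.toLeftBialgebroid M} (hx : x ∈ homog H.η (modAct H.η M) n) :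
    face H.toLeftBialgebroid M (n + 1) i
      (slot (modAct H.η M) r 0 (prod_isSlotMap H.η) x) = x := by
  rcases hi with hi | hi
  · by_cases h : i = 0
    · obtain rfl : r = n := by omega
      rw [h, face_zero, cap_counit_degen hx]
    · rw [face_inner (by omega) (by omega), show n + 1 - i - 1 = r by omega,
        merge_degen_left (by omega) hx]
  · rcases r with _ | r
    · obtain rfl : i = n + 1 := by omega
      rw [face_last (by omega), lastFace_degen]
    · rw [face_inner (by omega) (by omega), show n + 1 - i - 1 = r by omega,
        merge_degen_right (by omega) hx]

theorem face_degen_mem {n r i : ℕ} (hr : r ≤ n) (hi : i ≤ n + 1) (h₁ : i ≠ n - r)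
    (h₂ : i ≠ n - r + 1) {x : Chains H.toLeftBialgebroid M}
    (hx : x ∈ homog H.η (modAct H.η M) n) :
    face H.toLeftBialgebroid M (n + 1) i (slot (modAct H.η M) r 0 (prod_isSlotMap H.η) x) ∈
      degenerate H.toLeftBialgebroid M := by
  obtain ⟨n, rfl⟩ : ∃ n', n = n' + 1 := ⟨n - 1, by omega⟩
  by_cases hi₀ : i = 0
  · rw [hi₀, face_zero, cap_slot _ _ (by omega) hx]
    have hc := cap_mem H.counitCochain (by omega) hx
    rw [Nat.add_sub_cancel] at hc
    exact degen_mem_degenerate (by omega) hc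
  by_cases hi₁ : i = n + 1 + 1
  · obtain ⟨r, rfl⟩ : ∃ r', r = r' + 1 := ⟨r - 1, by omega⟩
    rw [hi₁, face_last (by omega), lastFace_slot _ (by omega) hx]
    exact degen_mem_degenerate (n := n) (by omega) (lastFace_mem hx)
  · obtain ⟨s, hs⟩ : ∃ s, s = n + 1 + 1 - i - 1 := ⟨_, rfl⟩
    rw [face_inner (by omega) (by omega), ← hs]
    by_cases h : r < s
    · have e := slot_slot (ρ := modAct H.η M) (prod_isSlotMap H.η) (prod_isSlotMap H.η) (r := r)
        (r' := s - 1) 0 2 (by omega) x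
      rw [show s - 1 + 1 = s by omega, add_zero] at e
      rw [← e]
      have hc := slot_mem (r := s - 1) (q := 2) (prod_isSlotMap H.η) (by omega) hx
      rw [show n + 1 + 1 - 2 = n by omega] at hc
      exact degen_mem_degenerate (by omega) hc
    · have e := slot_slot (ρ := modAct H.η M) (prod_isSlotMap H.η) (prod_isSlotMap H.η) (r := s)
        (r' := r - 2) 2 0 (by omega) x
      rw [show r - 2 + 2 = r by omega] at e
      rw [e]
      have hc := slot_mem (r := s) (q := 2) (prod_isSlotMap H.η) (by omega) hx
      rw [show n + 1 + 1 - 2 = n by omega] at hc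
      exact degen_mem_degenerate (by omega) hc

variable (C) in
theorem bOp_redCycKer : redCycKer C ≤ (redCycKer C).comap (bOp H.toLeftBialgebroid M) := by
  refine redCycKer_le_comap C (bOp_imT C) fun n r x hr hx => ?_
  have hx' := slot_mem (r := r) (q := 0) (prod_isSlotMap H.η) (by omega) hx
  rw [Nat.sub_zero] at hx'
  -- Two neighbouring faces undo the degeneracy and cancel by their signs; all other faces of it are
  -- degenerate.
  rw [bOp_apply hx', ← Finset.add_sum_erase _ _ (Finset.mem_range.2 (show n - r < n + 1 + 1 by omega)),
    ← Finset.add_sum_erase (a := n - r + 1) _ _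
      (Finset.mem_erase.2 ⟨by omega, Finset.mem_range.2 (by omega)⟩), ← add_assoc,
    sface_apply, sface_apply, face_degen_eq hr (.inl rfl) hx, face_degen_eq hr (.inr rfl) hx,
    pow_succ, mul_neg_one, neg_smul, add_neg_cancel, zero_add]
  refine Submodule.sum_mem _ fun i hi => ?_
  simp only [Finset.mem_erase, Finset.mem_range] at hi
  rw [sface_apply]
  exact zsmul_mem (face_degen_mem hr (by omega) hi.2.1 hi.1 hx) _

variable (C) in
theorem BOp_redCycKer : redCycKer C ≤ (redCycKer C).comap (BOp C) := by
  refine redCycKer_le_comap C (BOp_imT C) fun n r x hr hx => ?_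
  have hx' := slot_mem (r := r) (q := 0) (prod_isSlotMap H.η) (by omega) hx
  rw [BOp_apply]
  exact Submodule.sub_mem _ ((ExtraDegenerate.degen (C := C) hr hx).coextra_normOp_mem hx')
    (cyc_coextra_mem (normOp_mem C hx'))

theorem iotaOp_redCycKer (hM : IsMCochain C φ) (hφ : IsReduced φ) :
    redCycKer C ≤ (redCycKer C).comap (iotaOp φ M) := by
  refine redCycKer_le_comap C (iotaOp_imT hM) fun n r x hr hx => ?_
  by_cases h : r + p ≤ n
  · rw [iotaOp, cap_slot _ φ (by omega) hx]
    exact degen_mem_degenerate (by omega) (cap_mem φ (by omega) hx)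
  · rw [iotaOp, cap_degen hφ (by omega) hr hx]
    exact Submodule.zero_mem _

theorem SOp_redCycKer (hM : IsMCochain C φ) (hφ : IsReduced φ) :
    redCycKer C ≤ (redCycKer C).comap (SOp C φ) := by
  refine redCycKer_le_comap C (SOp_imT hM) fun n r x hr hx => ?_
  rw [SOp_eq, Module.End.mul_apply, Module.End.mul_apply, ← degen_cycT C hr hx]
  exact (ExtraDegenerate.degen (C := C) hr (cycT_mem C hx)).coextra_homotopy_mem hφ
    (slot_mem (r := r) (q := 0) _ (by omega) (cycT_mem C hx))

end Descent

end HopfAlgd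

namespace HopfAlgd

/-! ### The homotopy formula -/

section HomotopyFormula

open LeftHopfAlgebroid LeftBialgebroid

variable {k A U : Type*} [CommRing k] [Ring A] [Algebra k A] [Ring U] [Algebra k U]
  {M : Type*} [AddCommGroup M] [Module k M] [Module Uᵐᵒᵖ M] [IsScalarTower k Uᵐᵒᵖ M]
  {H : LeftHopfAlgebroid k A U} (C : ModuleComodule H.toLeftBialgebroid M)
  {p : ℕ} (φ : Cochain (k := k) H.η p)

theorem sum_Icc_one {G : Type*} [AddCommMonoid G] (f : ℕ → G) (n : ℕ) :
    ∑ i ∈ Finset.Icc 1 n, f i = ∑ i ∈ Finset.range n, f (i + 1) := by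
  rw [Finset.range_eq_Ico, Finset.sum_Ico_add' f 0 n 1]
  rfl

/-- Powers of `t` are pulled through `D'_φ`. In the first sum they complete to a full `T` on the
right; in the second they bring the insertion to the front and leave one `t` outside. -/
theorem lieOp_apply {K : ℕ} {x : Chains H.toLeftBialgebroid M}
    (hx : x ∈ homog H.η (modAct H.η M) (K + p)) :
    lieOp C φ x = ∑ i ∈ Finset.range (K + 1), ins φ M (K + p) i (cycT C x) +
      ∑ r ∈ Finset.range p, lam C (ins φ M (K + p) 0 ((lam C ^ (K + 1 + r)) x)) := by
  rw [lieOp, gr_apply _ hx, if_pos (by omega), Nat.add_sub_cancel, LinearMap.add_apply,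
    LinearMap.sum_apply, LinearMap.sum_apply, sum_Icc_one, sum_Icc_one]
  congr 1
  · refine Finset.sum_congr rfl fun i hi => ?_
    rw [Finset.mem_range] at hi
    have e := cyc_pow_slot C (H.DD_isSlotMap φ) (DD_transCompat H φ p) (r := i) (K - i) (by omega)
      (cyc_pow_mem C (i + 1 + p) hx)
    rw [show i + (K - i) = K by omega, ← insertLast_apply φ (cyc_pow_mem C _ hx), pow_apply_add,
      show K - i + (i + 1 + p) = K + p + 1 by omega, ← cycT_apply C hx] at e
    rw [ins_apply, ← e, show K + 1 - (i + 1) = K - i by omega]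
    refine zsmul_negOnePow ?_ _
    push_cast
    exact ⟨p * (K + p) + i, by ring⟩
  · refine Finset.sum_congr rfl fun i _ => ?_
    have hy := cyc_pow_mem C (i + 1) hx
    have e := cyc_pow_slot C (H.DD_isSlotMap φ) (DD_transCompat H φ p) (r := 0) K (by omega) hy
    rw [zero_add, ← insertLast_apply φ hy, pow_apply_add] at e
    rw [lam_apply C (ins_mem φ (N := K + 1) (by omega) (by omega) (lam_pow_mem C _ hx)),
      lam_pow_apply C _ hx, map_zsmul, map_zsmul, ins_apply, map_zsmul, smul_smul, smul_smul,
      ← pow_add, ← pow_add, show K + 1 + i = K + (i + 1) by omega, ← e,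
      ← Module.End.mul_apply (cyc C), ← pow_succ']
    refine zsmul_negOnePow ?_ _
    obtain ⟨w, hw⟩ := Int.even_mul_succ_self (K + p)
    push_cast
    exact ⟨w + (K + p) * (i + 1), by linear_combination hw⟩

variable {φ}

/-- The operator `ι_φ B` modulo the image of `id - T`. -/
theorem iotaOp_coextra_normOp (hφ : IsMCochain C φ) {K : ℕ} {x : Chains H.toLeftBialgebroid M}
    (hx : x ∈ homog H.η (modAct H.η M) (K + p)) :
    iotaOp φ M (coextra C (normOp C x)) -
      (-1 : ℤ) ^ (p + 1) • lam C (ins φ M (K + p) 0 (normOp C x)) ∈ imT C := by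
  have hz := normOp_mem C hx
  -- Modulo `im(id - T)` the operator `T` may be put in front of `ι_φ J N`, where
  -- `cycT_iotaOp_coextra` evaluates it.
  have h₁ := sub_cycT_mem_imT C (iotaOp φ M (coextra C (normOp C x)))
  rw [cycT_iotaOp_coextra C φ hz] at h₁
  have e : cyc C (slot (modAct H.η M) 0 p (H.DD_isSlotMap φ) ((cyc C ^ (K + 1)) (normOp C x))) =
      (-1 : ℤ) ^ (p + 1) • lam C (ins φ M (K + p) 0 ((lam C ^ (K + 1)) (normOp C x))) := by
    rw [lam_apply C (ins_mem φ (N := K + 1) (by omega) (by omega) (lam_pow_mem C _ hz)),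
      lam_pow_apply C _ hz, map_zsmul, map_zsmul, ins_apply, map_zsmul, smul_smul, smul_smul,
      smul_smul, ← pow_add, ← pow_add, ← pow_add, Even.neg_one_pow, one_smul]
    convert Nat.even_mul_succ_self (K + p + 1) using 1
    ring
  -- `λ N - N` telescopes to `λⁿ⁺¹ - 1 = T - 1` for `n = K + p`, as `n(n + 1)` is even. So powers of
  -- `λ` in front of `N` are invisible modulo `im(id - T)`.
  have shift : ∀ m, (lam C ^ m) (normOp C x) - normOp C x ∈ imT C := by
    intro m
    induction m with
    | zero => simp
    | succ m ih =>
      have h : lam C (normOp C x) - normOp C x ∈ imT C := by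
        rw [normOp_apply C hx, map_sum, ← Finset.sum_sub_distrib]
        simp only [← Module.End.mul_apply, ← pow_succ']
        rw [Finset.sum_range_sub (fun r => (lam C ^ r) x), lam_pow_apply C _ hx, mul_comm,
          (Nat.even_mul_succ_self (K + p)).neg_one_pow, one_smul, ← cycT_apply C hx, pow_zero,
          Module.End.one_apply, ← neg_sub]
        exact Submodule.neg_mem _ (sub_cycT_mem_imT C x)
      have h' : (lam C ^ m) (lam C (normOp C x) - normOp C x) ∈ imT C := lam_pow_imT C m h
      rw [map_sub, ← Module.End.mul_apply, ← pow_succ] at h'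
      have := Submodule.add_mem _ h' ih
      rwa [sub_add_sub_cancel] at this
  have h₂ : lam C (ins φ M (K + p) 0 ((lam C ^ (K + 1)) (normOp C x) - normOp C x)) ∈ imT C :=
    lam_imT C (ins_imT hφ _ _ (shift _))
  rw [e] at h₁
  rw [map_sub, map_sub] at h₂
  have := Submodule.add_mem _ h₁ (zsmul_mem h₂ ((-1 : ℤ) ^ (p + 1)))
  rwa [smul_sub, sub_add_sub_cancel] at this

theorem mkQ_eq_zero {x : Chains H.toLeftBialgebroid M} (hx : x ∈ imT C) :
    (redCycKer C).mkQ x = 0 :=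
  (Submodule.Quotient.mk_eq_zero _).2 (Submodule.mem_sup_left hx)

theorem mkQ_eq_zero_of_degenerate {x : Chains H.toLeftBialgebroid M}
    (hx : x ∈ degenerate H.toLeftBialgebroid M) : (redCycKer C).mkQ x = 0 :=
  (Submodule.Quotient.mk_eq_zero _).2 (Submodule.mem_sup_right hx)

theorem mkQ_BOp {n : ℕ} {x : Chains H.toLeftBialgebroid M}
    (hx : x ∈ homog H.η (modAct H.η M) n) :
    (redCycKer C).mkQ (BOp C x) = (redCycKer C).mkQ (coextra C (normOp C x)) := by
  rw [BOp_apply, map_sub, mkQ_eq_zero_of_degenerate C (cyc_coextra_mem (normOp_mem C hx)), sub_zero]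

variable (φ) in
/-- The right-hand side of the homotopy formula, as an operator on chains. -/
noncomputable def cartan : Module.End k (Chains H.toLeftBialgebroid M) :=
  (BOp C + bOp H.toLeftBialgebroid M) * (SOp C φ + iotaOp φ M) -
    (-1 : ℤ) ^ p • ((SOp C φ + iotaOp φ M) * (BOp C + bOp H.toLeftBialgebroid M)) -
    iotaOp (H.delta φ) M - SOp C (H.delta φ)

variable (φ) in
theorem cartan_apply (x : Chains H.toLeftBialgebroid M) : cartan C φ x =
    BOp C (SOp C φ x) + bOp H.toLeftBialgebroid M (SOp C φ x) +
      (BOp C (iotaOp φ M x) + bOp H.toLeftBialgebroid M (iotaOp φ M x)) -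
    (-1 : ℤ) ^ p • (SOp C φ (BOp C x) + SOp C φ (bOp H.toLeftBialgebroid M x) +
      (iotaOp φ M (BOp C x) + iotaOp φ M (bOp H.toLeftBialgebroid M x))) -
    iotaOp (H.delta φ) M x - SOp C (H.delta φ) x := by
  simp only [cartan, LinearMap.sub_apply, LinearMap.smul_apply, Module.End.mul_apply,
    LinearMap.add_apply, map_add]
  abel_nf

/-- An operator congruent to `f` modulo `im(id - T)` when precomposed with `T`. -/
theorem mkQ_cycT {f : Module.End k (Chains H.toLeftBialgebroid M)}
    (hf : imT C ≤ (imT C).comap f) (x : Chains H.toLeftBialgebroid M) :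
    (redCycKer C).mkQ (f (cycT C x)) = (redCycKer C).mkQ (f x) := by
  have h := mkQ_eq_zero C (hf (sub_cycT_mem_imT C x))
  rw [map_sub, map_sub, sub_eq_zero] at h
  exact h.symm

theorem mkQ_SOp (hφ : IsMCochain C φ) (x : Chains H.toLeftBialgebroid M) :
    (redCycKer C).mkQ (SOp C φ x) = (redCycKer C).mkQ (coextra C (homotopy C φ x)) := by
  rw [SOp_eq]
  exact mkQ_cycT C (f := coextra C * homotopy C φ)
    (fun y hy => coextra_imT C (homotopy_imT hφ hy)) x

/-- `S_φ J = J Y J T`, and `J Y J` is degenerate; with `B = J N` in the quotient this gives `S_φ B =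
0`. -/
theorem SOp_coextra_mem (hred : IsReduced φ) {n : ℕ} {z : Chains H.toLeftBialgebroid M}
    (hz : z ∈ homog H.η (modAct H.η M) n) :
    SOp C φ (coextra C z) ∈ degenerate H.toLeftBialgebroid M := by
  rw [SOp_eq, Module.End.mul_apply, Module.End.mul_apply, ← coextra_cycT C hz]
  exact (ExtraDegenerate.extra (cycT_mem C hz)).coextra_homotopy_mem hred
    (coextra_mem C (cycT_mem C hz))

theorem mkQ_of_BOp {f : Module.End k (Chains H.toLeftBialgebroid M)}
    (hf : redCycKer C ≤ (redCycKer C).comap f) {n : ℕ} {x : Chains H.toLeftBialgebroid M}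
    (hx : x ∈ homog H.η (modAct H.η M) n) :
    (redCycKer C).mkQ (f (BOp C x)) = (redCycKer C).mkQ (f (coextra C (normOp C x))) := by
  have hd : cyc C (coextra C (normOp C x)) ∈ redCycKer C :=
    Submodule.mem_sup_right (cyc_coextra_mem (normOp_mem C hx))
  have h : (redCycKer C).mkQ (f (cyc C (coextra C (normOp C x)))) = 0 :=
    (Submodule.Quotient.mk_eq_zero _).2 (hf hd)
  rw [BOp_apply, map_sub, map_sub, h, sub_zero]

theorem mkQ_SOp_BOp (hφ : IsMCochain C φ) (hred : IsReduced φ) {n : ℕ}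
    {x : Chains H.toLeftBialgebroid M} (hx : x ∈ homog H.η (modAct H.η M) n) :
    (redCycKer C).mkQ (SOp C φ (BOp C x)) = 0 := by
  rw [mkQ_of_BOp C (SOp_redCycKer hφ hred) hx]
  exact mkQ_eq_zero_of_degenerate C (SOp_coextra_mem C hred (normOp_mem C hx))

/-- In the quotient `B S_φ` is `J N J Y T`, and rotations of extra degeneracies become degenerate
under the outer `J`. -/
theorem mkQ_BOp_SOp {K : ℕ} {x : Chains H.toLeftBialgebroid M}
    (hx : x ∈ homog H.η (modAct H.η M) (K + p)) :
    (redCycKer C).mkQ (BOp C (SOp C φ x)) = 0 := by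
  have hY := homotopy_mem C φ (N := K + 1) (by omega) (cycT_mem C hx)
  have hJ := coextra_mem C hY
  rw [SOp_eq, Module.End.mul_apply, Module.End.mul_apply, mkQ_BOp C hJ]
  exact mkQ_eq_zero_of_degenerate C
    ((ExtraDegenerate.extra (C := C) hY).coextra_normOp_mem hJ)

/-- With `T` dropped, `bOp_coextra` gives `b J Y = (1 - λ) Y - J b' Y`. Here `sum_sface_homotopy`
replaces `b' Y` by `N ι_φ - (-1)^p Y b - Y_{δφ}`, and applying `J` turns these terms into `B ι_φ`,
`S_φ b` and `S_{δφ}`. -/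
theorem mkQ_bOp_SOp (hφ : IsMCochain C φ) {K : ℕ}
    {x : Chains H.toLeftBialgebroid M} (hx : x ∈ homog H.η (modAct H.η M) (K + p)) :
    (redCycKer C).mkQ (bOp H.toLeftBialgebroid M (SOp C φ x)) =
      (-1 : ℤ) ^ p • (redCycKer C).mkQ (SOp C φ (bOp H.toLeftBialgebroid M x)) +
      (redCycKer C).mkQ (SOp C (H.delta φ) x) +
      (redCycKer C).mkQ (homotopy C φ x - lam C (homotopy C φ x)) -
      (redCycKer C).mkQ (BOp C (iotaOp φ M x)) := by
  have hδ := delta_isMCochain hφ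
  have e := mkQ_cycT C (f := bOp H.toLeftBialgebroid M * (coextra C * homotopy C φ))
    (fun y hy => bOp_imT C (coextra_imT C (homotopy_imT hφ hy))) x
  have hY := homotopy_mem C φ (N := K + 1) (by omega) hx
  have hs := sum_sface_homotopy C φ hx
  rw [← eq_sub_iff_add_eq] at hs
  rw [SOp_eq]
  refine e.trans ?_
  rw [← SOp_eq, Module.End.mul_apply, Module.End.mul_apply, bOp_coextra C hY, hs,
    mkQ_SOp C hφ, mkQ_SOp C hδ, mkQ_BOp C (iotaOp_mem φ hx), map_sub, map_sub (coextra C), map_add,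
    map_sub (redCycKer C).mkQ (_ + _), map_add (redCycKer C).mkQ, map_zsmul, map_zsmul, pow_succ,
    mul_neg_one, neg_smul]
  abel

/-- `(1 - λ) Y` subtracts the terms `λ D λʳ` with `r ≤ K` for the insertion `D` in the first place,
whereas `-(-1)^p ι_φ B` adds them for all `r ≤ K + p`. The surplus `r > K` is the second sum of
`L_φ`. -/
theorem mkQ_lieOp (hφ : IsMCochain C φ) (hred : IsReduced φ) {K : ℕ} {x : Chains H.toLeftBialgebroid M}
    (hx : x ∈ homog H.η (modAct H.η M) (K + p)) :
    (redCycKer C).mkQ (lieOp C φ x) =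
      (redCycKer C).mkQ (homotopy C φ x - lam C (homotopy C φ x)) -
      (-1 : ℤ) ^ p • (redCycKer C).mkQ (iotaOp φ M (BOp C x)) := by
  have h₁ := mkQ_eq_zero C (iotaOp_coextra_normOp C hφ hx)
  have h₂ : normOp C x = ∑ r ∈ Finset.range (K + 1), (lam C ^ r) x +
      ∑ r ∈ Finset.range p, (lam C ^ (K + 1 + r)) x := by
    rw [normOp_apply C hx, show K + p + 1 = K + 1 + p by omega, Finset.sum_range_add]
  have h₃ : ∀ i, (redCycKer C).mkQ (ins φ M (K + p) i (cycT C x)) =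
      (redCycKer C).mkQ (ins φ M (K + p) i x) := fun i => mkQ_cycT C (ins_imT hφ _ _) x
  rw [map_sub, map_zsmul, sub_eq_zero] at h₁
  rw [mkQ_of_BOp C (iotaOp_redCycKer hφ hred) hx, h₁, smul_smul, ← pow_add,
    Odd.neg_one_pow ⟨p, by ring⟩, neg_one_smul, sub_neg_eq_add, lieOp_apply C φ hx,
    homotopy_sub_lam C φ hx, h₂]
  simp only [map_add, map_sub, map_sum, h₃]
  abel

theorem SOp_eq_zero (φ : Cochain (k := k) H.η p) {n : ℕ} (h : n < p)
    {x : Chains H.toLeftBialgebroid M} (hx : x ∈ homog H.η (modAct H.η M) n) :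
    SOp C φ x = 0 := by
  rw [SOp, gr_apply _ hx, if_neg (by omega), LinearMap.zero_apply]

theorem BOp_mem {n : ℕ} {x : Chains H.toLeftBialgebroid M}
    (hx : x ∈ homog H.η (modAct H.η M) n) :
    BOp C x ∈ homog H.η (modAct H.η M) (n + 1) := by
  have h := coextra_mem C (normOp_mem C hx)
  rw [BOp_apply]
  exact Submodule.sub_mem _ h (cyc_mem C h)

/-- The homotopy formula in the degrees below `p`. -/
theorem mkQ_lieOp_of_lt (hφ : IsMCochain C φ) (hred : IsReduced φ) {n : ℕ} (h : n < p)
    {x : Chains H.toLeftBialgebroid M} (hx : x ∈ homog H.η (modAct H.η M) n) :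
    (redCycKer C).mkQ (lieOp C φ x) = (redCycKer C).mkQ (cartan C φ x) := by
  have hb : SOp C φ (bOp H.toLeftBialgebroid M x) = 0 ∧
      iotaOp φ M (bOp H.toLeftBialgebroid M x) = 0 := by
    rcases n with _ | n
    · rw [bOp_zero hx, map_zero, map_zero]
      exact ⟨rfl, rfl⟩
    · exact ⟨SOp_eq_zero C φ (by omega) (bOp_mem hx), iotaOp_eq_zero φ (by omega) (bOp_mem hx)⟩
  rw [cartan_apply, hb.1, hb.2, SOp_eq_zero C φ h hx, SOp_eq_zero C _ (by omega) hx,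
    iotaOp_eq_zero φ h hx, iotaOp_eq_zero _ (by omega) hx]
  simp only [map_zero, add_zero, zero_sub, sub_zero]
  rw [map_neg, map_zsmul, map_add, mkQ_SOp_BOp C hφ hred hx, zero_add, ← map_zsmul, ← map_neg,
    lieOp, gr_apply _ hx, if_neg (by omega)]
  -- Only `ι_φ B` is left. For `p = n + 1` it is `L_φ` by definition, the signs `(-1)^{p-1}` and
  -- `-(-1)^p` being equal; for larger `p` the degree is still too small for `ι_φ`.
  split_ifs with hn
  · congr 1
    change Int.negOnePow _ • iotaOp φ M (BOp C x) = _
    rw [← neg_smul, ← mul_neg_one, ← pow_succ]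
    refine zsmul_negOnePow ?_ _
    push_cast
    exact ⟨p, by ring⟩
  · rw [iotaOp_eq_zero φ (by omega) (BOp_mem C hx), smul_zero, neg_zero, LinearMap.zero_apply]

theorem mkQ_lieOp_eq (hφ : IsMCochain C φ) (hred : IsReduced φ)
    (x : Chains H.toLeftBialgebroid M) :
    (redCycKer C).mkQ (lieOp C φ x) = (redCycKer C).mkQ (cartan C φ x) := by
  suffices h : (redCycKer C).mkQ ∘ₗ lieOp C φ = (redCycKer C).mkQ ∘ₗ cartan C φ from
    LinearMap.congr_fun h x
  refine wext fun m l => ?_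
  obtain ⟨n, hn⟩ : ∃ n, l.length = n := ⟨_, rfl⟩
  have hx := wmk_mem_homog (η := H.η) (ρ := modAct H.η M) m hn
  clear hn
  rw [LinearMap.comp_apply, LinearMap.comp_apply]
  generalize wmk H.η (modAct H.η M) m l = x at hx ⊢
  by_cases hp : p ≤ n
  · obtain ⟨K, rfl⟩ : ∃ K, n = K + p := ⟨n - p, by omega⟩
    -- The terms `B ι_φ` from `[b, S_φ]` and from `[B, ι_φ]` cancel, as do `S_{δφ}` and `ι_{δφ}`
    -- against the subtracted ones.
    rw [cartan_apply, bOp_iotaOp φ hx, mkQ_lieOp C hφ hred hx]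
    simp only [map_add, map_sub (redCycKer C).mkQ, map_zsmul]
    rw [mkQ_BOp_SOp C hx, mkQ_SOp_BOp C hφ hred hx, mkQ_bOp_SOp C hφ hx, map_sub]
    simp only [smul_add, smul_zero]
    abel
  · exact mkQ_lieOp_of_lt C hφ hred (by omega) hx

theorem cartan_redCycKer (hφ : IsMCochain C φ) (hred : IsReduced φ) :
    redCycKer C ≤ (redCycKer C).comap (cartan C φ) := by
  intro x hx
  have hb : ∀ {y}, y ∈ redCycKer C → bOp H.toLeftBialgebroid M y ∈ redCycKer C :=
    fun h => bOp_redCycKer C h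
  have hB : ∀ {y}, y ∈ redCycKer C → BOp C y ∈ redCycKer C := fun h => BOp_redCycKer C h
  have hS : ∀ {y}, y ∈ redCycKer C → SOp C φ y ∈ redCycKer C := fun h => SOp_redCycKer hφ hred h
  have hι : ∀ {y}, y ∈ redCycKer C → iotaOp φ M y ∈ redCycKer C :=
    fun h => iotaOp_redCycKer hφ hred h
  have hM := delta_isMCochain hφ
  have hR := delta_isReduced hred
  rw [Submodule.mem_comap, cartan_apply]
  exact Submodule.sub_mem _ (Submodule.sub_mem _ (Submodule.sub_mem _
    (Submodule.add_mem _ (Submodule.add_mem _ (hB (hS hx)) (hb (hS hx)))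
      (Submodule.add_mem _ (hB (hι hx)) (hb (hι hx))))
    (zsmul_mem (Submodule.add_mem _ (Submodule.add_mem _ (hS (hB hx)) (hS (hb hx)))
      (Submodule.add_mem _ (hι (hB hx)) (hι (hb hx)))) _))
    (iotaOp_redCycKer hM hR hx)) (SOp_redCycKer hM hR hx)

end HomotopyFormula

end HopfAlgd

/-! ### The formula on the reduced cyclic quotient -/

theorem mainTheorem2 {k A U M : Type*} [CommRing k] [Ring A] [Algebra k A] [Ring U] [Algebra k U]
    [AddCommGroup M] [Module k M] [Module Uᵐᵒᵖ M] [IsScalarTower k Uᵐᵒᵖ M]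
    (H : HopfAlgd.LeftHopfAlgebroid k A U)
    (C : HopfAlgd.ModuleComodule H.toLeftBialgebroid M)
    (p : ℕ) (φ : HopfAlgd.Cochain (k := k) H.η p)
    (hφM : HopfAlgd.IsMCochain C φ) (hφred : HopfAlgd.IsReduced φ) :
    ∃ (hb : HopfAlgd.redCycKer C ≤
          (HopfAlgd.redCycKer C).comap (HopfAlgd.bOp H.toLeftBialgebroid M))
      (hB : HopfAlgd.redCycKer C ≤ (HopfAlgd.redCycKer C).comap (HopfAlgd.BOp C))
      (hι : HopfAlgd.redCycKer C ≤ (HopfAlgd.redCycKer C).comap (HopfAlgd.iotaOp φ M))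
      (hS : HopfAlgd.redCycKer C ≤ (HopfAlgd.redCycKer C).comap (HopfAlgd.SOp C φ))
      (hL : HopfAlgd.redCycKer C ≤ (HopfAlgd.redCycKer C).comap (HopfAlgd.lieOp C φ))
      (hιδ : HopfAlgd.redCycKer C ≤
          (HopfAlgd.redCycKer C).comap (HopfAlgd.iotaOp (H.delta φ) M))
      (hSδ : HopfAlgd.redCycKer C ≤ (HopfAlgd.redCycKer C).comap (HopfAlgd.SOp C (H.delta φ))),
      HopfAlgd.onRedCyc C (HopfAlgd.lieOp C φ) hL =
        HopfAlgd.gradedComm 1 p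
          (HopfAlgd.onRedCyc C (HopfAlgd.BOp C) hB +
            HopfAlgd.onRedCyc C (HopfAlgd.bOp H.toLeftBialgebroid M) hb)
          (HopfAlgd.onRedCyc C (HopfAlgd.SOp C φ) hS +
            HopfAlgd.onRedCyc C (HopfAlgd.iotaOp φ M) hι)
        - HopfAlgd.onRedCyc C (HopfAlgd.iotaOp (H.delta φ) M) hιδ
        - HopfAlgd.onRedCyc C (HopfAlgd.SOp C (H.delta φ)) hSδ := by
  have hb := HopfAlgd.bOp_redCycKer C
  have hB := HopfAlgd.BOp_redCycKer C
  have hι := HopfAlgd.iotaOp_redCycKer hφM hφred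
  have hS := HopfAlgd.SOp_redCycKer hφM hφred
  have hM := HopfAlgd.delta_isMCochain hφM
  have hred := HopfAlgd.delta_isReduced hφred
  have hιδ := HopfAlgd.iotaOp_redCycKer hM hred
  have hSδ := HopfAlgd.SOp_redCycKer hM hred
  have hR := HopfAlgd.cartan_redCycKer C hφM hφred
  -- `L_φ` agrees with the right-hand side modulo the kernel on all chains, and the right-hand side
  -- preserves the kernel, so `L_φ` descends without a separate argument.
  have hL : HopfAlgd.redCycKer C ≤ (HopfAlgd.redCycKer C).comap (HopfAlgd.lieOp C φ) := by
    intro x hx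
    have h := HopfAlgd.mkQ_lieOp_eq C hφM hφred x
    exact (Submodule.Quotient.mk_eq_zero (HopfAlgd.redCycKer C)).1
      (h.trans ((Submodule.Quotient.mk_eq_zero _).2 (hR hx)))
  refine ⟨hb, hB, hι, hS, hL, hιδ, hSδ, ?_⟩
  refine Submodule.linearMap_qext _ (LinearMap.ext fun x => ?_)
  refine (HopfAlgd.mkQ_lieOp_eq C hφM hφred x).trans ?_
  -- `gradedComm` takes its sign in the endomorphism ring, `cartan` as an integer scalar.
  have e (X : Module.End k (HopfAlgd.RedCyc C)) : (-1) ^ p * X = (-1 : ℤ) ^ p • X := by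
    rw [zsmul_eq_mul]
    push_cast
    rfl
  rw [HopfAlgd.gradedComm, one_mul, e, HopfAlgd.cartan_apply]
  simp only [HopfAlgd.onRedCyc, LinearMap.comp_apply, LinearMap.sub_apply, LinearMap.smul_apply,
    Module.End.mul_apply, LinearMap.add_apply, map_add, map_sub, map_zsmul, Submodule.mkQ_apply,
    Submodule.mapQ_apply]
  abel_nf
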